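/- **Definitions.** A *vincular 3-pattern* $\phi$ is a permutation $abc\in S_3$ in one-line notation, enclosed by brackets (each round or square), with or without a dash between $a,b$ and between $b,c$. An *occurrence* of $\phi$ in $\pi=\pi_1\cdots\pi_n\in S_n$ is a subsequence $\pi_{i_1}\pi_{i_2}\pi_{i_3}$, $i_1<i_2<i_3$, in the same relative order as $abc$, such that $i_1=1$ if $\phi$ begins with a square bracket, $i_2=i_1+1$ if there is no dash between $a$ and $b$, $i_3=i_2+1$ if there is no dash between $b$ and $c$, and $i_3=n$ if $\phi$ ends with a square bracket. The classical pattern $abc$ is $(a\text{-}b\text{-}c)$. Let $\#\phi(\pi)$ be the number of occurrences of $\phi$ in $\pi$, and let the mean statistic $\overline{\#\phi}$ be the class function on $S_n$ whose value at $\pi$ is the mean of $\#\phi$ over the conjugacy class of $\pi$. For a partition $\lambda$ of $n$, $\chi^\lambda$ is the irreducible character of $S_n$ indexed by $\lambda$ (the character of the Specht module $S^\lambda$). Write $(n)_k=n(n-1)\cdots(n-k+1)$. **Theorem.** Let $n\ge 3$, and let $\phi$ be a vincular 3-pattern, not of the form $[abc]$ (two square brackets and no dash). Then $$\overline{\#\phi}=a_1\,\chi^{(n)}+a_2\,\chi^{(n-1,1)}+a_3\,\chi^{(n-2,2)}+a_4\,\chi^{(n-2,1,1)}+a_5\,\chi^{(n-3,2,1)},$$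 where $a_1,\dots,a_5$ are the entries of the row that contains $\phi$ in the two tables below, and every such $\phi$ is listed there. For $n\le 4$, the index sequences that are not partitions are read as follows: if $n=3$ then $\chi^{(n-2,2)}=0$ and $\chi^{(n-3,2,1)}=-\chi^{(n-2,1,1)}$; if $n=4$ then $\chi^{(n-3,2,1)}=0$. (For $n\ge5$ all five are irreducible characters.) For the remaining patterns, $\overline{\#[abc]}=\overline{\#(abc)}$ if $n=3$, and $\overline{\#[abc]}=0$ if $n>3$. Table 1. $$\begin{array}{l|ccccc} \phi & a_1 & a_2 & a_3 & a_4 & a_5\\ \hline {(\text{1-2-3})} & \frac{1}{6}\tbinom{n}{3} & \frac{(n+1)(3n-4)}{60} & \frac{n+1}{30} & \frac{3n-2}{30} & \frac{1}{15}\\ {(\text{1-3-2}),\ (\text{2-1-3})} & \frac{1}{6}\tbinom{n}{3} & \frac{(n+1)(n-3)}{60} & -\frac{n+1}{60} & -\frac{n+1}{20} & -\frac{1}{30}\\ {(\text{2-3-1}),\ (\text{3-1-2})} & \frac{1}{6}\tbinom{n}{3} & -\frac{(n+1)(3n-4)}{120} & -\frac{n+1}{60} & \frac{n+1}{30} & -\frac{1}{30}\\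 {(\text{3-2-1})} & \frac{1}{6}\tbinom{n}{3} & -\frac{(n+1)(n-3)}{30} & \frac{n+1}{30} & -\frac{2n-3}{30} & \frac{1}{15}\\ {(\text{12-3}),\ (\text{1-23})} & \frac{1}{6}\tbinom{n-1}{2} & \frac{n^2+3n-6}{12n} & \frac{n+2}{12n} & \frac{5n-6}{12n} & \frac{1}{4n}\\ {(\text{13-2}),\ (\text{2-13})} & \frac{1}{6}\tbinom{n-1}{2} & \frac{n-3}{6n} & -\frac{n-1}{6n} & -\frac{1}{2n} & 0\\ {(\text{21-3}),\ (\text{1-32})} & \frac{1}{6}\tbinom{n-1}{2} & \frac{n(n-3)}{12n} & \frac{n-4}{12n} & -\frac{1}{4} & -\frac{1}{4n}\\ {(\text{23-1}),\ (\text{3-12})} & \frac{1}{6}\tbinom{n-1}{2} & -\frac{n(n-1)}{12n} & \frac{n-4}{12n} & \frac{1}{12} & -\frac{1}{4n}\\ {(\text{31-2}),\ (\text{2-31})} & \frac{1}{6}\tbinom{n-1}{2} & -\frac{2n-3}{6n} & -\frac{n-1}{6n} & \frac{1}{2n} & 0\\ {(\text{32-1}),\ (\text{3-21})} & \frac{1}{6}\tbinom{n-1}{2}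 & -\frac{(n+2)(n-3)}{12n} & \frac{n+2}{12n} & -\frac{n-2}{4n} & \frac{1}{4n}\\ {[\text{1-2-3}),\ (\text{1-2-3}]} & \frac{1}{6}\tbinom{n-1}{2} & \frac{5n-7}{24} & \frac{1}{8} & \frac{5}{24} & \frac{1}{8n}\\ {[\text{1-3-2}),\ (\text{2-1-3}]} & \frac{1}{6}\tbinom{n-1}{2} & \frac{n-3}{8} & -\frac{1}{8} & -\frac{5}{24} & -\frac{1}{8n}\\ {[\text{2-1-3}),\ (\text{1-3-2}]} & \frac{1}{6}\tbinom{n-1}{2} & 0 & 0 & -\frac{1}{6} & 0\\ {[\text{2-3-1}),\ (\text{3-1-2}]} & \frac{1}{6}\tbinom{n-1}{2} & -\frac{n-2}{6} & 0 & \frac{1}{6} & 0\\ {[\text{3-1-2}),\ (\text{2-3-1}]} & \frac{1}{6}\tbinom{n-1}{2} & -\frac{n+1}{24} & -\frac{1}{8} & \frac{1}{8} & -\frac{1}{8n}\\ {[\text{3-2-1}),\ (\text{3-2-1}]} & \frac{1}{6}\tbinom{n-1}{2} & -\frac{n-3}{8} & \frac{1}{8} & -\frac{1}{8} & \frac{1}{8n}\\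 {(\text{12-3}],\ [\text{1-23})} & \frac{n-2}{6} & \frac{1}{3} & \frac{n+2}{6(n)_{2}} & \frac{1}{2(n-1)} & \frac{1}{2(n)_{2}}\\ {(\text{13-2}],\ [\text{2-13})} & \frac{n-2}{6} & -\frac{n-3}{6n} & -\frac{2n-5}{6(n)_{2}} & -\frac{1}{2(n)_{2}} & \frac{1}{2(n)_{2}}\\ {(\text{21-3}],\ [\text{1-32})} & \frac{n-2}{6} & \frac{(2n+1)(n-3)}{6(n)_{2}} & \frac{n-7}{6(n)_{2}} & -\frac{n+1}{2(n)_{2}} & -\frac{1}{(n)_{2}}\\ {(\text{23-1}],\ [\text{3-12})} & \frac{n-2}{6} & -\frac{n^2-4n+9}{6(n)_{2}} & \frac{n-7}{6(n)_{2}} & \frac{n-3}{2(n)_{2}} & -\frac{1}{(n)_{2}}\\ {(\text{31-2}],\ [\text{2-31})} & \frac{n-2}{6} & -\frac{n^2+2n-9}{6(n)_{2}} & -\frac{2n-5}{6(n)_{2}} & \frac{3}{2(n)_{2}} & \frac{1}{2(n)_{2}}\\ {(\text{32-1}],\ [\text{3-21})} & \frac{n-2}{6} & -\frac{(n+2)(n-3)}{6(n)_{2}}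 & \frac{n+2}{6(n)_{2}} & -\frac{n-2}{2(n)_{2}} & \frac{1}{2(n)_{2}}\\ {[\text{12-3}),\ (\text{1-23}]} & \frac{n-2}{6} & \frac{n^2+5n-12}{6(n)_{2}} & \frac{1}{3n} & \frac{n-2}{(n)_{2}} & 0\\ {[\text{13-2}),\ (\text{2-13}]} & \frac{n-2}{6} & \frac{(n+2)(n-3)}{6(n)_{2}} & -\frac{2}{3n} & -\frac{1}{(n)_{2}} & 0\\ {[\text{21-3}),\ (\text{1-32}]} & \frac{n-2}{6} & \frac{(n-3)(n-4)}{6(n)_{2}} & \frac{1}{3n} & -\frac{n-2}{(n)_{2}} & 0\\ {[\text{23-1}),\ (\text{3-12}]} & \frac{n-2}{6} & -\frac{n^2-n-3}{3(n)_{2}} & \frac{1}{3n} & \frac{1}{(n)_{2}} & 0\\ {[\text{31-2}),\ (\text{2-31}]} & \frac{n-2}{6} & \frac{n-6}{6n} & -\frac{2}{3n} & \frac{1}{(n)_{2}} & 0\\ {[\text{32-1}),\ (\text{3-21}],\ [\text{3-2-1}]} & \frac{n-2}{6} & -\frac{n-3}{3n} & \frac{1}{3n} & -\frac{1}{(n)_{2}}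 & 0\\ {[\text{1-2-3}]} & \frac{n-2}{6} & \frac{2n-3}{3n} & \frac{1}{3n} & \frac{1}{(n)_{2}} & 0\\ {[\text{1-3-2}],\ [\text{2-1-3}]} & \frac{n-2}{6} & \frac{n-3}{6n} & -\frac{1}{6n} & -\frac{1}{2n} & 0\\ {[\text{2-3-1}],\ [\text{3-1-2}]} & \frac{n-2}{6} & -\frac{2n-3}{6n} & -\frac{1}{6n} & \frac{1}{2n} & 0 \end{array}$$ Table 2. $$\begin{array}{l|ccccc} \phi & a_1 & a_2 & a_3 & a_4 & a_5\\ \hline {(\text{123})} & \frac{n-2}{6} & \frac{1}{n} & \frac{1}{(n)_{2}} & \frac{1}{n} & \frac{1}{(n)_{2}}\\ {(\text{132}),\ (\text{213})} & \frac{n-2}{6} & \frac{n-3}{2(n)_{2}} & -\frac{1}{2(n)_{2}} & -\frac{3}{2(n)_{2}} & -\frac{1}{2(n)_{2}}\\ {(\text{231}),\ (\text{312})} & \frac{n-2}{6} & -\frac{1}{2n} & -\frac{1}{2(n)_{2}} & \frac{1}{2(n)_{2}} & -\frac{1}{2(n)_{2}}\\ {(\text{321})} & \frac{n-2}{6} &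 -\frac{n-3}{(n)_{2}} & \frac{1}{(n)_{2}} & -\frac{n-3}{(n)_{2}} & \frac{1}{(n)_{2}}\\ {[\text{123}),\ (\text{123}]} & \frac{1}{6} & \frac{1}{n(n-2)} & \frac{1}{(n)_{3}} & \frac{1}{n(n-2)} & \frac{1}{(n)_{3}}\\ {[\text{132}),\ (\text{213}]} & \frac{1}{6} & \frac{2n-6}{(n)_{3}} & -\frac{2}{(n)_{3}} & \frac{n-6}{(n)_{3}} & -\frac{2}{(n)_{3}}\\ {[\text{213}),\ (\text{132}],\ [\text{321}),\ (\text{321}]} & \frac{1}{6} & -\frac{n-3}{(n)_{3}} & \frac{1}{(n)_{3}} & -\frac{n-3}{(n)_{3}} & \frac{1}{(n)_{3}}\\ {[\text{231}),\ (\text{312}]} & \frac{1}{6} & -\frac{2n-5}{(n)_{3}} & \frac{1}{(n)_{3}} & -\frac{n-5}{(n)_{3}} & \frac{1}{(n)_{3}}\\ {[\text{312}),\ (\text{231}]} & \frac{1}{6} & \frac{n-4}{(n)_{3}} & -\frac{2}{(n)_{3}} & \frac{n-4}{(n)_{3}} & -\frac{2}{(n)_{3}}\\ {[\text{12-3}],\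 [\text{1-23}]} & \frac{1}{6} & \frac{n+1}{2(n)_{2}} & \frac{1}{2(n)_{2}} & \frac{1}{2(n)_{2}} & -\frac{1}{2(n)_{3}}\\ {[\text{13-2}],\ [\text{2-13}]} & \frac{1}{6} & 0 & -\frac{1}{(n)_{2}} & 0 & \frac{1}{(n)_{3}}\\ {[\text{21-3}],\ [\text{1-32}]} & \frac{1}{6} & \frac{n-3}{2(n)_{2}} & \frac{1}{2(n)_{2}} & -\frac{3}{2(n)_{2}} & -\frac{1}{2(n)_{3}}\\ {[\text{23-1}],\ [\text{3-12}]} & \frac{1}{6} & -\frac{1}{2n} & \frac{1}{2(n)_{2}} & \frac{1}{2(n)_{2}} & -\frac{1}{2(n)_{3}}\\ {[\text{31-2}],\ [\text{2-31}]} & \frac{1}{6} & -\frac{1}{(n)_{2}} & -\frac{1}{(n)_{2}} & \frac{2}{(n)_{3}} & \frac{1}{(n)_{3}}\\ {[\text{32-1}],\ [\text{3-21}]} & \frac{1}{6} & -\frac{n-3}{2(n)_{2}} & \frac{1}{2(n)_{2}} & \frac{n-6}{2(n)_{3}} & -\frac{1}{2(n)_{3}} \end{array}$$ -/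

import Mathlib

open Equiv (Perm)

noncomputable section

/-! ### Vincular patterns of length three -/

/-- A vincular 3-pattern: its letters in one-line notation (`word 0`, `word 1`, `word 2`, shifted
down by one), whether it begins with a square bracket, whether its first and second letters are
*not* separated by a dash, whether its second and third letters are *not* separated by a dash, and
whether it ends with a square bracket. -/
@[ext]
structure VincularPattern where
  word : Perm (Fin 3)
  startBracket : Bool
  bond₁₂ : Bool
  bond₂₃ : Bool
  endBracket : Bool

namespace VincularPattern

/-- The number of conditions given by square brackets and absent dashes. -/
def numConditions (φ : VincularPattern) : ℕ :=
  φ.startBracket.toNat + φ.bond₁₂.toNat + φ.bond₂₃.toNat + φ.endBracket.toNat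

/-- `π (i 0) π (i 1) π (i 2)` is an occurrence of `φ` in `π`, where positions and letters are
numbered `0, …, n - 1`. -/
def IsOccurrence (φ : VincularPattern) {n : ℕ} (π : Perm (Fin n)) (i : Fin 3 → Fin n) : Prop :=
  StrictMono i ∧
  (∀ a b : Fin 3, π (i a) < π (i b) ↔ φ.word a < φ.word b) ∧
  (φ.startBracket = true → (i 0 : ℕ) = 0) ∧
  (φ.bond₁₂ = true → (i 1 : ℕ) = i 0 + 1) ∧
  (φ.bond₂₃ = true → (i 2 : ℕ) = i 1 + 1) ∧
  (φ.endBracket = true → (i 2 : ℕ) + 1 = n)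

open scoped Classical in
/-- The number of occurrences of `φ` in `π`. -/
def count (φ : VincularPattern) {n : ℕ} (π : Perm (Fin n)) : ℕ :=
  (Finset.univ.filter fun i : Fin 3 → Fin n => φ.IsOccurrence π i).card

/-! The six words of length three, in one-line notation with letters `0, 1, 2`. -/

def w123 : Perm (Fin 3) := ⟨![0, 1, 2], ![0, 1, 2], by decide, by decide⟩
def w132 : Perm (Fin 3) := ⟨![0, 2, 1], ![0, 2, 1], by decide, by decide⟩
def w213 : Perm (Fin 3) := ⟨![1, 0, 2], ![1, 0, 2], by decide, by decide⟩
def w231 : Perm (Fin 3) := ⟨![1, 2, 0], ![2, 0, 1], by decide, by decide⟩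
def w312 : Perm (Fin 3) := ⟨![2, 0, 1], ![1, 2, 0], by decide, by decide⟩
def w321 : Perm (Fin 3) := ⟨![2, 1, 0], ![2, 1, 0], by decide, by decide⟩

/-! The sixteen dash and bracket types. In a name, `r` and `s` stand for a round and a square
bracket, `X` for a letter and `_` for a dash: `sXX_Xr w213` is the pattern `[21-3)`. -/

def rX_X_Xr (w : Perm (Fin 3)) : VincularPattern := ⟨w, false, false, false, false⟩
def rXX_Xr (w : Perm (Fin 3)) : VincularPattern := ⟨w, false, true, false, false⟩
def rX_XXr (w : Perm (Fin 3)) : VincularPattern := ⟨w, false, false, true, false⟩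
def rXXXr (w : Perm (Fin 3)) : VincularPattern := ⟨w, false, true, true, false⟩
def sX_X_Xr (w : Perm (Fin 3)) : VincularPattern := ⟨w, true, false, false, false⟩
def sXX_Xr (w : Perm (Fin 3)) : VincularPattern := ⟨w, true, true, false, false⟩
def sX_XXr (w : Perm (Fin 3)) : VincularPattern := ⟨w, true, false, true, false⟩
def sXXXr (w : Perm (Fin 3)) : VincularPattern := ⟨w, true, true, true, false⟩
def rX_X_Xs (w : Perm (Fin 3)) : VincularPattern := ⟨w, false, false, false, true⟩
def rXX_Xs (w : Perm (Fin 3)) : VincularPattern := ⟨w, false, true, false, true⟩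
def rX_XXs (w : Perm (Fin 3)) : VincularPattern := ⟨w, false, false, true, true⟩
def rXXXs (w : Perm (Fin 3)) : VincularPattern := ⟨w, false, true, true, true⟩
def sX_X_Xs (w : Perm (Fin 3)) : VincularPattern := ⟨w, true, false, false, true⟩
def sXX_Xs (w : Perm (Fin 3)) : VincularPattern := ⟨w, true, true, false, true⟩
def sX_XXs (w : Perm (Fin 3)) : VincularPattern := ⟨w, true, false, true, true⟩
def sXXXs (w : Perm (Fin 3)) : VincularPattern := ⟨w, true, true, true, true⟩

end VincularPattern

open scoped Classical in
/-- The mean statistic of `s`, as a function on `S_n` constant on conjugacy classes: its value at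
`π` is the mean of `s` over the conjugacy class of `π`. -/
def meanStatistic {n : ℕ} (s : Perm (Fin n) → ℝ) (π : Perm (Fin n)) : ℝ :=
  (∑ τ : Perm (Fin n) with IsConj π τ, s τ) /
    ((Finset.univ.filter fun τ : Perm (Fin n) => IsConj π τ).card : ℝ)

/-! ### Irreducible characters of the symmetric group, through Specht modules -/

namespace Specht

/-- The Young diagram whose row lengths are the parts of `l` in weakly decreasing order. -/
def diagram {n : ℕ} (l : n.Partition) : YoungDiagram :=
  YoungDiagram.ofRowLens (l.parts.sort (· ≥ ·)) (Multiset.pairwise_sort _ _).sortedGE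

/-- A tableau of shape `μ`: a bijective filling of the cells of `μ` with the elements of `Fin n`,
given by the map sending an element to its cell `(row, column)`. -/
abbrev Tableau (n : ℕ) (μ : YoungDiagram) : Type := Fin n ≃ μ.cells

/-- A tabloid of shape `μ`: a distribution of the elements of `Fin n` over the rows of `μ`, such
that the `i`-th row receives as many elements as it has cells. -/
abbrev Tabloid (n : ℕ) (μ : YoungDiagram) : Type :=
  {r : Fin n → ℕ // ∀ i : ℕ, (Finset.univ.filter fun x => r x = i).card = μ.rowLen i}

variable {n : ℕ} {μ : YoungDiagram}

/-- The symmetric group acts on tabloids by permuting the entries. -/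
instance : MulAction (Perm (Fin n)) (Tabloid n μ) where
  smul σ t := ⟨fun x => t.1 (σ⁻¹ x), fun i => by
    rw [← t.2 i]
    exact Finset.card_bij (fun x _ => σ⁻¹ x) (by simp) (by simp)
      (fun y hy => ⟨σ y, by simpa using hy, by simp⟩)⟩
  one_smul t := rfl
  mul_smul σ τ t := Subtype.ext (funext fun x => by
    change t.1 ((σ * τ)⁻¹ x) = t.1 (τ⁻¹ (σ⁻¹ x))
    rw [mul_inv_rev]; rfl)

theorem smul_val (σ : Perm (Fin n)) (t : Tabloid n μ) (x : Fin n) :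
    (σ • t).1 x = t.1 (σ⁻¹ x) := rfl

/-- The tabloid of a tableau, recording only the row of each entry. -/
def Tableau.tabloid (T : Tableau n μ) : Tabloid n μ :=
  ⟨fun x => (T x).1.1, fun i => by
    rw [YoungDiagram.rowLen_eq_card]
    refine Finset.card_bij (fun x _ => (T x).1) ?_ ?_ ?_
    · intro x hx
      rw [YoungDiagram.mem_row_iff]
      exact ⟨(YoungDiagram.mem_cells _).1 (T x).2, by simpa using hx⟩
    · intro x _ y _ h
      exact T.injective (Subtype.ext h)
    · intro c hc
      rw [YoungDiagram.mem_row_iff] at hc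
      exact ⟨T.symm ⟨c, (YoungDiagram.mem_cells _).2 hc.1⟩, by simpa using hc.2, by simp⟩⟩

/-- `σ` maps each column of the tableau `T` to itself. -/
def Tableau.IsColumnPerm (T : Tableau n μ) (σ : Perm (Fin n)) : Prop :=
  ∀ x, (T (σ x)).1.2 = (T x).1.2

/-- The permutation module on tabloids of shape `μ`. -/
def tabloidRep (n : ℕ) (μ : YoungDiagram) :
    Representation ℂ (Perm (Fin n)) (MonoidAlgebra ℂ (Tabloid n μ)) :=
  Representation.ofMulAction ℂ (Perm (Fin n)) (Tabloid n μ)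

open scoped Classical in
/-- The polytabloid of `T`: the sum of `sign σ • σ{T}` over the column permutations `σ` of `T`. -/
def polytabloid (T : Tableau n μ) : MonoidAlgebra ℂ (Tabloid n μ) :=
  ∑ σ : Perm (Fin n) with T.IsColumnPerm σ,
    MonoidAlgebra.single (σ • T.tabloid) ((Perm.sign σ : ℤ) : ℂ)

theorem tabloidRep_polytabloid (g : Perm (Fin n)) (T : Tableau n μ) :
    tabloidRep n μ g (polytabloid T) = polytabloid (g.symm.trans T : Tableau n μ) := by
  classical
  have hT : Tableau.tabloid (g.symm.trans T : Tableau n μ) = g • T.tabloid := rfl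
  unfold polytabloid
  rw [map_sum]
  refine Finset.sum_bij (fun σ _ => g * σ * g⁻¹) ?_ ?_ ?_ ?_
  · intro σ hσ
    refine Finset.mem_filter.2 ⟨Finset.mem_univ _, fun x => ?_⟩
    have h : T.IsColumnPerm σ := (Finset.mem_filter.1 hσ).2
    simpa [Equiv.Perm.inv_def] using h (g⁻¹ x)
  · intro σ _ τ _ h
    simpa using h
  · intro τ hτ
    refine ⟨g⁻¹ * τ * g, Finset.mem_filter.2 ⟨Finset.mem_univ _, fun x => ?_⟩, by group⟩
    have h : Tableau.IsColumnPerm (g.symm.trans T : Tableau n μ) τ := (Finset.mem_filter.1 hτ).2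
    simpa [Equiv.Perm.inv_def] using h (g x)
  · intro σ _
    rw [tabloidRep, Representation.ofMulAction_single, hT, smul_smul, smul_smul]
    congr 1
    · group
    · rw [Perm.sign_mul, Perm.sign_mul, Perm.sign_inv, mul_right_comm, Int.units_mul_self, one_mul]

/-- The Specht module `S^μ`: the span of all polytabloids of shape `μ`. -/
def spechtModule (n : ℕ) (μ : YoungDiagram) : Submodule ℂ (MonoidAlgebra ℂ (Tabloid n μ)) :=
  Submodule.span ℂ (Set.range (polytabloid : Tableau n μ → _))

/-- The representation of `S_n` on the Specht module `S^μ`. -/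
def rep (n : ℕ) (μ : YoungDiagram) : Representation ℂ (Perm (Fin n)) (spechtModule n μ) :=
  (tabloidRep n μ).subrepresentation (spechtModule n μ) fun g => by
    refine Submodule.span_le.2 ?_
    rintro _ ⟨T, rfl⟩
    exact Submodule.subset_span ⟨_, (tabloidRep_polytabloid g T).symm⟩

end Specht

/-- The irreducible character `χ^l` of `S_n`: the character of the Specht module of shape `l`. -/
def irrChar {n : ℕ} (l : n.Partition) (π : Perm (Fin n)) : ℂ :=
  (Specht.rep n (Specht.diagram l)).character π

/-- The class functions `χ^(n)`, `χ^(n-1,1)`, `χ^(n-2,2)`, `χ^(n-2,1,1)`, `χ^(n-3,2,1)`, in this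
order. For small `n` the sequences that are not partitions are read as follows: `χ^(n-2,2) = 0` for
`n = 3`, `χ^(n-3,2,1) = 0` for `n = 4`, and `χ^(n-3,2,1) = - χ^(n-2,1,1)` for `n = 3`. -/
def chiVec {n : ℕ} (hn : 3 ≤ n) : Fin 5 → Perm (Fin n) → ℂ :=
  ![irrChar (.ofSums n {n} (by simp)),
    irrChar (.ofSums n {n - 1, 1} (by simp; omega)),
    if h : 4 ≤ n then irrChar (.ofSums n {n - 2, 2} (by simp; omega)) else 0,
    irrChar (.ofSums n {n - 2, 1, 1} (by simp; omega)),
    if h : 5 ≤ n then irrChar (.ofSums n {n - 3, 2, 1} (by simp; omega))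
    else if n = 4 then 0
    else - irrChar (.ofSums n {n - 2, 1, 1} (by simp; omega))]

/-! ### The tables of coefficients -/

/-- A row of the tables: patterns with the same mean, and the coefficients of the five class
functions `chiVec` in that mean. -/
structure TableRow where
  patterns : List VincularPattern
  coeff : Fin 5 → ℚ

section Tables

open VincularPattern

/-- Patterns with at most two conditions, except `(abc)`. -/
def table₁ (n : ℕ) : List TableRow :=
  let N : ℚ := n
  let B3 : ℚ := n.choose 3
  let B2 : ℚ := (n - 1).choose 2
  let ff2 : ℚ := n.descFactorial 2
  [ ⟨[rX_X_Xr w123],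
      ![B3 / 6, (N + 1) * (3 * N - 4) / 60, (N + 1) / 30, (3 * N - 2) / 30, 1 / 15]⟩,
    ⟨[rX_X_Xr w132, rX_X_Xr w213],
      ![B3 / 6, (N + 1) * (N - 3) / 60, -(N + 1) / 60, -(N + 1) / 20, -1 / 30]⟩,
    ⟨[rX_X_Xr w231, rX_X_Xr w312],
      ![B3 / 6, -(N + 1) * (3 * N - 4) / 120, -(N + 1) / 60, (N + 1) / 30, -1 / 30]⟩,
    ⟨[rX_X_Xr w321],
      ![B3 / 6, -(N + 1) * (N - 3) / 30, (N + 1) / 30, -(2 * N - 3) / 30, 1 / 15]⟩,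
    ⟨[rXX_Xr w123, rX_XXr w123],
      ![B2 / 6, (N ^ 2 + 3 * N - 6) / (12 * N), (N + 2) / (12 * N), (5 * N - 6) / (12 * N), 1 / (4 * N)]⟩,
    ⟨[rXX_Xr w132, rX_XXr w213],
      ![B2 / 6, (N - 3) / (6 * N), -(N - 1) / (6 * N), -1 / (2 * N), 0]⟩,
    ⟨[rXX_Xr w213, rX_XXr w132],
      ![B2 / 6, N * (N - 3) / (12 * N), (N - 4) / (12 * N), -1 / 4, -1 / (4 * N)]⟩,
    ⟨[rXX_Xr w231, rX_XXr w312],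
      ![B2 / 6, -N * (N - 1) / (12 * N), (N - 4) / (12 * N), 1 / 12, -1 / (4 * N)]⟩,
    ⟨[rXX_Xr w312, rX_XXr w231],
      ![B2 / 6, -(2 * N - 3) / (6 * N), -(N - 1) / (6 * N), 1 / (2 * N), 0]⟩,
    ⟨[rXX_Xr w321, rX_XXr w321],
      ![B2 / 6, -(N + 2) * (N - 3) / (12 * N), (N + 2) / (12 * N), -(N - 2) / (4 * N), 1 / (4 * N)]⟩,
    ⟨[sX_X_Xr w123, rX_X_Xs w123],
      ![B2 / 6, (5 * N - 7) / 24, 1 / 8, 5 / 24, 1 / (8 * N)]⟩,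
    ⟨[sX_X_Xr w132, rX_X_Xs w213],
      ![B2 / 6, (N - 3) / 8, -1 / 8, -5 / 24, -1 / (8 * N)]⟩,
    ⟨[sX_X_Xr w213, rX_X_Xs w132],
      ![B2 / 6, 0, 0, -1 / 6, 0]⟩,
    ⟨[sX_X_Xr w231, rX_X_Xs w312],
      ![B2 / 6, -(N - 2) / 6, 0, 1 / 6, 0]⟩,
    ⟨[sX_X_Xr w312, rX_X_Xs w231],
      ![B2 / 6, -(N + 1) / 24, -1 / 8, 1 / 8, -1 / (8 * N)]⟩,
    ⟨[sX_X_Xr w321, rX_X_Xs w321],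
      ![B2 / 6, -(N - 3) / 8, 1 / 8, -1 / 8, 1 / (8 * N)]⟩,
    ⟨[rXX_Xs w123, sX_XXr w123],
      ![(N - 2) / 6, 1 / 3, (N + 2) / (6 * ff2), 1 / (2 * (N - 1)), 1 / (2 * ff2)]⟩,
    ⟨[rXX_Xs w132, sX_XXr w213],
      ![(N - 2) / 6, -(N - 3) / (6 * N), -(2 * N - 5) / (6 * ff2), -1 / (2 * ff2), 1 / (2 * ff2)]⟩,
    ⟨[rXX_Xs w213, sX_XXr w132],
      ![(N - 2) / 6, (2 * N + 1) * (N - 3) / (6 * ff2), (N - 7) / (6 * ff2), -(N + 1) / (2 * ff2), -1 / ff2]⟩,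
    ⟨[rXX_Xs w231, sX_XXr w312],
      ![(N - 2) / 6, -(N ^ 2 - 4 * N + 9) / (6 * ff2), (N - 7) / (6 * ff2), (N - 3) / (2 * ff2), -1 / ff2]⟩,
    ⟨[rXX_Xs w312, sX_XXr w231],
      ![(N - 2) / 6, -(N ^ 2 + 2 * N - 9) / (6 * ff2), -(2 * N - 5) / (6 * ff2), 3 / (2 * ff2), 1 / (2 * ff2)]⟩,
    ⟨[rXX_Xs w321, sX_XXr w321],
      ![(N - 2) / 6, -(N + 2) * (N - 3) / (6 * ff2), (N + 2) / (6 * ff2), -(N - 2) / (2 * ff2), 1 / (2 * ff2)]⟩,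
    ⟨[sXX_Xr w123, rX_XXs w123],
      ![(N - 2) / 6, (N ^ 2 + 5 * N - 12) / (6 * ff2), 1 / (3 * N), (N - 2) / ff2, 0]⟩,
    ⟨[sXX_Xr w132, rX_XXs w213],
      ![(N - 2) / 6, (N + 2) * (N - 3) / (6 * ff2), -2 / (3 * N), -1 / ff2, 0]⟩,
    ⟨[sXX_Xr w213, rX_XXs w132],
      ![(N - 2) / 6, (N - 3) * (N - 4) / (6 * ff2), 1 / (3 * N), -(N - 2) / ff2, 0]⟩,
    ⟨[sXX_Xr w231, rX_XXs w312],
      ![(N - 2) / 6, -(N ^ 2 - N - 3) / (3 * ff2), 1 / (3 * N), 1 / ff2, 0]⟩,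
    ⟨[sXX_Xr w312, rX_XXs w231],
      ![(N - 2) / 6, (N - 6) / (6 * N), -2 / (3 * N), 1 / ff2, 0]⟩,
    ⟨[sXX_Xr w321, rX_XXs w321, sX_X_Xs w321],
      ![(N - 2) / 6, -(N - 3) / (3 * N), 1 / (3 * N), -1 / ff2, 0]⟩,
    ⟨[sX_X_Xs w123],
      ![(N - 2) / 6, (2 * N - 3) / (3 * N), 1 / (3 * N), 1 / ff2, 0]⟩,
    ⟨[sX_X_Xs w132, sX_X_Xs w213],
      ![(N - 2) / 6, (N - 3) / (6 * N), -1 / (6 * N), -1 / (2 * N), 0]⟩,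
    ⟨[sX_X_Xs w231, sX_X_Xs w312],
      ![(N - 2) / 6, -(2 * N - 3) / (6 * N), -1 / (6 * N), 1 / (2 * N), 0]⟩ ]

/-- Patterns with three conditions, and `(abc)`. -/
def table₂ (n : ℕ) : List TableRow :=
  let N : ℚ := n
  let ff2 : ℚ := n.descFactorial 2
  let ff3 : ℚ := n.descFactorial 3
  [ ⟨[rXXXr w123],
      ![(N - 2) / 6, 1 / N, 1 / ff2, 1 / N, 1 / ff2]⟩,
    ⟨[rXXXr w132, rXXXr w213],
      ![(N - 2) / 6, (N - 3) / (2 * ff2), -1 / (2 * ff2), -3 / (2 * ff2), -1 / (2 * ff2)]⟩,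
    ⟨[rXXXr w231, rXXXr w312],
      ![(N - 2) / 6, -1 / (2 * N), -1 / (2 * ff2), 1 / (2 * ff2), -1 / (2 * ff2)]⟩,
    ⟨[rXXXr w321],
      ![(N - 2) / 6, -(N - 3) / ff2, 1 / ff2, -(N - 3) / ff2, 1 / ff2]⟩,
    ⟨[sXXXr w123, rXXXs w123],
      ![1 / 6, 1 / (N * (N - 2)), 1 / ff3, 1 / (N * (N - 2)), 1 / ff3]⟩,
    ⟨[sXXXr w132, rXXXs w213],
      ![1 / 6, (2 * N - 6) / ff3, -2 / ff3, (N - 6) / ff3, -2 / ff3]⟩,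
    ⟨[sXXXr w213, rXXXs w132, sXXXr w321, rXXXs w321],
      ![1 / 6, -(N - 3) / ff3, 1 / ff3, -(N - 3) / ff3, 1 / ff3]⟩,
    ⟨[sXXXr w231, rXXXs w312],
      ![1 / 6, -(2 * N - 5) / ff3, 1 / ff3, -(N - 5) / ff3, 1 / ff3]⟩,
    ⟨[sXXXr w312, rXXXs w231],
      ![1 / 6, (N - 4) / ff3, -2 / ff3, (N - 4) / ff3, -2 / ff3]⟩,
    ⟨[sXX_Xs w123, sX_XXs w123],
      ![1 / 6, (N + 1) / (2 * ff2), 1 / (2 * ff2), 1 / (2 * ff2), -1 / (2 * ff3)]⟩,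
    ⟨[sXX_Xs w132, sX_XXs w213],
      ![1 / 6, 0, -1 / ff2, 0, 1 / ff3]⟩,
    ⟨[sXX_Xs w213, sX_XXs w132],
      ![1 / 6, (N - 3) / (2 * ff2), 1 / (2 * ff2), -3 / (2 * ff2), -1 / (2 * ff3)]⟩,
    ⟨[sXX_Xs w231, sX_XXs w312],
      ![1 / 6, -1 / (2 * N), 1 / (2 * ff2), 1 / (2 * ff2), -1 / (2 * ff3)]⟩,
    ⟨[sXX_Xs w312, sX_XXs w231],
      ![1 / 6, -1 / ff2, -1 / ff2, 2 / ff3, 1 / ff3]⟩,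
    ⟨[sXX_Xs w321, sX_XXs w321],
      ![1 / 6, -(N - 3) / (2 * ff2), 1 / (2 * ff2), (N - 6) / (2 * ff3), -1 / (2 * ff3)]⟩ ]

end Tables

end

/-!
Both sides of the identity are polynomials in the numbers of fixed points, of points on two-cycles
and of points on three-cycles of `π`, so the theorem reduces to an identity of polynomials for each
row of the tables.

*Mean statistics.* The mean of `φ.count` over the class of `π` is its mean over all `g * π * g⁻¹`
(`meanStatistic_eq`). For increasing positions `i` and letters `v`, the number of `g` for which
`g * π * g⁻¹` has the letters `v` at the positions `i`, in the order given by the word of `φ`,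
depends only on which letters equal which positions: it is a factorial times `embCount R π`, the
number of embeddings of the partial injection `R` of three points formed by these coincidences into
the functional graph of `π` (`sum_conj_indicator`). Hence only the relative position of `i` and `v`
matters, and there are 63 of these (`configurations`). Brackets and absent dashes close gaps between
the points, so the number of placements of a relative position in `Fin n` is a number of
compositions, a binomial coefficient (`card_strictMono_positionsOK`). Up to relabelling there are
ten partial injections of three points, with numbers of embeddings `embPoly₃` that follow by
inclusion-exclusion from the numbers of tuples with at least the given arrows
(`embCount_linkRep₃`). Altogether the mean is a combination of the ten polynomials `embPoly₃`, with
explicitly computable weights (`meanStatistic_count`).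

*Characters.* Let `T` be a tableau of shape `μ`. The operator `polytabloidOp` sends each tabloid to
the sum of the polytabloids of its tableaux. It commutes with the symmetric group, its image lies in
the Specht module, and since the column antisymmetrizer maps everything to multiples of the
polytabloid of `T`, it acts on the Specht module by a scalar. The trace of its composition with a
permutation `g` is therefore that scalar times the character at `g`, while the definition gives the
trace as a signed count of permutations (`scalar_mul_character`). No irreducibility is needed: the
scalar is computed as well and turns out not to vanish. For the five shapes, only the columns with
more than one cell and the cells below the first row contribute (`Core`). There are at most five
such cells, whatever `n` is, so both counts reduce to numbers of embeddings of partial injections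
with finitely many integer coefficients (`Core.mul_character`), and the five characters come out as
the polynomials `chiPoly` (`chiVec_eq`).
-/

/-! ### Counting permutations with prescribed values -/

section Counting

variable {α ι : Type*} [Fintype α] [DecidableEq α] [Fintype ι]

theorem card_perm_comp_eq_self (e : ι → α) :
    (Finset.univ.filter fun g : Perm α => ∀ a, g (e a) = e a).card =
      (Fintype.card α - (Finset.univ.image e).card).factorial := by
  classical
  have h1 := Fintype.card_congr (Equiv.Perm.subtypeEquivSubtypePerm
    (fun x : α => x ∉ Finset.univ.image e))
  have h2 : Fintype.card {x : α // x ∉ Finset.univ.image e} =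
      Fintype.card α - (Finset.univ.image e).card := by
    rw [Fintype.card_subtype_compl, Fintype.card_coe]
  rw [Fintype.card_perm, h2] at h1
  rw [h1, Fintype.card_subtype]
  congr 1
  ext g
  simp

/-- The permutations that send a family `e` of points to a family `f` with the same coincidences
are determined by an arbitrary bijection between the complements. -/
theorem card_perm_comp_eq (e f : ι → α) (h : ∀ a b, e a = e b ↔ f a = f b) :
    (Finset.univ.filter fun g : Perm α => ∀ a, g (e a) = f a).card =
      (Fintype.card α - (Finset.univ.image e).card).factorial := by
  classical
  obtain ⟨g₀, hg₀⟩ : ∃ g₀ : Perm α, ∀ a, g₀ (e a) = f a := by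
    have hs : ∀ x : Set.range e, ∃ a, e a = x := fun x => x.2
    choose s hs using hs
    obtain ⟨g, hg⟩ := Equiv.Perm.exists_extending_pair (fun x : Set.range e => (x : α))
      (fun x => f (s x)) Subtype.val_injective (fun x y hxy => by
        have : e (s x) = e (s y) := (h _ _).2 hxy
        rw [hs, hs] at this
        exact Subtype.ext this)
    refine ⟨g, fun a => ?_⟩
    rw [hg ⟨e a, a, rfl⟩]
    exact (h _ _).1 (hs ⟨e a, a, rfl⟩)
  rw [← card_perm_comp_eq_self e]
  refine Finset.card_bij' (fun g _ => g₀⁻¹ * g) (fun g _ => g₀ * g) ?_ ?_ ?_ ?_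
  · intro g hg
    simp only [Finset.mem_filter, Finset.mem_univ, true_and] at hg ⊢
    intro a
    rw [Perm.mul_apply, hg, Perm.inv_eq_iff_eq, hg₀]
  · intro g hg
    simp only [Finset.mem_filter, Finset.mem_univ, true_and] at hg ⊢
    intro a
    rw [Perm.mul_apply, hg, hg₀]
  · intro g _; simp
  · intro g _; simp

theorem card_perm_comp_eq_ite (e f : ι → α) :
    (Finset.univ.filter fun g : Perm α => ∀ a, g (e a) = f a).card =
      if ∀ a b, e a = e b ↔ f a = f b then
        (Fintype.card α - (Finset.univ.image e).card).factorial else 0 := by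
  split_ifs with h
  · exact card_perm_comp_eq e f h
  · rw [Finset.card_eq_zero, Finset.filter_eq_empty_iff]
    intro g _ hg
    exact h fun a b => by rw [← hg a, ← hg b, g.injective.eq_iff]

omit [Fintype α] in
/-- Families with the same coincidences have equally many values. -/
theorem card_image_eq_of_ker_eq {β : Type*} [DecidableEq β] (e : ι → α) (f : ι → β)
    (h : ∀ a b, e a = e b ↔ f a = f b) :
    (Finset.univ.image e).card = (Finset.univ.image f).card := by
  classical
  refine Finset.card_bij (fun x hx => f (Finset.mem_image.1 hx).choose) ?_ ?_ ?_
  · intro x hx; simp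
  · intro x hx y hy hxy
    rw [← (Finset.mem_image.1 hx).choose_spec.2, ← (Finset.mem_image.1 hy).choose_spec.2]
    exact (h _ _).2 hxy
  · intro y hy
    obtain ⟨a, -, rfl⟩ := Finset.mem_image.1 hy
    refine ⟨e a, Finset.mem_image_of_mem _ (Finset.mem_univ _), ?_⟩
    exact (h _ _).1 (Finset.mem_image.1 (Finset.mem_image_of_mem e (Finset.mem_univ a))).choose_spec.2

end Counting

/-! ### Averages over a conjugacy class -/

/-- The mean over a conjugacy class is the mean over all conjugations. -/
theorem meanStatistic_eq {n : ℕ} (s : Perm (Fin n) → ℝ) (π : Perm (Fin n)) :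
    meanStatistic s π = (∑ g : Perm (Fin n), s (g * π * g⁻¹)) / n.factorial := by
  classical
  -- all fibres of `g ↦ g * π * g⁻¹` are cosets of the centralizer of `π`
  set z := (Finset.univ.filter fun g : Perm (Fin n) => g * π * g⁻¹ = π).card with hz
  have hz0 : 0 < z := Finset.card_pos.2 ⟨1, by simp⟩
  have hfib : ∀ τ : Perm (Fin n), IsConj π τ →
      (Finset.univ.filter fun g : Perm (Fin n) => g * π * g⁻¹ = τ).card = z := by
    intro τ hτ
    obtain ⟨c, hc⟩ := isConj_iff.1 hτ
    refine Finset.card_bij' (fun g _ => c⁻¹ * g) (fun g _ => c * g) ?_ ?_ ?_ ?_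
    · intro g hg
      simp only [Finset.mem_filter, Finset.mem_univ, true_and] at hg ⊢
      calc c⁻¹ * g * π * (c⁻¹ * g)⁻¹ = c⁻¹ * (g * π * g⁻¹) * c := by group
        _ = π := by rw [hg, ← hc]; group
    · intro g hg
      simp only [Finset.mem_filter, Finset.mem_univ, true_and] at hg ⊢
      calc c * g * π * (c * g)⁻¹ = c * (g * π * g⁻¹) * c⁻¹ := by group
        _ = τ := by rw [hg, hc]
    · intro g _; simp
    · intro g _; simp
  have hsum : ∀ t : Perm (Fin n) → ℝ, (∑ g : Perm (Fin n), t (g * π * g⁻¹)) =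
      z * ∑ τ : Perm (Fin n) with IsConj π τ, t τ := by
    intro t
    have h := Finset.sum_fiberwise_of_maps_to (s := (Finset.univ : Finset (Perm (Fin n))))
      (t := Finset.univ.filter fun τ => IsConj π τ) (g := fun g => g * π * g⁻¹)
      (fun g _ => by simp) (fun g => t (g * π * g⁻¹))
    rw [← h, Finset.mul_sum]
    refine Finset.sum_congr rfl fun τ hτ => ?_
    have hτ' : IsConj π τ := by simpa using hτ
    rw [Finset.sum_congr rfl (g := fun _ => t τ)
      (fun g hg => by rw [(Finset.mem_filter.1 hg).2]), Finset.sum_const, hfib τ hτ', nsmul_eq_mul]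
  have hcard := hsum fun _ => 1
  simp only [Finset.sum_const, nsmul_eq_mul, mul_one, Finset.card_univ, Fintype.card_perm,
    Fintype.card_fin] at hcard
  unfold meanStatistic
  rw [hsum, hcard]
  rw [mul_div_mul_left _ _ (by exact_mod_cast hz0.ne')]

/-! ### Embeddings of a finite digraph in a permutation -/

/-- The number of injective `k`-tuples `x` of points such that `π` sends `x a` to `x b` exactly
when `R a b` holds. -/
def embCount {n k : ℕ} (R : Fin k → Fin k → Bool) (π : Perm (Fin n)) : ℕ :=
  (Finset.univ.filter fun x : Fin k → Fin n =>
    Function.Injective x ∧ ∀ a b, π (x a) = x b ↔ R a b = true).card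

/-- A tuple `x` together with its image under `π` has the same coincidences as `i` together with
`j` exactly when `x` is an embedding of the digraph `j a = i b`. -/
theorem forall_elim_eq_iff {n m k : ℕ} (π : Perm (Fin n)) (x : Fin k → Fin n)
    (i j : Fin k → Fin m) (hi : Function.Injective i) (hj : Function.Injective j) :
    (∀ a b, Sum.elim x (fun b => π (x b)) a = Sum.elim x (fun b => π (x b)) b ↔
        Sum.elim i j a = Sum.elim i j b) ↔
      Function.Injective x ∧ ∀ a b, π (x a) = x b ↔ j a = i b := by
  constructor
  · intro h
    refine ⟨fun a b hab => hi ((h (Sum.inl a) (Sum.inl b)).1 hab), fun a b => ?_⟩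
    exact h (Sum.inr a) (Sum.inl b)
  · rintro ⟨hx, h⟩ (a | a) (b | b)
    · simp [hx.eq_iff, hi.eq_iff]
    · simpa [eq_comm] using h b a
    · exact h a b
    · simp [hx.eq_iff, hj.eq_iff]

/-- A configuration with more points than `Fin n` does not embed. -/
theorem embCount_eq_zero {n m k : ℕ} (π : Perm (Fin n)) (i j : Fin k → Fin m)
    (hi : Function.Injective i) (hj : Function.Injective j)
    (h : n < (Finset.univ.image (Sum.elim i j)).card) :
    embCount (fun a b => decide (j a = i b)) π = 0 := by
  rw [embCount, Finset.card_eq_zero, Finset.filter_eq_empty_iff]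
  intro x _ hx
  simp only [decide_eq_true_eq] at hx
  rw [← card_image_eq_of_ker_eq _ _ ((forall_elim_eq_iff π x i j hi hj).2 hx)] at h
  have h' := Finset.card_le_univ (Finset.univ.image (Sum.elim x fun b => π (x b)))
  rw [Fintype.card_fin] at h'
  omega

/-- The number of conjugations of `π` after which `i a` is sent to `j a` for all `a` depends on `i`
and `j` only through the coincidences `j a = i b`. -/
theorem sum_conj_indicator {n k : ℕ} (π : Perm (Fin n)) (i j : Fin k → Fin n)
    (hi : Function.Injective i) (hj : Function.Injective j) :
    (∑ g : Perm (Fin n), if ∀ a, (g * π * g⁻¹) (i a) = j a then 1 else 0) =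
      (n - (Finset.univ.image (Sum.elim i j)).card).factorial *
        embCount (fun a b => decide (j a = i b)) π := by
  classical
  have h1 : ∀ g : Perm (Fin n), (if ∀ a, (g * π * g⁻¹) (i a) = j a then 1 else 0) =
      ∑ x : Fin k → Fin n, if (∀ a, g (Sum.elim x (fun b => π (x b)) a) = Sum.elim i j a)
        then 1 else 0 := by
    intro g
    -- the only tuple that can contribute is the preimage of `i`
    rw [Finset.sum_eq_single (fun a => g⁻¹ (i a))]
    · congr 1
      simp [Perm.mul_apply]
    · intro x _ hx
      rw [if_neg]
      intro h
      refine hx (funext fun a => ?_)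
      have := h (Sum.inl a)
      simp only [Sum.elim_inl] at this
      rw [← this]; simp
    · simp
  simp_rw [h1]
  rw [Finset.sum_comm]
  have h2 : ∀ x : Fin k → Fin n,
      (∑ g : Perm (Fin n), if (∀ a, g (Sum.elim x (fun b => π (x b)) a) = Sum.elim i j a)
        then 1 else 0) = if Function.Injective x ∧ ∀ a b, π (x a) = x b ↔ j a = i b then
          (n - (Finset.univ.image (Sum.elim i j)).card).factorial else 0 := by
    intro x
    rw [← Finset.card_filter, card_perm_comp_eq_ite]
    have hiff := forall_elim_eq_iff π x i j hi hj
    by_cases hk : Function.Injective x ∧ ∀ a b, π (x a) = x b ↔ j a = i b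
    · rw [if_pos (hiff.2 hk), if_pos hk, card_image_eq_of_ker_eq _ _ (hiff.2 hk), Fintype.card_fin]
    · rw [if_neg (fun h => hk (hiff.1 h)), if_neg hk]
  rw [Finset.sum_congr rfl fun x _ => h2 x, ← Finset.sum_filter, Finset.sum_const, smul_eq_mul,
    mul_comm]
  congr 1
  unfold embCount
  simp

/-! ### Partial injections up to relabelling -/

/-- `R` is the graph of a partial injection. -/
def IsLink {k : ℕ} (R : Fin k → Fin k → Bool) : Prop :=
  (∀ a b c, R a b = true → R a c = true → b = c) ∧ (∀ a b c, R a c = true → R b c = true → a = b)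

instance {k : ℕ} (R : Fin k → Fin k → Bool) : Decidable (IsLink R) := by
  unfold IsLink; infer_instance

section Links

variable {n k : ℕ}

theorem isLink_of_perm (π : Perm (Fin n)) {x : Fin k → Fin n} (hx : Function.Injective x) :
    IsLink fun a b => decide (π (x a) = x b) := by
  refine ⟨fun a b c h1 h2 => ?_, fun a b c h1 h2 => ?_⟩
  · simp only [decide_eq_true_eq] at h1 h2
    exact hx (h1.symm.trans h2)
  · simp only [decide_eq_true_eq] at h1 h2
    exact hx (π.injective (h1.trans h2.symm))

theorem embCount_comp (R : Fin k → Fin k → Bool) (σ : Perm (Fin k)) (π : Perm (Fin n)) :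
    embCount (fun a b => R (σ a) (σ b)) π = embCount R π := by
  unfold embCount
  refine Finset.card_bij' (fun x _ => x ∘ σ.symm) (fun x _ => x ∘ σ) ?_ ?_ ?_ ?_
  · intro x hx
    simp only [Finset.mem_filter, Finset.mem_univ, true_and] at hx ⊢
    refine ⟨hx.1.comp σ.symm.injective, fun a b => ?_⟩
    simpa using hx.2 (σ.symm a) (σ.symm b)
  · intro x hx
    simp only [Finset.mem_filter, Finset.mem_univ, true_and] at hx ⊢
    exact ⟨hx.1.comp σ.injective, fun a b => hx.2 (σ a) (σ b)⟩
  · intro x _; ext a; simp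
  · intro x _; ext a; simp

/-- The number of injective tuples for which `π` sends `x a` to `x b` whenever `q a b` holds, sorted
by the exact relation. -/
theorem card_atLeast (q : Fin k → Fin k → Bool) (π : Perm (Fin n)) :
    (Finset.univ.filter fun x : Fin k → Fin n =>
      Function.Injective x ∧ ∀ a b, q a b = true → π (x a) = x b).card =
    ∑ R : Fin k → Fin k → Bool with IsLink R ∧ ∀ a b, q a b = true → R a b = true,
      embCount R π := by
  classical
  rw [Finset.card_eq_sum_card_fiberwise (f := fun x a b => decide (π (x a) = x b))
    (t := Finset.univ.filter fun R => IsLink R ∧ ∀ a b, q a b = true → R a b = true)]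
  · refine Finset.sum_congr rfl fun R hR => ?_
    unfold embCount
    congr 1
    ext x
    simp only [Finset.mem_filter, Finset.mem_univ, true_and] at hR ⊢
    constructor
    · rintro ⟨⟨hx, -⟩, rfl⟩
      exact ⟨hx, fun a b => by simp⟩
    · rintro ⟨hx, h⟩
      have hR' : (fun a b => decide (π (x a) = x b)) = R := by
        funext a b
        rw [Bool.eq_iff_iff, decide_eq_true_eq]
        exact h a b
      exact ⟨⟨hx, fun a b hab => (h a b).2 (hR.2 a b hab)⟩, hR'⟩
  · intro x hx
    simp only [Finset.coe_filter, Finset.mem_univ, true_and, Set.mem_ofPred_eq] at hx ⊢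
    exact ⟨isLink_of_perm π hx.1, fun a b hab => by simpa using hx.2 a b hab⟩

/-- If links are sorted into classes with constant `embCount`, then the number of tuples with at
least the coincidences `q` is a combination of the values of `embCount` on the classes. -/
theorem card_atLeast_eq_sum {c : ℕ} (cls : (Fin k → Fin k → Bool) → Fin c) (E : Fin c → ℕ)
    (π : Perm (Fin n)) (hE : ∀ R, IsLink R → embCount R π = E (cls R))
    (q : Fin k → Fin k → Bool) :
    (Finset.univ.filter fun x : Fin k → Fin n =>
      Function.Injective x ∧ ∀ a b, q a b = true → π (x a) = x b).card =
    ∑ t, (Finset.univ.filter fun R : Fin k → Fin k → Bool =>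
      (IsLink R ∧ ∀ a b, q a b = true → R a b = true) ∧ cls R = t).card * E t := by
  rw [card_atLeast, ← Finset.sum_fiberwise _ cls]
  refine Finset.sum_congr rfl fun t _ => ?_
  rw [Finset.sum_congr rfl (g := fun _ => E t), Finset.sum_const, Finset.filter_filter, smul_eq_mul]
  intro R hR
  rw [Finset.mem_filter, Finset.mem_filter] at hR
  rw [hE R hR.1.2.1, hR.2]

end Links

/-- The numbers of arrows, of loops, and of ordered pairs of points on a common two-cycle. For at
most three points, these numbers determine a partial injection up to relabelling. -/
def linkType {k : ℕ} (R : Fin k → Fin k → Bool) : ℕ × ℕ × ℕ :=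
  (∑ a, ∑ b, (R a b).toNat, ∑ a, (R a a).toNat,
    ∑ a, ∑ b, (decide (a ≠ b) && R a b && R b a).toNat)

/-- The graph of a partial map. -/
def graphOf {k : ℕ} (p : Fin k → Option (Fin k)) (a b : Fin k) : Bool := p a == some b

/-- Representatives of the classes of partial injections of three points up to relabelling. -/
def linkRep₃ : Fin 10 → Fin 3 → Fin 3 → Bool := fun t => graphOf
  (![![none, none, none], ![some 0, none, none], ![some 1, none, none], ![some 0, some 1, none],
    ![some 0, some 2, none], ![some 1, some 0, none], ![some 1, some 2, none],
    ![some 0, some 1, some 2], ![some 0, some 2, some 1], ![some 1, some 2, some 0]] t)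

/-- The class of a partial injection of three points: the index of its representative in
`linkRep₃`. -/
def linkClass₃ (R : Fin 3 → Fin 3 → Bool) : Fin 10 :=
  match linkType R with
  | (0, _) => 0
  | (1, 1, _) => 1
  | (1, _) => 2
  | (2, 2, _) => 3
  | (2, 1, _) => 4
  | (2, 0, 2) => 5
  | (2, _) => 6
  | (3, 3, _) => 7
  | (3, 1, _) => 8
  | _ => 9

open VincularPattern in
theorem exists_relabel₃ : ∀ R : Fin 3 → Fin 3 → Bool, IsLink R →
    ∃ σ ∈ [w123, w132, w213, w231, w312, w321],
      ∀ a b, R (σ a) (σ b) = linkRep₃ (linkClass₃ R) a b := by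
  decide +kernel

/-- The number of partial injections in class `t` that contain the `s`-th representative. -/
theorem links_count₃ : ∀ s t : Fin 10, (Finset.univ.filter fun R : Fin 3 → Fin 3 → Bool =>
      (IsLink R ∧ ∀ a b, linkRep₃ s a b = true → R a b = true) ∧ linkClass₃ R = t).card =
    (![![1, 3, 6, 3, 6, 3, 6, 1, 3, 2], ![0, 1, 0, 2, 2, 0, 0, 1, 1, 0],
      ![0, 0, 1, 0, 1, 1, 2, 0, 1, 1], ![0, 0, 0, 1, 0, 0, 0, 1, 0, 0],
      ![0, 0, 0, 0, 1, 0, 0, 0, 1, 0], ![0, 0, 0, 0, 0, 1, 0, 0, 1, 0],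
      ![0, 0, 0, 0, 0, 0, 1, 0, 0, 1], ![0, 0, 0, 0, 0, 0, 0, 1, 0, 0],
      ![0, 0, 0, 0, 0, 0, 0, 0, 1, 0], ![0, 0, 0, 0, 0, 0, 0, 0, 0, 1]] : Fin 10 → Fin 10 → ℕ) s t := by
  decide +kernel

/-! ### Tuples with at least the given arrows -/

section AtLeast

variable {n : ℕ} (π : Perm (Fin n))

/-- The number of fixed points. -/
def numFix : ℕ := (Finset.univ.filter fun x => π x = x).card

/-- The number of points on two-cycles. -/
def numTwo : ℕ := (Finset.univ.filter fun x => π (π x) = x ∧ π x ≠ x).card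

/-- The number of points on three-cycles. -/
def numThree : ℕ := (Finset.univ.filter fun x => π (π (π x)) = x ∧ π x ≠ x).card

/-- An injective tuple extends by one entry in `n - k` ways. -/
theorem card_injective_init {k : ℕ} (P : (Fin k → Fin n) → Prop) [DecidablePred P] :
    (Finset.univ.filter fun x : Fin (k + 1) → Fin n =>
      Function.Injective x ∧ P (Fin.init x)).card =
    (Finset.univ.filter fun y : Fin k → Fin n => Function.Injective y ∧ P y).card * (n - k) := by
  classical
  rw [Finset.card_eq_sum_card_fiberwise (f := fun x : Fin (k + 1) → Fin n => Fin.init x)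
    (t := Finset.univ.filter fun y : Fin k → Fin n => Function.Injective y ∧ P y),
    Finset.sum_congr rfl (g := fun _ => n - k), Finset.sum_const, smul_eq_mul]
  · intro y hy
    simp only [Finset.mem_filter, Finset.mem_univ, true_and] at hy
    have h1 : (Finset.univ \ Finset.univ.image y).card = n - k := by
      rw [Finset.card_sdiff_of_subset (Finset.subset_univ _),
        Finset.card_image_of_injective _ hy.1, Finset.card_univ, Fintype.card_fin,
        Finset.card_univ, Fintype.card_fin]
    rw [← h1]
    refine Finset.card_bij' (fun x _ => x (Fin.last k)) (fun c _ => (Fin.snoc y c : _ → Fin n))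
      ?_ ?_ ?_ ?_
    · intro x hx
      simp only [Finset.mem_filter, Finset.mem_univ, true_and] at hx
      obtain ⟨⟨hx, -⟩, rfl⟩ := hx
      simp only [Finset.mem_sdiff, Finset.mem_univ, true_and, Finset.mem_image, not_exists]
      intro a ha
      exact (Fin.castSucc_lt_last a).ne (hx ha)
    · intro c hc
      simp only [Finset.mem_sdiff, Finset.mem_univ, true_and, Finset.mem_image, not_exists] at hc
      simp only [Finset.mem_filter, Finset.mem_univ, true_and, Fin.init_snoc, and_true]
      refine ⟨?_, hy.2⟩
      rw [Fin.snoc_injective_iff]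
      exact ⟨hy.1, by simpa using hc⟩
    · intro x hx
      simp only [Finset.mem_filter, Finset.mem_univ, true_and] at hx
      obtain ⟨-, rfl⟩ := hx
      exact Fin.snoc_init_self x
    · intro c _; simp
  · intro x hx
    simp only [Finset.coe_filter, Finset.mem_univ, true_and, Set.mem_ofPred_eq] at hx ⊢
    exact ⟨hx.1.comp (Fin.castSucc_injective k), hx.2⟩

theorem card_injective_forall {k : ℕ} (P : Fin n → Prop) [DecidablePred P] :
    (Finset.univ.filter fun x : Fin k → Fin n => Function.Injective x ∧ ∀ a, P (x a)).card =
      (Finset.univ.filter P).card.descFactorial k := by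
  classical
  have h := Fintype.card_embedding_eq (α := Fin k) (β := {x // P x})
  rw [Fintype.card_fin, Fintype.card_subtype] at h
  rw [← h, ← Finset.card_univ]
  refine Finset.card_bij' (fun x hx => ⟨fun a => ⟨x a, (Finset.mem_filter.1 hx).2.2 a⟩,
      fun a b hab => (Finset.mem_filter.1 hx).2.1 (congrArg Subtype.val hab)⟩)
    (fun y _ a => (y a).1) ?_ ?_ ?_ ?_
  · intro x _; simp
  · intro y _
    simp only [Finset.mem_filter, Finset.mem_univ, true_and]
    exact ⟨Subtype.val_injective.comp y.injective, fun a => (y a).2⟩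
  · intro x _; rfl
  · intro y _; rfl

theorem numFix_add_card_moved :
    numFix π + (Finset.univ.filter fun x => π x ≠ x).card = n := by
  have := Finset.card_filter_add_card_filter_not (s := (Finset.univ : Finset (Fin n)))
    (fun x => π x = x)
  rw [Finset.card_univ, Fintype.card_fin] at this
  exact this

/-- The injective tuples for which `π` sends `x a` to `x b` whenever `q a b` holds. -/
abbrev atLeastSet {k : ℕ} (q : Fin k → Fin k → Bool) : Finset (Fin k → Fin n) :=
  Finset.univ.filter fun x => Function.Injective x ∧ ∀ a b, q a b = true → π (x a) = x b

theorem mem_atLeastSet_graphOf {k : ℕ} (p : Fin k → Option (Fin k)) (x : Fin k → Fin n) :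
    x ∈ atLeastSet π (graphOf p) ↔
      Function.Injective x ∧ ∀ a, ∀ b ∈ p a, π (x a) = x b := by
  simp [atLeastSet, graphOf]

theorem injective_fin_two {α : Type*} (x : Fin 2 → α) : Function.Injective x ↔ x 0 ≠ x 1 := by
  constructor
  · intro h h'; exact absurd (h h') (by decide)
  · intro h a b hab
    fin_cases a <;> fin_cases b <;> simp_all

theorem injective_fin_three {α : Type*} (x : Fin 3 → α) :
    Function.Injective x ↔ x 0 ≠ x 1 ∧ x 0 ≠ x 2 ∧ x 1 ≠ x 2 := by
  constructor
  · intro h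
    exact ⟨fun h' => absurd (h h') (by decide), fun h' => absurd (h h') (by decide),
      fun h' => absurd (h h') (by decide)⟩
  · rintro ⟨h1, h2, h3⟩ a b hab
    fin_cases a <;> fin_cases b <;> simp_all

/-- An unconstrained last point contributes the factor `n - k`. -/
theorem card_atLeastSet_snoc {k : ℕ} (p : Fin k → Option (Fin k)) :
    (atLeastSet π (graphOf (Fin.snoc (fun a => (p a).map Fin.castSucc) none :
      Fin (k + 1) → Option (Fin (k + 1))))).card =
    (atLeastSet π (graphOf p)).card * (n - k) := by
  have h := card_injective_init (n := n) (fun y : Fin k → Fin n => ∀ a, ∀ b ∈ p a, π (y a) = y b)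
  have h1 : atLeastSet π (graphOf p) = Finset.univ.filter fun y : Fin k → Fin n =>
      Function.Injective y ∧ ∀ a, ∀ b ∈ p a, π (y a) = y b := by
    ext y; rw [mem_atLeastSet_graphOf]; simp
  rw [h1, ← h]
  congr 1
  ext x
  rw [mem_atLeastSet_graphOf]
  simp [Fin.forall_fin_succ', Fin.init]

theorem card_atLeast_none (k : ℕ) :
    (atLeastSet π (graphOf fun _ : Fin k => none)).card = n.descFactorial k := by
  have h := card_injective_forall (n := n) (k := k) (fun _ => True)
  simp only [implies_true, and_true, Finset.filter_true, Finset.card_univ, Fintype.card_fin] at h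
  rw [← h]
  congr 1
  ext x
  rw [mem_atLeastSet_graphOf]; simp

theorem card_atLeast_loops (k : ℕ) :
    (atLeastSet π (graphOf fun a : Fin k => some a)).card = (numFix π).descFactorial k := by
  rw [numFix, ← card_injective_forall]
  congr 1
  ext x
  rw [mem_atLeastSet_graphOf]; simp

theorem card_atLeast_arrow : (atLeastSet π (graphOf ![some 1, none])).card + numFix π = n := by
  have h := numFix_add_card_moved π
  have h2 : (atLeastSet π (graphOf ![some 1, none])).card =
      (Finset.univ.filter fun x => π x ≠ x).card := by
    refine Finset.card_bij' (fun x _ => x 0) (fun a _ => ![a, π a]) ?_ ?_ ?_ ?_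
    · intro x hx
      rw [mem_atLeastSet_graphOf] at hx
      simp [injective_fin_two, Fin.forall_fin_succ] at hx ⊢
      rw [hx.2]; exact Ne.symm hx.1
    · intro a ha
      rw [mem_atLeastSet_graphOf]
      simp [injective_fin_two, Fin.forall_fin_succ] at ha ⊢
      exact Ne.symm ha
    · intro x hx
      rw [mem_atLeastSet_graphOf] at hx
      simp [injective_fin_two, Fin.forall_fin_succ] at hx
      ext a; fin_cases a <;> simp [hx.2]
    · intro a _; rfl
  omega

theorem card_atLeast_twoCycle :
    (atLeastSet π (graphOf ![some 1, some 0])).card = numTwo π := by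
  refine Finset.card_bij' (fun x _ => x 0) (fun a _ => ![a, π a]) ?_ ?_ ?_ ?_
  · intro x hx
    rw [mem_atLeastSet_graphOf] at hx
    simp [injective_fin_two, Fin.forall_fin_succ] at hx ⊢
    rw [hx.2.1]; exact ⟨hx.2.2, Ne.symm hx.1⟩
  · intro a ha
    rw [mem_atLeastSet_graphOf]
    simp [injective_fin_two, Fin.forall_fin_succ] at ha ⊢
    exact ⟨Ne.symm ha.2, ha.1⟩
  · intro x hx
    rw [mem_atLeastSet_graphOf] at hx
    simp [injective_fin_two, Fin.forall_fin_succ] at hx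
    ext a; fin_cases a <;> simp [hx.2]
  · intro a _; rfl

theorem card_atLeast_loop_arrow :
    (atLeastSet π (graphOf ![some 0, some 2, none])).card = numFix π * (n - numFix π) := by
  have h := numFix_add_card_moved π
  have h2 : n - numFix π = (Finset.univ.filter fun x => π x ≠ x).card := by omega
  rw [h2, numFix, ← Finset.card_product]
  refine Finset.card_bij' (fun x _ => (x 0, x 1)) (fun a _ => ![a.1, a.2, π a.2]) ?_ ?_ ?_ ?_
  · intro x hx
    rw [mem_atLeastSet_graphOf] at hx
    simp [injective_fin_three, Fin.forall_fin_succ] at hx ⊢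
    rw [hx.2.2]; exact ⟨hx.2.1, Ne.symm hx.1.2.2⟩
  · rintro ⟨a, b⟩ hab
    rw [mem_atLeastSet_graphOf]
    simp [injective_fin_three, Fin.forall_fin_succ] at hab ⊢
    refine ⟨⟨?_, ?_, Ne.symm hab.2⟩, hab.1⟩
    · rintro rfl; exact hab.2 hab.1
    · rintro rfl; exact hab.2 (π.injective hab.1)
  · intro x hx
    rw [mem_atLeastSet_graphOf] at hx
    simp [injective_fin_three, Fin.forall_fin_succ] at hx
    ext a; fin_cases a <;> simp [hx.2]
  · intro a _; rfl

theorem card_atLeast_path :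
    (atLeastSet π (graphOf ![some 1, some 2, none])).card + numFix π + numTwo π = n := by
  have h := numFix_add_card_moved π
  have h3 := Finset.card_filter_add_card_filter_not
    (s := (Finset.univ.filter fun x => π x ≠ x)) (fun x => π (π x) = x)
  rw [Finset.filter_filter, Finset.filter_filter] at h3
  have h4 : (Finset.univ.filter fun x => π x ≠ x ∧ π (π x) = x).card = numTwo π := by
    unfold numTwo; simp only [and_comm]
  have h2 : (atLeastSet π (graphOf ![some 1, some 2, none])).card =
      (Finset.univ.filter fun x => π x ≠ x ∧ ¬ π (π x) = x).card := by
    refine Finset.card_bij' (fun x _ => x 0) (fun a _ => ![a, π a, π (π a)]) ?_ ?_ ?_ ?_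
    · intro x hx
      rw [mem_atLeastSet_graphOf] at hx
      simp [injective_fin_three, Fin.forall_fin_succ] at hx ⊢
      rw [hx.2.1, hx.2.2]; exact ⟨Ne.symm hx.1.1, Ne.symm hx.1.2.1⟩
    · intro a ha
      rw [mem_atLeastSet_graphOf]
      simp [injective_fin_three, Fin.forall_fin_succ] at ha ⊢
      exact ⟨Ne.symm ha.1, Ne.symm ha.2, fun h => ha.1 h.symm⟩
    · intro x hx
      rw [mem_atLeastSet_graphOf] at hx
      simp [injective_fin_three, Fin.forall_fin_succ] at hx
      ext a; fin_cases a <;> simp [hx.2]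
    · intro a _; rfl
  omega

theorem card_atLeast_loop_twoCycle :
    (atLeastSet π (graphOf ![some 0, some 2, some 1])).card = numFix π * numTwo π := by
  rw [numFix, numTwo, ← Finset.card_product]
  refine Finset.card_bij' (fun x _ => (x 0, x 1)) (fun a _ => ![a.1, a.2, π a.2]) ?_ ?_ ?_ ?_
  · intro x hx
    rw [mem_atLeastSet_graphOf] at hx
    simp [injective_fin_three, Fin.forall_fin_succ] at hx ⊢
    rw [hx.2.2.1]; exact ⟨hx.2.1, hx.2.2.2, Ne.symm hx.1.2.2⟩
  · rintro ⟨a, b⟩ hab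
    rw [mem_atLeastSet_graphOf]
    simp [injective_fin_three, Fin.forall_fin_succ] at hab ⊢
    refine ⟨⟨?_, ?_, Ne.symm hab.2.2⟩, hab.1, hab.2.1⟩
    · rintro rfl; exact hab.2.2 hab.1
    · rintro rfl; exact hab.2.2 (π.injective hab.1)
  · intro x hx
    rw [mem_atLeastSet_graphOf] at hx
    simp [injective_fin_three, Fin.forall_fin_succ] at hx
    ext a; fin_cases a <;> simp [hx.2]
  · intro a _; rfl

theorem card_atLeast_threeCycle :
    (atLeastSet π (graphOf ![some 1, some 2, some 0])).card = numThree π := by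
  refine Finset.card_bij' (fun x _ => x 0) (fun a _ => ![a, π a, π (π a)]) ?_ ?_ ?_ ?_
  · intro x hx
    rw [mem_atLeastSet_graphOf] at hx
    simp [injective_fin_three, Fin.forall_fin_succ] at hx ⊢
    rw [hx.2.1, hx.2.2.1]; exact ⟨hx.2.2.2, Ne.symm hx.1.1⟩
  · intro a ha
    rw [mem_atLeastSet_graphOf]
    simp [injective_fin_three, Fin.forall_fin_succ] at ha ⊢
    refine ⟨⟨Ne.symm ha.2, ?_, fun h => ha.2 h.symm⟩, ha.1⟩
    intro h
    rw [← h] at ha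
    exact ha.2 ha.1
  · intro x hx
    rw [mem_atLeastSet_graphOf] at hx
    simp [injective_fin_three, Fin.forall_fin_succ] at hx
    ext a; fin_cases a <;> simp [hx.2]
  · intro a _; rfl

end AtLeast

/-! ### Numbers of embeddings as polynomials -/

/-- Representatives of the classes of partial injections of two points up to relabelling. -/
def linkRep₂ : Fin 5 → Fin 2 → Fin 2 → Bool := fun t => graphOf
  (![![none, none], ![some 0, none], ![some 1, none], ![some 0, some 1], ![some 1, some 0]] t)

/-- The class of a partial injection of two points: the index of its representative in
`linkRep₂`. -/
def linkClass₂ (R : Fin 2 → Fin 2 → Bool) : Fin 5 :=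
  match linkType R with
  | (0, _) => 0
  | (1, 1, _) => 1
  | (1, _) => 2
  | (2, 2, _) => 3
  | _ => 4

theorem exists_relabel₂ : ∀ R : Fin 2 → Fin 2 → Bool, IsLink R →
    ∃ σ ∈ [1, Equiv.swap 0 1], ∀ a b, R (σ a) (σ b) = linkRep₂ (linkClass₂ R) a b := by
  decide +kernel

/-- The number of partial injections in class `t` that contain the `s`-th representative. -/
theorem links_count₂ : ∀ s t : Fin 5, (Finset.univ.filter fun R : Fin 2 → Fin 2 → Bool =>
      (IsLink R ∧ ∀ a b, linkRep₂ s a b = true → R a b = true) ∧ linkClass₂ R = t).card =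
    (![![1, 2, 2, 1, 1], ![0, 1, 0, 1, 0], ![0, 0, 1, 0, 1], ![0, 0, 0, 1, 0],
      ![0, 0, 0, 0, 1]] : Fin 5 → Fin 5 → ℕ) s t := by
  decide +kernel

section EmbCount

variable {n : ℕ} (π : Perm (Fin n))

theorem cast_descFactorial_three (m : ℕ) :
    (m.descFactorial 3 : ℚ) = m * (m - 1) * (m - 2) := by
  rcases m with _ | _ | _ | m
  · simp
  · simp
  · simp
  · simp [Nat.descFactorial_succ]; ring

theorem embCount_eq_rep₂ (R : Fin 2 → Fin 2 → Bool) (hR : IsLink R) :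
    embCount R π = embCount (linkRep₂ (linkClass₂ R)) π := by
  obtain ⟨σ, -, hσ⟩ := exists_relabel₂ R hR
  rw [← embCount_comp R σ]
  congr 1
  funext a b
  exact hσ a b

theorem embCount_eq_rep₃ (R : Fin 3 → Fin 3 → Bool) (hR : IsLink R) :
    embCount R π = embCount (linkRep₃ (linkClass₃ R)) π := by
  obtain ⟨σ, -, hσ⟩ := exists_relabel₃ R hR
  rw [← embCount_comp R σ]
  congr 1
  funext a b
  exact hσ a b

/-- The numbers of embeddings of the partial injections `linkRep₂`, in terms of the numbers
`n` of points, `f` of fixed points and `t` of points on two-cycles. -/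
def embPoly₂ (n f t : ℚ) : Fin 5 → ℚ :=
  ![n * (n - 1) - 2 * f * (n - 1) - 2 * (n - f) + f * (f - 1) + t, f * (n - f), n - f - t,
    f * (f - 1), t]

/-- The numbers of embeddings of the partial injections `linkRep₃`, in terms of the numbers
`n` of points, `f` of fixed points, `t` of points on two-cycles and `w` of points on
three-cycles. -/
def embPoly₃ (n f t w : ℚ) : Fin 10 → ℚ :=
  ![n * (n - 1) * (n - 2) - 3 * f * ((n - f) * (n - f - 3) + t)
      - 6 * (w * (n - f - 3) + (n - f - t - w) * (n - f - 4)) - 3 * (f * (f - 1) * (n - f))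
      - 6 * (f * (n - f - t)) - 3 * (t * (n - f - 2)) - 6 * (n - f - t - w)
      - f * (f - 1) * (f - 2) - 3 * (t * f) - 2 * w,
    f * ((n - f) * (n - f - 3) + t), w * (n - f - 3) + (n - f - t - w) * (n - f - 4),
    f * (f - 1) * (n - f), f * (n - f - t), t * (n - f - 2), n - f - t - w,
    f * (f - 1) * (f - 2), t * f, w]

theorem embCount_linkRep₂ (hn : 1 ≤ n) (s : Fin 5) :
    (embCount (linkRep₂ s) π : ℚ) = embPoly₂ n (numFix π) (numTwo π) s := by
  have key := fun s => card_atLeast_eq_sum linkClass₂ (fun t => embCount (linkRep₂ t) π) π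
    (embCount_eq_rep₂ π) (linkRep₂ s)
  simp only [links_count₂] at key
  have h0 := key 0
  have h1 := key 1
  have h2 := key 2
  have h3 := key 3
  have h4 := key 4
  simp only [Fin.sum_univ_five, Matrix.cons_val] at h0 h1 h2 h3 h4
  have c1 := card_atLeastSet_snoc π (![some 0] : Fin 1 → Option (Fin 1))
  have e0 : (atLeastSet π (linkRep₂ 0)).card = n.descFactorial 2 := by
    rw [← card_atLeast_none π 2]
    congr 3
    decide
  have e1 : (atLeastSet π (linkRep₂ 1)).card = numFix π * (n - 1) := by
    rw [← Nat.descFactorial_one (numFix π), ← card_atLeast_loops π 1]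
    convert c1 using 4
    · decide
    · decide
  have e2 : (atLeastSet π (linkRep₂ 2)).card + numFix π = n := card_atLeast_arrow π
  have e3 : (atLeastSet π (linkRep₂ 3)).card = (numFix π).descFactorial 2 := by
    rw [← card_atLeast_loops π 2]
    congr 3
    decide
  have e4 : (atLeastSet π (linkRep₂ 4)).card = numTwo π := card_atLeast_twoCycle π
  simp only [atLeastSet] at e0 e1 e2 e3 e4
  rw [h0] at e0
  rw [h1] at e1
  rw [h2] at e2
  rw [h3] at e3
  rw [h4] at e4
  have q0 := congrArg (Nat.cast : ℕ → ℚ) e0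
  have q1 := congrArg (Nat.cast : ℕ → ℚ) e1
  have q2 := congrArg (Nat.cast : ℕ → ℚ) e2
  have q3 := congrArg (Nat.cast : ℕ → ℚ) e3
  have q4 := congrArg (Nat.cast : ℕ → ℚ) e4
  push_cast [Nat.cast_descFactorial_two, Nat.cast_sub hn] at q0 q1 q2 q3 q4
  fin_cases s <;> simp [embPoly₂] <;> linarith

set_option maxHeartbeats 1000000 in
theorem embCount_linkRep₃ (hn : 3 ≤ n) (s : Fin 10) :
    (embCount (linkRep₃ s) π : ℚ) = embPoly₃ n (numFix π) (numTwo π) (numThree π) s := by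
  have key := fun s => card_atLeast_eq_sum linkClass₃ (fun t => embCount (linkRep₃ t) π) π
    (embCount_eq_rep₃ π) (linkRep₃ s)
  simp only [links_count₃] at key
  have h0 := key 0
  have h1 := key 1
  have h2 := key 2
  have h3 := key 3
  have h4 := key 4
  have h5 := key 5
  have h6 := key 6
  have h7 := key 7
  have h8 := key 8
  have h9 := key 9
  simp only [Fin.sum_univ_succ, Fin.sum_univ_zero, Matrix.cons_val, Fin.succ_zero_eq_one,
    Fin.succ_one_eq_two, Fin.reduceSucc] at h0 h1 h2 h3 h4 h5 h6 h7 h8 h9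
  have e0 : (atLeastSet π (linkRep₃ 0)).card = n.descFactorial 3 := by
    rw [← card_atLeast_none π 3]
    congr 3
    decide
  have e1 : (atLeastSet π (linkRep₃ 1)).card = numFix π * (n - 1) * (n - 2) := by
    have c1 := card_atLeastSet_snoc π (![some 0] : Fin 1 → Option (Fin 1))
    have c2 := card_atLeastSet_snoc π (![some 0, none] : Fin 2 → Option (Fin 2))
    rw [← Nat.descFactorial_one (numFix π), ← card_atLeast_loops π 1]
    convert c2 using 4
    · decide
    · convert c1.symm using 4
      · decide
      · decide
  have e2 : (atLeastSet π (linkRep₃ 2)).card = (n - numFix π) * (n - 2) := by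
    have c := card_atLeastSet_snoc π (![some 1, none] : Fin 2 → Option (Fin 2))
    have c' := card_atLeast_arrow π
    rw [← Nat.eq_sub_of_add_eq c']
    convert c using 4
    decide
  have e3 : (atLeastSet π (linkRep₃ 3)).card = (numFix π).descFactorial 2 * (n - 2) := by
    have c := card_atLeastSet_snoc π (fun a : Fin 2 => some a)
    rw [← card_atLeast_loops π 2]
    convert c using 4
    decide
  have e4 : (atLeastSet π (linkRep₃ 4)).card = numFix π * (n - numFix π) :=
    card_atLeast_loop_arrow π
  have e5 : (atLeastSet π (linkRep₃ 5)).card = numTwo π * (n - 2) := by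
    have c := card_atLeastSet_snoc π (![some 1, some 0] : Fin 2 → Option (Fin 2))
    rw [← card_atLeast_twoCycle π]
    convert c using 4
    decide
  have e6 : (atLeastSet π (linkRep₃ 6)).card + numFix π + numTwo π = n := card_atLeast_path π
  have e7 : (atLeastSet π (linkRep₃ 7)).card = (numFix π).descFactorial 3 := by
    rw [← card_atLeast_loops π 3]
    congr 3
    decide
  have e8 : (atLeastSet π (linkRep₃ 8)).card = numFix π * numTwo π := card_atLeast_loop_twoCycle π
  have e9 : (atLeastSet π (linkRep₃ 9)).card = numThree π := card_atLeast_threeCycle π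
  have hf : numFix π ≤ n := (Nat.le_add_right _ _).trans (numFix_add_card_moved π).le
  simp only [atLeastSet] at e0 e1 e2 e3 e4 e5 e6 e7 e8 e9
  rw [h0] at e0
  rw [h1] at e1
  rw [h2] at e2
  rw [h3] at e3
  rw [h4] at e4
  rw [h5] at e5
  rw [h6] at e6
  rw [h7] at e7
  rw [h8] at e8
  rw [h9] at e9
  have q0 := congrArg (Nat.cast : ℕ → ℚ) e0
  have q1 := congrArg (Nat.cast : ℕ → ℚ) e1
  have q2 := congrArg (Nat.cast : ℕ → ℚ) e2
  have q3 := congrArg (Nat.cast : ℕ → ℚ) e3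
  have q4 := congrArg (Nat.cast : ℕ → ℚ) e4
  have q5 := congrArg (Nat.cast : ℕ → ℚ) e5
  have q6 := congrArg (Nat.cast : ℕ → ℚ) e6
  have q7 := congrArg (Nat.cast : ℕ → ℚ) e7
  have q8 := congrArg (Nat.cast : ℕ → ℚ) e8
  have q9 := congrArg (Nat.cast : ℕ → ℚ) e9
  push_cast [Nat.cast_descFactorial_two, cast_descFactorial_three, Nat.cast_sub hf,
    Nat.cast_sub (show 1 ≤ n by omega), Nat.cast_sub (show 2 ≤ n by omega)]
    at q0 q1 q2 q3 q4 q5 q6 q7 q8 q9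
  fin_cases s <;> simp [embPoly₃] <;> linarith

end EmbCount

/-! ### Column permutations of a tableau -/

namespace Specht

/-- Among the sets of natural numbers with a given cardinality, the initial segment has the
smallest sum. -/
theorem sum_range_card_le_sum (A : Finset ℕ) : ∑ i ∈ Finset.range A.card, i ≤ ∑ i ∈ A, i := by
  induction A using Finset.induction_on_max with
  | empty => simp
  | insert a s hs ih =>
    have ha : a ∉ s := fun h => lt_irrefl _ (hs a h)
    have hc : s.card ≤ a := by
      simpa using Finset.card_le_card (show s ⊆ Finset.range a from fun x hx =>
        Finset.mem_range.2 (hs x hx))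
    rw [Finset.card_insert_of_notMem ha, Finset.sum_range_succ, Finset.sum_insert ha]
    omega

theorem lt_card_of_sum_le {A : Finset ℕ} (h : ∑ i ∈ A, i ≤ ∑ i ∈ Finset.range A.card, i) :
    ∀ a ∈ A, a < A.card := by
  intro a ha
  by_contra hlt
  have h1 := sum_range_card_le_sum (A.erase a)
  rw [Finset.card_erase_of_mem ha] at h1
  have h2 := Finset.add_sum_erase A (fun i => i) ha
  obtain ⟨m, hm⟩ : ∃ m, A.card = m + 1 :=
    ⟨A.card - 1, by have := Finset.card_pos.2 ⟨a, ha⟩; omega⟩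
  rw [hm, Finset.sum_range_succ] at h
  rw [hm, Nat.add_sub_cancel] at h1
  omega

variable {n : ℕ} {μ : YoungDiagram}

theorem Tabloid.sum_eq (s t : Tabloid n μ) : ∑ x, s.1 x = ∑ x, t.1 x := by
  classical
  have h : ∀ t : Tabloid n μ, ∀ B : Finset ℕ, (∀ x, t.1 x ∈ B) →
      ∑ x, t.1 x = ∑ i ∈ B, μ.rowLen i * i := by
    intro t B hB
    rw [← Finset.sum_fiberwise_of_maps_to (t := B) (g := t.1) (fun x _ => hB x)]
    refine Finset.sum_congr rfl fun i _ => ?_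
    rw [Finset.sum_congr rfl (g := fun _ => i) (fun x hx => (Finset.mem_filter.1 hx).2),
      Finset.sum_const, t.2 i, smul_eq_mul]
  rw [h s (Finset.univ.image s.1 ∪ Finset.univ.image t.1) (by simp),
    h t (Finset.univ.image s.1 ∪ Finset.univ.image t.1) (by simp)]

/-- The row of an entry of a tableau. -/
abbrev Tableau.row (T : Tableau n μ) (x : Fin n) : ℕ := (T x).1.1

/-- The column of an entry of a tableau. -/
abbrev Tableau.col (T : Tableau n μ) (x : Fin n) : ℕ := (T x).1.2

theorem Tableau.cell_ext (T : Tableau n μ) {x y : Fin n} (hr : T.row x = T.row y)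
    (hc : T.col x = T.col y) : x = y :=
  T.injective (Subtype.ext (Prod.ext hr hc))

theorem Tableau.image_row_column (T : Tableau n μ) (j : ℕ) :
    (Finset.univ.filter fun x => T.col x = j).image T.row = Finset.range (μ.colLen j) := by
  ext i
  simp only [Finset.mem_image, Finset.mem_filter, Finset.mem_univ, true_and, Finset.mem_range,
    ← YoungDiagram.mem_iff_lt_colLen]
  constructor
  · rintro ⟨x, rfl, rfl⟩
    exact (YoungDiagram.mem_cells _).1 (T x).2
  · intro h
    have hT := T.apply_symm_apply ⟨(i, j), (YoungDiagram.mem_cells _).2 h⟩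
    exact ⟨T.symm ⟨(i, j), (YoungDiagram.mem_cells _).2 h⟩,
      congrArg (fun c : μ.cells => c.1.2) hT, congrArg (fun c : μ.cells => c.1.1) hT⟩

theorem Tableau.card_column (T : Tableau n μ) (j : ℕ) :
    (Finset.univ.filter fun x => T.col x = j).card = μ.colLen j := by
  rw [← Finset.card_range (μ.colLen j), ← T.image_row_column, Finset.card_image_of_injOn]
  intro x hx y hy hxy
  simp only [Finset.coe_filter, Finset.mem_univ, true_and, Set.mem_ofPred_eq] at hx hy
  exact T.cell_ext hxy (hx.trans hy.symm)

/-- If the entries of each column of `T` lie in distinct rows of the tabloid `t`, then they lie in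
the rows that the column meets: otherwise the row indices of `t` would have too large a sum. -/
theorem Tableau.lt_colLen_of_injOn (T : Tableau n μ) (t : Tabloid n μ)
    (h : ∀ x y, T.col x = T.col y → t.1 x = t.1 y → x = y) (x : Fin n) :
    t.1 x < μ.colLen (T.col x) := by
  classical
  have hinj : ∀ j, Set.InjOn t.1 (Finset.univ.filter fun x => T.col x = j) := by
    intro j x hx y hy hxy
    simp only [Finset.coe_filter, Finset.mem_univ, true_and, Set.mem_ofPred_eq] at hx hy
    exact h x y (hx.trans hy.symm) hxy
  have hinj' : ∀ j, Set.InjOn T.row (Finset.univ.filter fun x => T.col x = j) := by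
    intro j x hx y hy hxy
    simp only [Finset.coe_filter, Finset.mem_univ, true_and, Set.mem_ofPred_eq] at hx hy
    exact T.cell_ext hxy (hx.trans hy.symm)
  have hcard : ∀ j, ((Finset.univ.filter fun x => T.col x = j).image t.1).card = μ.colLen j :=
    fun j => by rw [Finset.card_image_of_injOn (hinj j), T.card_column]
  have hle : ∀ j, ∑ x with T.col x = j, T.row x ≤ ∑ x with T.col x = j, t.1 x := by
    intro j
    rw [← Finset.sum_image (f := fun i => i) (hinj j),
      ← Finset.sum_image (f := fun i => i) (hinj' j), T.image_row_column, ← hcard j]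
    exact sum_range_card_le_sum _
  have hsum : ∑ x, t.1 x = ∑ x, T.row x := Tabloid.sum_eq t T.tabloid
  set J := Finset.univ.image T.col with hJ
  have hmaps : ∀ y ∈ (Finset.univ : Finset (Fin n)), T.col y ∈ J :=
    fun y _ => Finset.mem_image_of_mem _ (Finset.mem_univ y)
  rw [← Finset.sum_fiberwise_of_maps_to hmaps, ← Finset.sum_fiberwise_of_maps_to hmaps] at hsum
  have heq := (Finset.sum_eq_sum_iff_of_le fun j (_ : j ∈ J) => hle j).1 hsum.symm (T.col x)
    (hmaps x (Finset.mem_univ x))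
  rw [← hcard]
  refine lt_card_of_sum_le ?_ _ (Finset.mem_image_of_mem _ (by simp))
  rw [Finset.sum_image (hinj _), hcard, ← T.image_row_column, Finset.sum_image (hinj' _)]
  exact heq.ge

/-- A tabloid that separates the entries of each column of `T` arises from `{T}` by a column
permutation. -/
theorem Tableau.exists_columnPerm (T : Tableau n μ) (t : Tabloid n μ)
    (h : ∀ x y, T.col x = T.col y → t.1 x = t.1 y → x = y) :
    ∃ σ : Perm (Fin n), T.IsColumnPerm σ ∧ σ • T.tabloid = t := by
  let f : Fin n → μ.cells := fun x => ⟨(t.1 x, T.col x), (YoungDiagram.mem_cells _).2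
    (YoungDiagram.mem_iff_lt_colLen.2 (T.lt_colLen_of_injOn t h x))⟩
  have hf : Function.Injective f := fun x y hxy => by
    have h' := Prod.ext_iff.1 (Subtype.ext_iff.1 hxy)
    exact h x y h'.2 h'.1
  have hb : Function.Bijective f := (Fintype.bijective_iff_injective_and_card f).2
    ⟨hf, Fintype.card_congr T⟩
  let T' : Tableau n μ := Equiv.ofBijective f hb
  refine ⟨T.trans T'.symm, fun x => ?_, Subtype.ext (funext fun x => ?_)⟩
  · have h1 : T' (T'.symm (T x)) = T x := T'.apply_symm_apply _
    have h2 : T.col (T'.symm (T x)) = (T' (T'.symm (T x))).1.2 := rfl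
    exact h2.trans (congrArg (fun c : μ.cells => c.1.2) h1)
  · rw [smul_val]
    change (T (T.symm (T'.symm.symm x))).1.1 = t.1 x
    simp [T', f]

theorem Tableau.IsColumnPerm.mul {T : Tableau n μ} {σ τ : Perm (Fin n)} (hσ : T.IsColumnPerm σ)
    (hτ : T.IsColumnPerm τ) : T.IsColumnPerm (σ * τ) := fun x => (hσ (τ x)).trans (hτ x)

theorem Tableau.IsColumnPerm.inv {T : Tableau n μ} {σ : Perm (Fin n)} (hσ : T.IsColumnPerm σ) :
    T.IsColumnPerm σ⁻¹ := fun x => by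
  have h := hσ (σ⁻¹ x)
  rw [show σ (σ⁻¹ x) = x from σ.apply_symm_apply x] at h
  exact h.symm

theorem Tableau.IsColumnPerm.swap {T : Tableau n μ} {x y : Fin n} (h : T.col x = T.col y) :
    T.IsColumnPerm (Equiv.swap x y) := fun z => by
  by_cases hx : z = x
  · subst hx; rw [Equiv.swap_apply_left]; exact h.symm
  by_cases hy : z = y
  · subst hy; rw [Equiv.swap_apply_right]; exact h
  rw [Equiv.swap_apply_of_ne_of_ne hx hy]

instance : Finite (Tabloid n μ) := by
  have h : ∀ (t : Tabloid n μ) (x : Fin n), t.1 x < μ.colLen 0 := by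
    intro t x
    have hpos : 0 < μ.rowLen (t.1 x) := by
      rw [← t.2]; exact Finset.card_pos.2 ⟨x, by simp⟩
    rw [← YoungDiagram.mem_iff_lt_rowLen] at hpos
    exact YoungDiagram.mem_iff_lt_colLen.1 hpos
  refine Finite.of_injective (fun t : Tabloid n μ => fun x => (⟨t.1 x, h t x⟩ : Fin (μ.colLen 0)))
    fun s t hst => Subtype.ext (funext fun x => ?_)
  exact congrArg Fin.val (congrFun hst x)

/-! ### Characters of Specht modules as signed counts -/

section Trace

variable (T : Tableau n μ) (C : Finset (Perm (Fin n)))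

theorem polytabloid_eq (hC : ∀ σ, σ ∈ C ↔ T.IsColumnPerm σ) :
    polytabloid T = ∑ σ ∈ C, ((Perm.sign σ : ℤ) : ℂ) • MonoidAlgebra.single (σ • T.tabloid) 1 := by
  classical
  unfold polytabloid
  refine Finset.sum_congr (by ext σ; simp [hC]) fun σ _ => ?_
  simp

theorem coeff_tabloidRep (g : Perm (Fin n)) (v : MonoidAlgebra ℂ (Tabloid n μ))
    (t : Tabloid n μ) : (tabloidRep n μ g v).coeff t = v.coeff (g⁻¹ • t) :=
  Representation.coeff_ofMulAction g v t

open scoped Classical in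
theorem coeff_polytabloid (hC : ∀ σ, σ ∈ C ↔ T.IsColumnPerm σ) (s : Tabloid n μ) :
    (polytabloid T).coeff s =
      ∑ σ ∈ C, ((Perm.sign σ : ℤ) : ℂ) * if σ • T.tabloid = s then 1 else 0 := by
  rw [polytabloid_eq T C hC, MonoidAlgebra.coeff_sum, Finsupp.finsetSum_apply]
  refine Finset.sum_congr rfl fun σ _ => ?_
  rw [MonoidAlgebra.coeff_smul_apply, MonoidAlgebra.coeff_single, Finsupp.single_apply, smul_eq_mul]

theorem coeff_polytabloid_self : (polytabloid T).coeff T.tabloid = 1 := by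
  classical
  rw [coeff_polytabloid T (Finset.univ.filter fun σ => T.IsColumnPerm σ) (by simp),
    Finset.sum_eq_single 1]
  · simp
  · intro σ hσ h1
    rw [if_neg, mul_zero]
    intro h
    have hc := Tableau.IsColumnPerm.inv (Finset.mem_filter.1 hσ).2
    refine h1 (inv_eq_one.1 (Equiv.ext fun x => T.cell_ext ?_ (hc x)))
    exact congrFun (congrArg Subtype.val h) x
  · intro h
    exact absurd (Finset.mem_filter.2 ⟨Finset.mem_univ _, fun _ => rfl⟩) h

/-- The signed sum of the permutations in `C`, as an operator. If `C` consists of the column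
permutations of a tableau `T`, this is the column antisymmetrizer of `T`. -/
noncomputable def columnOp : Module.End ℂ (MonoidAlgebra ℂ (Tabloid n μ)) :=
  ∑ σ ∈ C, ((Perm.sign σ : ℤ) : ℂ) • tabloidRep n μ σ

theorem columnOp_tabloid (hC : ∀ σ, σ ∈ C ↔ T.IsColumnPerm σ) :
    columnOp C (MonoidAlgebra.single T.tabloid 1) = polytabloid T := by
  rw [polytabloid_eq T C hC, columnOp, LinearMap.sum_apply]
  refine Finset.sum_congr rfl fun σ _ => ?_
  rw [LinearMap.smul_apply, tabloidRep, Representation.ofMulAction_single]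

/-- The column antisymmetrizer of `T` sends a tabloid to a multiple of the polytabloid of `T`: if the
tabloid has two entries of a column of `T` in the same row, then swapping them shows that its image
vanishes, and otherwise the tabloid arises from that of `T` by a column permutation. -/
theorem columnOp_single_mem (hC : ∀ σ, σ ∈ C ↔ T.IsColumnPerm σ) (t : Tabloid n μ) :
    columnOp C (MonoidAlgebra.single t 1) ∈ Submodule.span ℂ {polytabloid T} := by
  classical
  have hexp : ∀ t : Tabloid n μ, columnOp C (MonoidAlgebra.single t 1) =
      ∑ σ ∈ C, MonoidAlgebra.single (σ • t) ((Perm.sign σ : ℤ) : ℂ) := by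
    intro t
    rw [columnOp, LinearMap.sum_apply]
    refine Finset.sum_congr rfl fun σ _ => ?_
    rw [LinearMap.smul_apply, tabloidRep, Representation.ofMulAction_single]
    simp
  by_cases h : ∀ x y, T.col x = T.col y → t.1 x = t.1 y → x = y
  · obtain ⟨τ, hτ, rfl⟩ := T.exists_columnPerm t h
    refine Submodule.mem_span_singleton.2 ⟨((Perm.sign τ : ℤ) : ℂ), ?_⟩
    rw [← columnOp_tabloid T C hC, hexp, hexp, Finset.smul_sum]
    refine Finset.sum_bij' (fun σ _ => σ * τ⁻¹) (fun σ _ => σ * τ) ?_ ?_ ?_ ?_ ?_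
    · intro σ hσ; exact (hC _).2 (((hC _).1 hσ).mul hτ.inv)
    · intro σ hσ; exact (hC _).2 (((hC _).1 hσ).mul hτ)
    · intro σ _; simp
    · intro σ _; simp
    · intro σ _
      rw [MonoidAlgebra.smul_single, smul_smul, inv_mul_cancel_right, Perm.sign_mul, Perm.sign_inv]
      congr 1
      push_cast
      rw [smul_eq_mul, mul_comm]
  · push Not at h
    obtain ⟨x, y, hc, ht, hne⟩ := h
    have hz : columnOp C (MonoidAlgebra.single t 1) = 0 := by
      rw [hexp]
      have hsw := Tableau.IsColumnPerm.swap hc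
      have hfix : Equiv.swap x y • t = t := by
        refine Subtype.ext (funext fun z => ?_)
        rw [smul_val, Equiv.swap_inv]
        by_cases hx : z = x
        · subst hx; rw [Equiv.swap_apply_left]; exact ht.symm
        by_cases hy : z = y
        · subst hy; rw [Equiv.swap_apply_right]; exact ht
        rw [Equiv.swap_apply_of_ne_of_ne hx hy]
      refine Finset.sum_involution (fun σ _ => σ * Equiv.swap x y) ?_ ?_ ?_ ?_
      · intro σ _
        rw [mul_smul, hfix, ← MonoidAlgebra.single_add, Perm.sign_mul, Perm.sign_swap hne]
        simp
      · intro σ _ _ h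
        exact hne (Equiv.swap_eq_one_iff.1 (mul_eq_left.1 h))
      · intro σ hσ; exact (hC _).2 (((hC _).1 hσ).mul hsw)
      · intro σ _; simp [mul_assoc]
    rw [hz]
    exact Submodule.zero_mem _

theorem columnOp_mem (hC : ∀ σ, σ ∈ C ↔ T.IsColumnPerm σ) (v : MonoidAlgebra ℂ (Tabloid n μ)) :
    columnOp C v ∈ Submodule.span ℂ {polytabloid T} := by
  induction v using MonoidAlgebra.induction_linear with
  | zero => simp
  | add x y hx hy => rw [map_add]; exact Submodule.add_mem _ hx hy
  | single t r =>
    have : MonoidAlgebra.single t r = r • MonoidAlgebra.single t (1 : ℂ) := by simp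
    rw [this, map_smul]
    exact Submodule.smul_mem _ _ (columnOp_single_mem T C hC t)

/-- The operator sending a tabloid to the sum of the polytabloids of its tableaux: a tableau is
`h • T` for a unique permutation `h`. -/
noncomputable def polytabloidOp : Module.End ℂ (MonoidAlgebra ℂ (Tabloid n μ)) :=
  ∑ h : Perm (Fin n), ((Finsupp.lapply (h • T.tabloid) : _ →ₗ[ℂ] ℂ) ∘ₗ
    (MonoidAlgebra.coeffLinearEquiv ℂ).toLinearMap).smulRight (tabloidRep n μ h (polytabloid T))

theorem polytabloidOp_apply (v : MonoidAlgebra ℂ (Tabloid n μ)) :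
    polytabloidOp T v =
      ∑ h : Perm (Fin n), v.coeff (h • T.tabloid) • tabloidRep n μ h (polytabloid T) := by
  rw [polytabloidOp, LinearMap.sum_apply]
  rfl

theorem tabloidRep_polytabloid_mem (h : Perm (Fin n)) :
    tabloidRep n μ h (polytabloid T) ∈ spechtModule n μ := by
  rw [tabloidRep_polytabloid]
  exact Submodule.subset_span ⟨_, rfl⟩

theorem polytabloidOp_mem (v : MonoidAlgebra ℂ (Tabloid n μ)) :
    polytabloidOp T v ∈ spechtModule n μ := by
  rw [polytabloidOp_apply]
  exact Submodule.sum_mem _ fun h _ => Submodule.smul_mem _ _ (tabloidRep_polytabloid_mem T h)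

theorem polytabloidOp_comm (g : Perm (Fin n)) (v : MonoidAlgebra ℂ (Tabloid n μ)) :
    polytabloidOp T (tabloidRep n μ g v) = tabloidRep n μ g (polytabloidOp T v) := by
  rw [polytabloidOp_apply, polytabloidOp_apply, map_sum]
  refine Fintype.sum_equiv (Equiv.mulLeft g⁻¹) _ _ fun h => ?_
  rw [LinearMap.map_smul, coeff_tabloidRep, ← Module.End.mul_apply, ← map_mul, Equiv.coe_mulLeft,
    mul_smul, mul_inv_cancel_left]

theorem exists_eq_tabloidRep (T' : Tableau n μ) :
    ∃ h : Perm (Fin n), polytabloid T' = tabloidRep n μ h (polytabloid T) := by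
  refine ⟨T.trans T'.symm, ?_⟩
  rw [tabloidRep_polytabloid]
  congr 1
  ext x : 1
  simp

/-- The polytabloid of `T` is an eigenvector of `polytabloidOp`: up to a factor it is the only vector
in the image of the column antisymmetrizer, which commutes with `polytabloidOp`. -/
theorem polytabloidOp_polytabloid :
    polytabloidOp T (polytabloid T) =
      (polytabloidOp T (polytabloid T)).coeff T.tabloid • polytabloid T := by
  classical
  set C : Finset (Perm (Fin n)) := Finset.univ.filter fun σ => T.IsColumnPerm σ with hCdef
  have hC : ∀ σ, σ ∈ C ↔ T.IsColumnPerm σ := by simp [hCdef]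
  have hcomm : ∀ v, polytabloidOp T (columnOp C v) = columnOp C (polytabloidOp T v) := by
    intro v
    simp only [columnOp, LinearMap.sum_apply, LinearMap.smul_apply, map_sum, map_smul,
      polytabloidOp_comm]
  have hmem : polytabloidOp T (polytabloid T) ∈ Submodule.span ℂ {polytabloid T} := by
    rw [← columnOp_tabloid T C hC, hcomm]
    rw [columnOp_tabloid T C hC]
    exact columnOp_mem T C hC _
  obtain ⟨a, ha⟩ := Submodule.mem_span_singleton.1 hmem
  rw [← ha, MonoidAlgebra.coeff_smul_apply, coeff_polytabloid_self, smul_eq_mul, mul_one]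

theorem polytabloidOp_eq_smul (v : MonoidAlgebra ℂ (Tabloid n μ)) (hv : v ∈ spechtModule n μ) :
    polytabloidOp T v = (polytabloidOp T (polytabloid T)).coeff T.tabloid • v := by
  induction hv using Submodule.span_induction with
  | mem x hx =>
    obtain ⟨T', rfl⟩ := hx
    obtain ⟨h, hh⟩ := exists_eq_tabloidRep T T'
    rw [hh, polytabloidOp_comm, polytabloidOp_polytabloid, map_smul,
      ← polytabloidOp_polytabloid]
  | zero => simp
  | add x y _ _ hx hy => rw [map_add, hx, hy, smul_add]
  | smul a x _ hx => rw [map_smul, hx, smul_comm]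

/-- The trace of `g` on the Specht module, up to the scalar by which `polytabloidOp` acts. It equals
the trace of the composition of `polytabloidOp` and `g` on the permutation module, since the image
of that composition lies in the Specht module. -/
theorem coeff_mul_character (g : Perm (Fin n)) :
    (polytabloidOp T (polytabloid T)).coeff T.tabloid * (rep n μ).character g =
      ∑ h : Perm (Fin n), (polytabloid T).coeff (h⁻¹ • g⁻¹ • h • T.tabloid) := by
  have hmem : ∀ v, (tabloidRep n μ g ∘ₗ polytabloidOp T) v ∈ spechtModule n μ := by
    intro v
    rw [LinearMap.comp_apply, ← polytabloidOp_comm]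
    exact polytabloidOp_mem T _
  have h1 := LinearMap.trace_restrict_eq_of_forall_mem (spechtModule n μ)
    (tabloidRep n μ g ∘ₗ polytabloidOp T) hmem
  have h2 : (tabloidRep n μ g ∘ₗ polytabloidOp T).restrict (fun x _ => hmem x) =
      (polytabloidOp T (polytabloid T)).coeff T.tabloid • rep n μ g := by
    ext1 v
    refine Subtype.ext ?_
    rw [LinearMap.coe_restrict_apply, LinearMap.comp_apply, polytabloidOp_eq_smul T v.1 v.2,
      map_smul]
    rfl
  rw [h2, map_smul, smul_eq_mul] at h1
  refine h1.trans ?_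
  have hsum : tabloidRep n μ g ∘ₗ polytabloidOp T = ∑ h : Perm (Fin n), tabloidRep n μ g ∘ₗ
      ((Finsupp.lapply (h • T.tabloid) : _ →ₗ[ℂ] ℂ) ∘ₗ
        (MonoidAlgebra.coeffLinearEquiv ℂ).toLinearMap).smulRight
          (tabloidRep n μ h (polytabloid T)) := by
    rw [polytabloidOp]
    exact map_sum (LinearMap.compRight ℂ (tabloidRep n μ g)) _ _
  rw [hsum, map_sum]
  refine Finset.sum_congr rfl fun h _ => ?_
  have h3 : ∀ (f : MonoidAlgebra ℂ (Tabloid n μ) →ₗ[ℂ] ℂ) (x : MonoidAlgebra ℂ (Tabloid n μ)),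
      tabloidRep n μ g ∘ₗ f.smulRight x = f.smulRight (tabloidRep n μ g x) := by
    intro f x
    refine LinearMap.ext fun v => ?_
    simp
  rw [h3, LinearMap.trace_smulRight]
  change (tabloidRep n μ g (tabloidRep n μ h (polytabloid T))).coeff (h • T.tabloid) = _
  rw [coeff_tabloidRep, coeff_tabloidRep]

open scoped Classical in
/-- The character of a Specht module: up to a constant, its value at `g` is the signed number of
pairs of a permutation `h` and a column permutation `σ` such that `h⁻¹ * g * h * σ` fixes the
tabloid of `T`. The constant is the signed number of triples `(h, σ, τ)` with `h` and `σ` agreeing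
on the tabloid and `h * τ` fixing it. -/
theorem scalar_mul_character (hC : ∀ σ, σ ∈ C ↔ T.IsColumnPerm σ) (g : Perm (Fin n)) :
    (∑ σ ∈ C, ∑ τ ∈ C, ((Perm.sign σ * Perm.sign τ : ℤ) : ℂ) *
      (Finset.univ.filter fun h : Perm (Fin n) =>
        h • T.tabloid = σ • T.tabloid ∧ (h * τ) • T.tabloid = T.tabloid).card) *
      (rep n μ).character g =
    ∑ σ ∈ C, ((Perm.sign σ : ℤ) : ℂ) * (Finset.univ.filter fun h : Perm (Fin n) =>
      (h⁻¹ * g * h * σ) • T.tabloid = T.tabloid).card := by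
  have hk : (polytabloidOp T (polytabloid T)).coeff T.tabloid =
      ∑ σ ∈ C, ∑ τ ∈ C, ((Perm.sign σ * Perm.sign τ : ℤ) : ℂ) *
      (Finset.univ.filter fun h : Perm (Fin n) =>
        h • T.tabloid = σ • T.tabloid ∧ (h * τ) • T.tabloid = T.tabloid).card := by
    rw [polytabloidOp_apply, MonoidAlgebra.coeff_sum, Finsupp.finsetSum_apply]
    simp_rw [MonoidAlgebra.coeff_smul_apply, coeff_tabloidRep, coeff_polytabloid T C hC,
      smul_eq_mul, Finset.sum_mul_sum]
    rw [Finset.sum_comm]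
    refine Finset.sum_congr rfl fun σ _ => ?_
    rw [Finset.sum_comm]
    refine Finset.sum_congr rfl fun τ _ => ?_
    rw [Finset.card_filter, Nat.cast_sum, Finset.mul_sum]
    refine Finset.sum_congr rfl fun h _ => ?_
    have e1 : (σ • T.tabloid = h • T.tabloid) ↔ h • T.tabloid = σ • T.tabloid := eq_comm
    have e2 : (τ • T.tabloid = h⁻¹ • T.tabloid) ↔ (h * τ) • T.tabloid = T.tabloid := by
      rw [eq_inv_smul_iff, mul_smul]
    by_cases ha : h • T.tabloid = σ • T.tabloid <;>
      by_cases hb : (h * τ) • T.tabloid = T.tabloid <;> simp [e1, e2, ha, hb]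
  rw [← hk, coeff_mul_character]
  simp_rw [coeff_polytabloid T C hC]
  rw [Finset.sum_comm]
  refine Finset.sum_congr rfl fun σ _ => ?_
  rw [Finset.card_filter, Nat.cast_sum, Finset.mul_sum]
  refine Finset.sum_congr rfl fun h _ => ?_
  have e : (σ • T.tabloid = h⁻¹ • g⁻¹ • h • T.tabloid) ↔
      (h⁻¹ * g * h * σ) • T.tabloid = T.tabloid := by
    rw [eq_inv_smul_iff, eq_inv_smul_iff, mul_smul, mul_smul, mul_smul, inv_smul_eq_iff]
  by_cases ha : (h⁻¹ * g * h * σ) • T.tabloid = T.tabloid <;> simp [e, ha]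

end Trace

end Specht

namespace Specht

/-! ### Reduction to the cells that matter -/

/-- The part of a tableau of shape `μ` that matters for the character: an enumeration `cell` of
cells including all cells of columns with more than one cell, and an enumeration `low` of those
among them that lie below the first row. Every other cell lies in the first row and is alone in its
column, which is `alone`. -/
structure Core (μ : YoungDiagram) (k l : ℕ) (cell : Fin k → ℕ × ℕ) (low : Fin l → Fin k) : Prop where
  mem : ∀ a, cell a ∈ μ
  cell_injective : Function.Injective cell
  low_injective : Function.Injective low
  low_iff : ∀ a, (cell a).1 ≠ 0 ↔ ∃ b, low b = a
  alone : ∀ p ∈ μ, (∀ a, cell a ≠ p) → p.1 = 0 ∧ ∀ q ∈ μ, q.2 = p.2 → q = p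

/-- The permutations of the core preserving the columns. -/
def coreCols {k : ℕ} (cell : Fin k → ℕ × ℕ) : Finset (Perm (Fin k)) :=
  Finset.univ.filter fun c => ∀ a, (cell (c a)).2 = (cell a).2

/-- The permutations of the lower part of the core preserving the rows. -/
def coreRows {k l : ℕ} (cell : Fin k → ℕ × ℕ) (low : Fin l → Fin k) : Finset (Perm (Fin l)) :=
  Finset.univ.filter fun τ => ∀ a, (cell (low (τ a))).1 = (cell (low a)).1

section Core

variable {n k l : ℕ} {μ : YoungDiagram} {cell : Fin k → ℕ × ℕ} {low : Fin l → Fin k}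

/-- The entries of a tableau in the core. -/
def Core.entry (H : Core μ k l cell low) (T : Tableau n μ) : Fin k ↪ Fin n where
  toFun a := T.symm ⟨cell a, (YoungDiagram.mem_cells _).2 (H.mem a)⟩
  inj' _ _ h := H.cell_injective (congrArg Subtype.val (T.symm.injective h))

theorem Core.apply_entry (H : Core μ k l cell low) (T : Tableau n μ) (a : Fin k) :
    (T (H.entry T a)).1 = cell a :=
  congrArg Subtype.val (T.apply_symm_apply _)

theorem Core.of_notMem (H : Core μ k l cell low) (T : Tableau n μ) {x : Fin n}
    (hx : x ∉ Set.range (H.entry T)) :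
    T.row x = 0 ∧ ∀ y, T.col y = T.col x → y = x := by
  have h := H.alone (T x).1 ((YoungDiagram.mem_cells _).1 (T x).2) fun a ha => hx ⟨a, ?_⟩
  · exact ⟨h.1, fun y hy => T.injective (Subtype.ext (h.2 _
      ((YoungDiagram.mem_cells _).1 (T y).2) hy))⟩
  · exact T.injective (Subtype.ext ((H.apply_entry T a).trans ha))

/-- A column permutation of a tableau is a column permutation of the core, extended by the identity
outside the entries of the core. -/
theorem Core.isColumnPerm_iff (H : Core μ k l cell low) (T : Tableau n μ) (σ : Perm (Fin n)) :
    σ ∈ (coreCols cell).image (fun c => c.viaFintypeEmbedding (H.entry T)) ↔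
      T.IsColumnPerm σ := by
  simp only [Finset.mem_image, coreCols, Finset.mem_filter, Finset.mem_univ, true_and]
  constructor
  · rintro ⟨c, hc, rfl⟩ x
    by_cases hx : x ∈ Set.range (H.entry T)
    · obtain ⟨a, rfl⟩ := hx
      rw [Equiv.Perm.viaFintypeEmbedding_apply_image, H.apply_entry, H.apply_entry, hc]
    · rw [Equiv.Perm.viaFintypeEmbedding_apply_notMem_range _ _ hx]
  · intro hσ
    have hr : ∀ a, ∃ b, H.entry T b = σ (H.entry T a) := by
      intro a
      by_contra hx
      have h := (H.of_notMem T hx).2 (H.entry T a) (hσ _).symm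
      exact hx ⟨a, h⟩
    choose f hf using hr
    have hinj : Function.Injective f := by
      intro a b hab
      have : H.entry T (f a) = H.entry T (f b) := by rw [hab]
      rw [hf, hf] at this
      exact (H.entry T).injective (σ.injective this)
    refine ⟨Equiv.ofBijective f (Finite.injective_iff_bijective.1 hinj), fun a => ?_, ?_⟩
    · rw [Equiv.ofBijective_apply, ← H.apply_entry T, ← H.apply_entry T, hf]
      exact hσ _
    · ext1 x
      by_cases hx : x ∈ Set.range (H.entry T)
      · obtain ⟨a, rfl⟩ := hx
        rw [Equiv.Perm.viaFintypeEmbedding_apply_image, Equiv.ofBijective_apply, hf]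
      · rw [Equiv.Perm.viaFintypeEmbedding_apply_notMem_range _ _ hx]
        exact ((H.of_notMem T hx).2 _ (hσ x)).symm

theorem Core.exists_low (H : Core μ k l cell low) (T : Tableau n μ) {x : Fin n}
    (hx : T.row x ≠ 0) : ∃ b, H.entry T (low b) = x := by
  by_cases h : x ∈ Set.range (H.entry T)
  · obtain ⟨a, rfl⟩ := h
    obtain ⟨b, rfl⟩ := (H.low_iff a).1 (by rwa [← H.apply_entry T])
    exact ⟨b, rfl⟩
  · exact absurd (H.of_notMem T h).1 hx

/-- A permutation fixes the tabloid of `T` if and only if it permutes the entries below the first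
row within their rows. -/
theorem Core.smul_tabloid_eq_iff (H : Core μ k l cell low) (T : Tableau n μ) (g : Perm (Fin n)) :
    g • T.tabloid = T.tabloid ↔
      ∃ τ ∈ coreRows cell low, ∀ a, g (H.entry T (low a)) = H.entry T (low (τ a)) := by
  have hrow : g • T.tabloid = T.tabloid ↔ ∀ x, T.row (g x) = T.row x := by
    constructor
    · intro h x
      have := congrFun (congrArg Subtype.val h) (g x)
      rw [smul_val, show g⁻¹ (g x) = x from g.symm_apply_apply x] at this
      exact this.symm
    · intro h
      refine Subtype.ext (funext fun x => ?_)
      rw [smul_val]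
      have := h (g⁻¹ x)
      rw [show g (g⁻¹ x) = x from g.apply_symm_apply x] at this
      exact this.symm
  have hlow : ∀ b, T.row (H.entry T (low b)) ≠ 0 := by
    intro b
    rw [Tableau.row, H.apply_entry]
    exact (H.low_iff _).2 ⟨b, rfl⟩
  rw [hrow]
  simp only [coreRows, Finset.mem_filter, Finset.mem_univ, true_and]
  constructor
  · intro h
    have hr : ∀ a, ∃ b, H.entry T (low b) = g (H.entry T (low a)) :=
      fun a => H.exists_low T (by rw [h]; exact hlow a)
    choose f hf using hr
    have hinj : Function.Injective f := by
      intro a b hab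
      have : H.entry T (low (f a)) = H.entry T (low (f b)) := by rw [hab]
      rw [hf, hf] at this
      exact H.low_injective ((H.entry T).injective (g.injective this))
    refine ⟨Equiv.ofBijective f (Finite.injective_iff_bijective.1 hinj), fun a => ?_, fun a => ?_⟩
    · rw [Equiv.ofBijective_apply, ← H.apply_entry T, ← H.apply_entry T, hf]
      exact h _
    · rw [Equiv.ofBijective_apply, hf]
  · rintro ⟨τ, hτ, h⟩ x
    by_cases hx : T.row x = 0
    · rw [hx]
      by_contra hg
      obtain ⟨b, hb⟩ := H.exists_low T hg
      have h1 := h (τ.symm b)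
      rw [τ.apply_symm_apply, hb] at h1
      rw [← g.injective h1] at hx
      exact hlow _ hx
    · obtain ⟨b, rfl⟩ := H.exists_low T hx
      rw [h, Tableau.row, Tableau.row, H.apply_entry, H.apply_entry, hτ]

/-- At most one row permutation `τ` is compatible with given images of the lower entries. -/
theorem Core.card_filter_exists (H : Core μ k l cell low)
    (s : Finset (Perm (Fin n))) (w : Perm (Fin n) → Fin l → Fin n)
    (v : Fin k → Fin n) (hv : Function.Injective v) :
    (s.filter fun h => ∃ τ ∈ coreRows cell low, ∀ a, w h a = v (low (τ a))).card =
      ∑ τ ∈ coreRows cell low, (s.filter fun h => ∀ a, w h a = v (low (τ a))).card := by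
  classical
  rw [← Finset.card_biUnion]
  · congr 1
    ext h
    simp only [Finset.mem_filter, Finset.mem_biUnion]
    tauto
  · intro τ _ τ' _ hne
    rw [Function.onFun, Finset.disjoint_left]
    intro h h1 h2
    refine hne (Equiv.ext fun a => H.low_injective (hv ?_))
    rw [← (Finset.mem_filter.1 h1).2, (Finset.mem_filter.1 h2).2]

theorem card_image_embedding_comp {α β ι : Type*} [DecidableEq α] [DecidableEq β] [Fintype ι]
    (u : α ↪ β) (e : ι → α) :
    (Finset.univ.image fun a => u (e a)).card = (Finset.univ.image e).card := by
  rw [show (fun a => u (e a)) = u ∘ e from rfl, ← Finset.image_image,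
    Finset.card_image_of_injective _ u.injective]

open scoped Classical in
/-- The numbers of permutations on the right-hand side of `scalar_mul_character`. -/
theorem Core.card_conj (H : Core μ k l cell low) (T : Tableau n μ) (g : Perm (Fin n))
    (c : Perm (Fin k)) :
    (Finset.univ.filter fun h : Perm (Fin n) =>
      (h⁻¹ * g * h * c.viaFintypeEmbedding (H.entry T)) • T.tabloid = T.tabloid).card =
    ∑ τ ∈ coreRows cell low,
      (n - (Finset.univ.image (Sum.elim (fun a => c (low a)) fun a => low (τ a))).card).factorial *
        embCount (fun a b => decide (low (τ a) = c (low b))) g := by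
  simp_rw [H.smul_tabloid_eq_iff T]
  rw [H.card_filter_exists _ _ _ (H.entry T).injective]
  refine Finset.sum_congr rfl fun τ _ => ?_
  have h := sum_conj_indicator g (fun a => H.entry T (c (low a))) (fun a => H.entry T (low (τ a)))
    (fun a b hab => H.low_injective (c.injective ((H.entry T).injective hab)))
    (fun a b hab => τ.injective (H.low_injective ((H.entry T).injective hab)))
  have he : Sum.elim (fun a => H.entry T (c (low a))) (fun a => H.entry T (low (τ a))) =
      fun x => H.entry T (Sum.elim (fun a => c (low a)) (fun a => low (τ a)) x) := by
    ext x; rcases x with x | x <;> rfl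
  rw [he, card_image_embedding_comp] at h
  simp only [(H.entry T).injective.eq_iff] at h
  rw [← h, ← Finset.card_filter]
  refine Finset.card_bij' (fun h _ => h⁻¹) (fun h _ => h⁻¹) ?_ ?_ ?_ ?_
  · intro h hh
    rw [Finset.mem_filter] at hh ⊢
    refine ⟨Finset.mem_univ _, fun a => ?_⟩
    have h' := hh.2 a
    rw [Perm.mul_apply, Equiv.Perm.viaFintypeEmbedding_apply_image] at h'
    rw [inv_inv, h']
  · intro h hh
    rw [Finset.mem_filter] at hh ⊢
    refine ⟨Finset.mem_univ _, fun a => ?_⟩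
    have h' := hh.2 a
    rw [Perm.mul_apply, Equiv.Perm.viaFintypeEmbedding_apply_image, inv_inv, h']
  · intro h _; simp
  · intro h _; simp

open scoped Classical in
/-- The numbers of permutations on the left-hand side of `scalar_mul_character`. -/
theorem Core.card_agree (H : Core μ k l cell low) (T : Tableau n μ) (c d : Perm (Fin k)) :
    (Finset.univ.filter fun h : Perm (Fin n) =>
      h • T.tabloid = c.viaFintypeEmbedding (H.entry T) • T.tabloid ∧
      (h * d.viaFintypeEmbedding (H.entry T)) • T.tabloid = T.tabloid).card =
    ∑ τ ∈ coreRows cell low, ∑ τ' ∈ coreRows cell low,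
      if ∀ x y, Sum.elim low (fun a => d (low a)) x = Sum.elim low (fun a => d (low a)) y ↔
          Sum.elim (fun a => c (low (τ a))) (fun a => low (τ' a)) x =
            Sum.elim (fun a => c (low (τ a))) (fun a => low (τ' a)) y then
        (n - (Finset.univ.image (Sum.elim low fun a => d (low a))).card).factorial else 0 := by
  have h1 : ∀ h : Perm (Fin n), h • T.tabloid = c.viaFintypeEmbedding (H.entry T) • T.tabloid ↔
      ∃ τ ∈ coreRows cell low, ∀ a, h (H.entry T (low a)) = H.entry T (c (low (τ a))) := by
    intro h
    rw [← inv_smul_eq_iff, ← mul_smul, H.smul_tabloid_eq_iff T]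
    simp_rw [Perm.mul_apply, Perm.inv_eq_iff_eq, Equiv.Perm.viaFintypeEmbedding_apply_image]
  simp_rw [h1, H.smul_tabloid_eq_iff T]
  rw [← Finset.filter_filter, H.card_filter_exists _ _ _ (H.entry T).injective, Finset.sum_comm]
  refine Finset.sum_congr rfl fun τ' _ => ?_
  rw [Finset.filter_comm, H.card_filter_exists _ _ (fun a => H.entry T (c a))
    ((H.entry T).injective.comp c.injective)]
  refine Finset.sum_congr rfl fun τ _ => ?_
  have h2 := card_perm_comp_eq_ite
    (fun x => H.entry T (Sum.elim low (fun a => d (low a)) x))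
    (fun x => H.entry T (Sum.elim (fun a => c (low (τ a))) (fun a => low (τ' a)) x))
  rw [card_image_embedding_comp, Fintype.card_fin] at h2
  simp only [(H.entry T).injective.eq_iff] at h2
  rw [Finset.filter_filter]
  convert h2 using 2
  ext h
  simp [Perm.mul_apply, Equiv.Perm.viaFintypeEmbedding_apply_image, and_comm]

/-- The signed number of pairs of column permutations `c`, `d` and pairs of row permutations `τ`, `τ'`
for which some permutation sends `low` to `c ∘ low ∘ τ` and `d ∘ low` to `low ∘ τ'`, restricted to
those that prescribe this permutation at exactly `m` points. -/
def coreScalar {k l : ℕ} (cell : Fin k → ℕ × ℕ) (low : Fin l → Fin k) (m : ℕ) : ℤ :=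
  ∑ c ∈ coreCols cell, ∑ d ∈ coreCols cell,
    (Perm.sign c * Perm.sign d : ℤ) * ∑ τ ∈ coreRows cell low, ∑ τ' ∈ coreRows cell low,
      if (∀ x y, Sum.elim low (fun a => d (low a)) x = Sum.elim low (fun a => d (low a)) y ↔
          Sum.elim (fun a => c (low (τ a))) (fun a => low (τ' a)) x =
            Sum.elim (fun a => c (low (τ a))) (fun a => low (τ' a)) y) ∧
        (Finset.univ.image (Sum.elim low fun a => d (low a))).card = m then 1 else 0

/-- The signed number of pairs of a column permutation and a row permutation that prescribe a
partial injection of class `t` involving `m` points. -/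
def coreSign {k l : ℕ} (cell : Fin k → ℕ × ℕ) (low : Fin l → Fin k) {N : ℕ}
    (cls : (Fin l → Fin l → Bool) → Fin N) (m : ℕ) (t : Fin N) : ℤ :=
  ∑ c ∈ coreCols cell, (Perm.sign c : ℤ) * ∑ τ ∈ coreRows cell low,
    if (Finset.univ.image (Sum.elim (fun a => c (low a)) fun a => low (τ a))).card = m ∧
      cls (fun a b => decide (low (τ a) = c (low b))) = t then 1 else 0

theorem card_image_lt_succ {ι : Type*} [Fintype ι] (e : ι → Fin k) :
    (Finset.univ.image e).card < k + 1 := by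
  have := Finset.card_le_univ (Finset.univ.image e)
  rw [Fintype.card_fin] at this
  omega

theorem isLink_core (H : Core μ k l cell low) (c : Perm (Fin k)) (τ : Perm (Fin l)) :
    IsLink fun a b => decide (low (τ a) = c (low b)) := by
  refine ⟨fun a b b' h1 h2 => ?_, fun a a' b h1 h2 => ?_⟩
  · simp only [decide_eq_true_eq] at h1 h2
    exact H.low_injective (c.injective (h1.symm.trans h2))
  · simp only [decide_eq_true_eq] at h1 h2
    exact τ.injective (H.low_injective (h1.trans h2.symm))

/-- The character of a Specht module, from finite data on the core and the numbers of embeddings of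
partial injections. -/
theorem Core.mul_character (H : Core μ k l cell low) (T : Tableau n μ) {N : ℕ}
    (cls : (Fin l → Fin l → Bool) → Fin N) (E : Fin N → ℕ) (g : Perm (Fin n))
    (hE : ∀ R, IsLink R → embCount R g = E (cls R)) :
    (∑ m ∈ Finset.range (k + 1), (coreScalar cell low m : ℂ) * (n - m).factorial) *
      (rep n μ).character g =
    ∑ m ∈ Finset.range (k + 1), ((n - m).factorial : ℂ) *
      ∑ t, (coreSign cell low cls m t : ℂ) * E t := by
  classical
  have hinj : Set.InjOn (fun c : Perm (Fin k) => c.viaFintypeEmbedding (H.entry T))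
      (coreCols cell) := by
    intro c _ d _ hcd
    refine Equiv.ext fun a => (H.entry T).injective ?_
    rw [← Equiv.Perm.viaFintypeEmbedding_apply_image, ← Equiv.Perm.viaFintypeEmbedding_apply_image]
    exact congrArg (fun σ : Perm (Fin n) => σ (H.entry T a)) hcd
  have hmain := scalar_mul_character T _ (H.isColumnPerm_iff T) g
  rw [Finset.sum_image hinj, Finset.sum_image hinj] at hmain
  simp_rw [Finset.sum_image hinj, H.card_agree, H.card_conj,
    Equiv.Perm.viaFintypeEmbedding_sign] at hmain
  convert hmain using 2
  · simp only [coreScalar, Int.cast_sum, Int.cast_mul, Finset.sum_mul, Nat.cast_sum,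
      Finset.mul_sum]
    rw [Finset.sum_comm]
    refine Finset.sum_congr rfl fun c _ => ?_
    rw [Finset.sum_comm]
    refine Finset.sum_congr rfl fun d _ => ?_
    rw [Finset.sum_comm]
    refine Finset.sum_congr rfl fun τ _ => ?_
    rw [Finset.sum_comm]
    refine Finset.sum_congr rfl fun τ' _ => ?_
    rw [Finset.sum_eq_single (Finset.univ.image (Sum.elim low fun a => d (low a))).card]
    · split_ifs with h1 h2 h2
      · simp
      · exact absurd h1.1 h2
      · exact absurd ⟨h2, rfl⟩ h1
      · simp
    · intro m _ hm
      rw [if_neg (fun h => hm h.2.symm)]; simp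
    · intro h
      exact absurd (Finset.mem_range.2 (card_image_lt_succ _)) h
  · simp only [coreSign, Int.cast_sum, Int.cast_mul, Finset.sum_mul, Nat.cast_sum,
      Finset.mul_sum]
    rw [Finset.sum_congr rfl fun m _ => Finset.sum_comm, Finset.sum_comm]
    refine Finset.sum_congr rfl fun c _ => ?_
    rw [Finset.sum_congr rfl fun m _ => Finset.sum_comm, Finset.sum_comm]
    refine Finset.sum_congr rfl fun τ _ => ?_
    rw [Finset.sum_eq_single
      (Finset.univ.image (Sum.elim (fun a => c (low a)) fun a => low (τ a))).card,
      Finset.sum_eq_single (cls (fun a b => decide (low (τ a) = c (low b))))]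
    · rw [hE _ (isLink_core H c τ)]
      simp; ring
    · intro t _ ht
      rw [if_neg (fun h => ht h.2.symm)]; simp
    · intro h; exact absurd (Finset.mem_univ _) h
    · intro m _ hm
      refine Finset.sum_eq_zero fun t _ => ?_
      rw [if_neg (fun h => hm h.1.symm)]; simp
    · intro h
      exact absurd (Finset.mem_range.2 (card_image_lt_succ _)) h

end Core

end Specht

namespace Specht

/-! ### The five shapes -/

theorem diagram_mem_iff {n : ℕ} (l : n.Partition) (w : List ℕ) (hw : w.Pairwise (· ≥ ·))
    (h : l.parts = (w : Multiset ℕ)) (p : ℕ × ℕ) :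
    p ∈ diagram l ↔ p.2 < w.getD p.1 0 := by
  have hs : l.parts.sort (· ≥ ·) = w := by
    rw [h, Multiset.coe_sort]
    exact List.mergeSort_of_pairwise (hw.imp (by simp))
  rw [diagram, YoungDiagram.mem_ofRowLens]
  simp only [hs]
  constructor
  · rintro ⟨h1, h2⟩
    rwa [List.getD_eq_getElem _ _ h1]
  · intro h1
    have h2 : p.1 < w.length := by
      by_contra h3
      rw [List.getD_eq_default _ _ (not_lt.1 h3)] at h1
      exact Nat.not_lt_zero _ h1
    exact ⟨h2, by rwa [List.getD_eq_getElem _ _ h2] at h1⟩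

theorem nonempty_tableau {n : ℕ} (l : n.Partition) : Nonempty (Tableau n (diagram l)) := by
  classical
  refine ⟨(Fintype.equivFinOfCardEq ?_).symm⟩
  rw [Fintype.card_coe]
  set w := l.parts.sort (· ≥ ·) with hw
  rw [Finset.card_eq_sum_card_fiberwise (f := Prod.fst) (t := Finset.range w.length)]
  · rw [Finset.sum_range]
    have : ∀ i : Fin w.length, ((diagram l).cells.filter fun c => c.1 = (i : ℕ)).card = w[i] := by
      intro i
      rw [← YoungDiagram.rowLen_ofRowLens (hw := (Multiset.pairwise_sort _ _).sortedGE) i,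
        YoungDiagram.rowLen_eq_card]
      rfl
    rw [Finset.sum_congr rfl fun i _ => this i]
    simp only [Fin.getElem_fin]
    rw [Fin.sum_univ_getElem, ← Multiset.sum_coe, hw, Multiset.sort_eq, l.parts_sum]
  · intro c hc
    have hc' := (YoungDiagram.mem_cells _).1 (Finset.mem_coe.1 hc)
    rw [diagram, YoungDiagram.mem_ofRowLens] at hc'
    obtain ⟨h, -⟩ := hc'
    exact Finset.mem_coe.2 (Finset.mem_range.2 h)

/-! For each shape, `cell…` and `low…` enumerate the cells of its core and the indices of those below
the first row. -/

def cellRow : Fin 0 → ℕ × ℕ := ![]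
def lowRow : Fin 0 → Fin 0 := ![]
def cellStd : Fin 2 → ℕ × ℕ := ![(0, 0), (1, 0)]
def lowStd : Fin 1 → Fin 2 := ![1]
def cellSquare : Fin 4 → ℕ × ℕ := ![(0, 0), (1, 0), (0, 1), (1, 1)]
def lowSquare : Fin 2 → Fin 4 := ![1, 3]
def cellHook : Fin 3 → ℕ × ℕ := ![(0, 0), (1, 0), (2, 0)]
def lowHook : Fin 2 → Fin 3 := ![1, 2]
def cellStair : Fin 5 → ℕ × ℕ := ![(0, 0), (1, 0), (2, 0), (0, 1), (1, 1)]
def lowStair : Fin 3 → Fin 5 := ![1, 4, 2]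

variable {n : ℕ}

theorem parts_ofSums {s : Multiset ℕ} (h : s.sum = n) (h0 : ∀ x ∈ s, x ≠ 0) :
    (Nat.Partition.ofSums n s h).parts = s :=
  Multiset.filter_eq_self.2 h0

theorem core_row (h : ({n} : Multiset ℕ).sum = n) (hn : 1 ≤ n) :
    Core (diagram (.ofSums n {n} h)) 0 0 cellRow lowRow := by
  have hm := diagram_mem_iff (.ofSums n {n} h) [n] (by simp)
    ((parts_ofSums h (by simp; omega)).trans rfl)
  refine ⟨fun a => ?_, by decide, by decide, by decide, ?_⟩
  · rw [hm]
    exact a.elim0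
  · rintro ⟨i, j⟩ hp ha
    simp [cellRow] at ha
    rw [hm] at hp
    rcases i with _ | i
    · simp at hp ha
      refine ⟨rfl, ?_⟩
      rintro ⟨i', j'⟩ hq hj
      rw [hm] at hq
      simp only at hj
      subst hj
      rcases i' with _ | i'
      · rfl
      all_goals simp at hq; try omega
    all_goals simp at hp ha; try omega

theorem core_std (h : ({n - 1, 1} : Multiset ℕ).sum = n) (hn : 2 ≤ n) :
    Core (diagram (.ofSums n {n - 1, 1} h)) 2 1 cellStd lowStd := by
  have hm := diagram_mem_iff (.ofSums n {n - 1, 1} h) [n - 1, 1] (by simp; omega)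
    ((parts_ofSums h (by simp; omega)).trans rfl)
  refine ⟨fun a => ?_, by decide, by decide, by decide, ?_⟩
  · rw [hm]
    fin_cases a <;> simp [cellStd]
    omega
  · rintro ⟨i, j⟩ hp ha
    simp [Fin.forall_fin_succ, cellStd] at ha
    rw [hm] at hp
    rcases i with _ | _ | i
    · simp at hp ha
      refine ⟨rfl, ?_⟩
      rintro ⟨i', j'⟩ hq hj
      rw [hm] at hq
      simp only at hj
      subst hj
      rcases i' with _ | _ | i'
      · rfl
      all_goals simp at hq; try omega
    all_goals simp at hp ha; try omega

theorem core_square (h : ({n - 2, 2} : Multiset ℕ).sum = n) (hn : 4 ≤ n) :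
    Core (diagram (.ofSums n {n - 2, 2} h)) 4 2 cellSquare lowSquare := by
  have hm := diagram_mem_iff (.ofSums n {n - 2, 2} h) [n - 2, 2] (by simp; omega)
    ((parts_ofSums h (by simp; omega)).trans rfl)
  refine ⟨fun a => ?_, by decide, by decide, by decide, ?_⟩
  · rw [hm]
    fin_cases a <;> simp [cellSquare] <;> omega
  · rintro ⟨i, j⟩ hp ha
    simp [Fin.forall_fin_succ, cellSquare] at ha
    rw [hm] at hp
    rcases i with _ | _ | i
    · simp at hp ha
      refine ⟨rfl, ?_⟩
      rintro ⟨i', j'⟩ hq hj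
      rw [hm] at hq
      simp only at hj
      subst hj
      rcases i' with _ | _ | i'
      · rfl
      all_goals simp at hq; try omega
    all_goals simp at hp ha; try omega

theorem core_hook (h : ({n - 2, 1, 1} : Multiset ℕ).sum = n) (hn : 3 ≤ n) :
    Core (diagram (.ofSums n {n - 2, 1, 1} h)) 3 2 cellHook lowHook := by
  have hm := diagram_mem_iff (.ofSums n {n - 2, 1, 1} h) [n - 2, 1, 1] (by simp; omega)
    ((parts_ofSums h (by simp; omega)).trans rfl)
  refine ⟨fun a => ?_, by decide, by decide, by decide, ?_⟩
  · rw [hm]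
    fin_cases a <;> simp [cellHook]
    omega
  · rintro ⟨i, j⟩ hp ha
    simp [Fin.forall_fin_succ, cellHook] at ha
    rw [hm] at hp
    rcases i with _ | _ | _ | i
    · simp at hp ha
      refine ⟨rfl, ?_⟩
      rintro ⟨i', j'⟩ hq hj
      rw [hm] at hq
      simp only at hj
      subst hj
      rcases i' with _ | _ | _ | i'
      · rfl
      all_goals simp at hq; try omega
    all_goals simp at hp ha; try omega

theorem core_stair (h : ({n - 3, 2, 1} : Multiset ℕ).sum = n) (hn : 5 ≤ n) :
    Core (diagram (.ofSums n {n - 3, 2, 1} h)) 5 3 cellStair lowStair := by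
  have hm := diagram_mem_iff (.ofSums n {n - 3, 2, 1} h) [n - 3, 2, 1] (by simp; omega)
    ((parts_ofSums h (by simp; omega)).trans rfl)
  refine ⟨fun a => ?_, by decide, by decide, by decide, ?_⟩
  · rw [hm]
    fin_cases a <;> simp [cellStair] <;> omega
  · rintro ⟨i, j⟩ hp ha
    simp [Fin.forall_fin_succ, cellStair] at ha
    rw [hm] at hp
    rcases i with _ | _ | _ | i
    · simp at hp ha
      refine ⟨rfl, ?_⟩
      rintro ⟨i', j'⟩ hq hj
      rw [hm] at hq
      simp only at hj
      subst hj
      rcases i' with _ | _ | _ | i'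
      · rfl
      all_goals simp at hq; try omega
    all_goals simp at hp ha; try omega

/-! The entry number `m` belongs to the permutations prescribed at `m` points. Together with the
factorials `(n - m)!` these coefficients give the scalar by which `polytabloidOp` acts. -/

theorem coreScalar_row : ∀ m : Fin 1, coreScalar cellRow lowRow m = ![1] m := by decide +kernel
theorem coreScalar_std : ∀ m : Fin 3, coreScalar cellStd lowStd m = ![0, 1, 1] m := by
  decide +kernel
theorem coreScalar_square : ∀ m : Fin 5,
    coreScalar cellSquare lowSquare m = ![0, 0, 2, 4, 4] m := by decide +kernel
theorem coreScalar_hook : ∀ m : Fin 4, coreScalar cellHook lowHook m = ![0, 0, 2, 4] m := by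
  decide +kernel
theorem coreScalar_stair : ∀ m : Fin 6,
    coreScalar cellStair lowStair m = ![0, 0, 0, 3, 9, 9] m := by decide +kernel

/-- The class of a partial injection of one point: `1` if it is a loop, and `0` if it is empty. -/
def linkClass₁ (R : Fin 1 → Fin 1 → Bool) : Fin 2 := if R 0 0 then 1 else 0

theorem embCount_fin_one (π : Perm (Fin n)) (R : Fin 1 → Fin 1 → Bool) :
    embCount R π = ![n - numFix π, numFix π] (linkClass₁ R) := by
  have h := numFix_add_card_moved π
  have hc : embCount R π = (Finset.univ.filter fun x => π x = x ↔ R 0 0 = true).card := by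
    refine Finset.card_bij' (fun x _ => x 0) (fun a _ _ => a) ?_ ?_ ?_ ?_
    · intro x hx
      simp only [Finset.mem_filter, Finset.mem_univ, true_and] at hx ⊢
      exact hx.2 0 0
    · intro a ha
      simp only [Finset.mem_filter, Finset.mem_univ, true_and] at ha ⊢
      refine ⟨Function.injective_of_subsingleton _, fun a b => ?_⟩
      rw [Subsingleton.elim a 0, Subsingleton.elim b 0]
      exact ha
    · intro x _
      funext a
      rw [Subsingleton.elim a 0]
    · intro a _; rfl
  rw [hc, linkClass₁]
  cases hR : R 0 0
  · have h' : (Finset.univ.filter fun x => ¬ π x = x).card = n - numFix π := Nat.eq_sub_of_add_eq' h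
    simpa using h'
  · simp [numFix]

theorem character_row (h : ({n} : Multiset ℕ).sum = n) (hn : 1 ≤ n) (π : Perm (Fin n)) :
    irrChar (.ofSums n {n} h) π = 1 := by
  obtain ⟨T⟩ := nonempty_tableau (.ofSums n {n} h)
  have key := (core_row h hn).mul_character T (N := 1) (fun _ => 0) (fun _ => 1) π (by
    intro R _
    simp [embCount, Function.injective_of_subsingleton])
  have c : ∀ (m : Fin 1) (t : Fin 1), coreSign cellRow lowRow (fun _ => (0 : Fin 1)) m t =
      (![![1]] : Fin 1 → Fin 1 → ℤ) m t := by decide +kernel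
  simp only [Finset.sum_range, coreScalar_row, c] at key
  simp at key
  have hne : (n.factorial : ℂ) ≠ 0 := by exact_mod_cast n.factorial_ne_zero
  exact mul_left_cancel₀ hne (key.trans (mul_one _).symm)

theorem character_std (h : ({n - 1, 1} : Multiset ℕ).sum = n) (hn : 2 ≤ n) (π : Perm (Fin n)) :
    irrChar (.ofSums n {n - 1, 1} h) π = ((numFix π - 1 : ℚ) : ℂ) := by
  obtain ⟨T⟩ := nonempty_tableau (.ofSums n {n - 1, 1} h)
  have key : _ * irrChar _ π = _ := (core_std h hn).mul_character T linkClass₁ _ π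
    fun R _ => embCount_fin_one π R
  have c : ∀ (m : Fin 3) (t : Fin 2), coreSign cellStd lowStd linkClass₁ m t =
      (![![0, 0], ![0, 1], ![-1, 0]] : Fin 3 → Fin 2 → ℤ) m t := by decide +kernel
  simp only [Finset.sum_range, coreScalar_std, c] at key
  generalize irrChar (Nat.Partition.ofSums n {n - 1, 1} h) π = χ at key ⊢
  have hf : numFix π ≤ n := (Nat.le_add_right _ _).trans (numFix_add_card_moved π).le
  obtain ⟨m, rfl⟩ : ∃ m, n = m + 2 := ⟨n - 2, by omega⟩
  have hne : ((m + 2) * m.factorial : ℂ) ≠ 0 := by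
    exact_mod_cast mul_ne_zero (by omega) m.factorial_ne_zero
  refine mul_left_cancel₀ hne ?_
  simp [Fin.sum_univ_succ, Nat.cast_sub hf, Nat.factorial_succ] at key
  push_cast
  linear_combination key

theorem character_square (h : ({n - 2, 2} : Multiset ℕ).sum = n) (hn : 4 ≤ n)
    (π : Perm (Fin n)) :
    irrChar (.ofSums n {n - 2, 2} h) π =
      (((numFix π * (numFix π - 3) + numTwo π) / 2 : ℚ) : ℂ) := by
  obtain ⟨T⟩ := nonempty_tableau (.ofSums n {n - 2, 2} h)
  have key : _ * irrChar _ π = _ := (core_square h hn).mul_character T linkClass₂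
    (fun t => embCount (linkRep₂ t) π) π (embCount_eq_rep₂ π)
  have c : ∀ (m : Fin 5) (t : Fin 5), coreSign cellSquare lowSquare linkClass₂ m t =
      (![![0, 0, 0, 0, 0], ![0, 0, 0, 0, 0], ![0, 0, 0, 1, 1], ![0, -2, -2, 0, 0],
        ![2, 0, 0, 0, 0]] : Fin 5 → Fin 5 → ℤ) m t := by decide +kernel
  have hE : ∀ t, (embCount (linkRep₂ t) π : ℂ) =
      ((embPoly₂ n (numFix π) (numTwo π) t : ℚ) : ℂ) := fun t => by
    rw [← embCount_linkRep₂ π (by omega)]; simp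
  simp only [Finset.sum_range, coreScalar_square, c, hE] at key
  generalize irrChar (Nat.Partition.ofSums n {n - 2, 2} h) π = χ at key ⊢
  obtain ⟨m, rfl⟩ : ∃ m, n = m + 4 := ⟨n - 4, by omega⟩
  have hne : (2 * (m + 3) * (m + 2) * m.factorial : ℂ) ≠ 0 := by
    exact_mod_cast mul_ne_zero (by positivity) m.factorial_ne_zero
  refine mul_left_cancel₀ hne ?_
  simp [Fin.sum_univ_succ, Nat.factorial_succ, embPoly₂] at key
  push_cast
  linear_combination key

theorem character_hook (h : ({n - 2, 1, 1} : Multiset ℕ).sum = n) (hn : 3 ≤ n)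
    (π : Perm (Fin n)) :
    irrChar (.ofSums n {n - 2, 1, 1} h) π =
      ((((numFix π - 1) * (numFix π - 2) - numTwo π) / 2 : ℚ) : ℂ) := by
  obtain ⟨T⟩ := nonempty_tableau (.ofSums n {n - 2, 1, 1} h)
  have key : _ * irrChar _ π = _ := (core_hook h hn).mul_character T linkClass₂
    (fun t => embCount (linkRep₂ t) π) π (embCount_eq_rep₂ π)
  have c : ∀ (m : Fin 4) (t : Fin 5), coreSign cellHook lowHook linkClass₂ m t =
      (![![0, 0, 0, 0, 0], ![0, 0, 0, 0, 0], ![0, 0, 0, 1, -1], ![0, -2, 2, 0, 0]] :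
        Fin 4 → Fin 5 → ℤ) m t := by decide +kernel
  have hE : ∀ t, (embCount (linkRep₂ t) π : ℂ) =
      ((embPoly₂ n (numFix π) (numTwo π) t : ℚ) : ℂ) := fun t => by
    rw [← embCount_linkRep₂ π (by omega)]; simp
  simp only [Finset.sum_range, coreScalar_hook, c, hE] at key
  generalize irrChar (Nat.Partition.ofSums n {n - 2, 1, 1} h) π = χ at key ⊢
  obtain ⟨m, rfl⟩ : ∃ m, n = m + 3 := ⟨n - 3, by omega⟩
  have hne : (2 * (m + 3) * m.factorial : ℂ) ≠ 0 := by
    exact_mod_cast mul_ne_zero (by positivity) m.factorial_ne_zero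
  refine mul_left_cancel₀ hne ?_
  simp [Fin.sum_univ_succ, Nat.factorial_succ, embPoly₂] at key
  push_cast
  linear_combination key

theorem character_stair (h : ({n - 3, 2, 1} : Multiset ℕ).sum = n) (hn : 5 ≤ n)
    (π : Perm (Fin n)) :
    irrChar (.ofSums n {n - 3, 2, 1} h) π =
      (((numFix π * (numFix π - 2) * (numFix π - 4) - numThree π) / 3 : ℚ) : ℂ) := by
  obtain ⟨T⟩ := nonempty_tableau (.ofSums n {n - 3, 2, 1} h)
  have key : _ * irrChar _ π = _ := (core_stair h hn).mul_character T linkClass₃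
    (fun t => embCount (linkRep₃ t) π) π (embCount_eq_rep₃ π)
  have c : ∀ (m : Fin 6) (t : Fin 10), coreSign cellStair lowStair linkClass₃ m t =
      (![0, 0, 0, ![0, 0, 0, 0, 0, 0, 0, 1, 0, -1], ![0, 0, 0, -3, 0, 0, 3, 0, 0, 0],
        ![0, 3, -3, 0, 0, 0, 0, 0, 0, 0]] : Fin 6 → Fin 10 → ℤ) m t := by decide +kernel
  have hE : ∀ t, (embCount (linkRep₃ t) π : ℂ) =
      ((embPoly₃ n (numFix π) (numTwo π) (numThree π) t : ℚ) : ℂ) := fun t => by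
    rw [← embCount_linkRep₃ π (by omega)]; simp
  simp only [Finset.sum_range, coreScalar_stair, c, hE] at key
  generalize irrChar (Nat.Partition.ofSums n {n - 3, 2, 1} h) π = χ at key ⊢
  obtain ⟨m, rfl⟩ : ∃ m, n = m + 5 := ⟨n - 5, by omega⟩
  have hne : (3 * (m + 4) * (m + 2) * m.factorial : ℂ) ≠ 0 := by
    exact_mod_cast mul_ne_zero (by positivity) m.factorial_ne_zero
  refine mul_left_cancel₀ hne ?_
  simp [Fin.sum_univ_succ, Nat.factorial_succ, embPoly₃] at key
  push_cast
  linear_combination key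

end Specht

/-! ### The class functions in terms of cycle numbers -/

/-- The values of the five class functions `chiVec` at a permutation of `n` points with `f` fixed points,
`t` points on two-cycles and `w` points on three-cycles. -/
def chiPoly (f t w : ℚ) : Fin 5 → ℚ :=
  ![1, f - 1, (f * (f - 3) + t) / 2, ((f - 1) * (f - 2) - t) / 2, (f * (f - 2) * (f - 4) - w) / 3]

/-- The two relations behind the reading of `χ^(n-2,2)` and `χ^(n-3,2,1)` for `n = 3`. -/
theorem numbers_three : ∀ π : Perm (Fin 3),
    ((numFix π : ℤ) * (numFix π - 3) + numTwo π = 0) ∧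
    2 * ((numFix π : ℤ) * (numFix π - 2) * (numFix π - 4) - numThree π) =
      - (3 * ((numFix π - 1) * (numFix π - 2) - numTwo π)) := by
  decide +kernel

/-- The relation behind the reading of `χ^(n-3,2,1)` for `n = 4`. -/
theorem numbers_four : ∀ π : Perm (Fin 4),
    (numFix π : ℤ) * (numFix π - 2) * (numFix π - 4) - numThree π = 0 := by
  decide +kernel

theorem chiVec_eq {n : ℕ} (hn : 3 ≤ n) (j : Fin 5) (π : Perm (Fin n)) :
    chiVec hn j π = ((chiPoly (numFix π) (numTwo π) (numThree π) j : ℚ) : ℂ) := by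
  fin_cases j
  · exact (Specht.character_row _ (by omega) π).trans (by simp [chiPoly])
  · exact (Specht.character_std _ (by omega) π).trans (by simp [chiPoly])
  · change (dite _ _ _ : Perm (Fin n) → ℂ) π = _
    split_ifs with h4
    · exact (Specht.character_square _ h4 π).trans (by simp [chiPoly])
    · obtain rfl : n = 3 := by omega
      have h := congrArg (Int.cast : ℤ → ℂ) (numbers_three π).1
      push_cast at h
      simp [chiPoly, h]
  · exact (Specht.character_hook _ hn π).trans (by simp [chiPoly])
  · change (dite _ _ _ : Perm (Fin n) → ℂ) π = _
    split_ifs with h5 h4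
    · exact (Specht.character_stair _ h5 π).trans (by simp [chiPoly])
    · subst h4
      have h := congrArg (Int.cast : ℤ → ℂ) (numbers_four π)
      push_cast at h
      simp [chiPoly, h]
    · obtain rfl : n = 3 := by omega
      have h := congrArg (Int.cast : ℤ → ℂ) (numbers_three π).2
      push_cast at h
      rw [Pi.neg_apply, Specht.character_hook _ le_rfl π]
      simp [chiPoly]
      linear_combination (-1 / 6 : ℂ) * h

/-! ### Increasing sequences with prescribed tight gaps -/

section Gaps

variable {z n : ℕ}

/-- An increasing sequence in `{0, …, n - 1}`, shifted up by one and bordered by `0` and `n + 1`, so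
that a bracket or an absent dash means that two consecutive terms differ by one. -/
def bordered (f : Fin z → Fin n) : ℕ → ℕ
  | 0 => 0
  | k + 1 => if h : k < z then f ⟨k, h⟩ + 1 else n + 1

theorem bordered_succ (f : Fin z → Fin n) (k : Fin z) : bordered f (k + 1) = f k + 1 := by
  simp [bordered]

theorem bordered_last (f : Fin z → Fin n) : bordered f (z + 1) = n + 1 := by
  simp [bordered]

theorem bordered_lt (f : Fin z → Fin n) (hf : StrictMono f) (k : ℕ) (hk : k ≤ z) :
    bordered f k < bordered f (k + 1) := by
  rcases k with _ | k
  · rw [bordered, bordered]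
    split_ifs <;> omega
  · have hk' : k < z := hk
    rw [bordered, dif_pos hk', bordered]
    split_ifs with h
    · have := hf (show (⟨k, hk'⟩ : Fin z) < ⟨k + 1, h⟩ from Nat.lt_succ_self k)
      have h2 : (f ⟨k, hk'⟩ : ℕ) < f ⟨k + 1, h⟩ := this
      omega
    · have := (f ⟨k, hk'⟩).2
      omega

theorem bordered_eq_sum (f : Fin z → Fin n) (hf : StrictMono f) (k : ℕ) (hk : k ≤ z + 1) :
    k + ∑ l ∈ Finset.range k, (bordered f (l + 1) - bordered f l - 1) = bordered f k := by
  induction k with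
  | zero => simp [bordered]
  | succ k ih =>
    have h1 := bordered_lt f hf k (by omega)
    have h2 := ih (by omega)
    rw [Finset.sum_range_succ]
    omega

/-- The number of increasing sequences of length `z` in `{0, …, n - 1}` for which the gaps in `T`
are closed: the remaining gaps form a composition of `n - z`. -/
theorem card_strictMono_tight (T : Finset (Fin (z + 1))) (hT : T.card ≤ z) (hTn : T.card ≤ n) :
    (Finset.univ.filter fun f : Fin z → Fin n =>
      StrictMono f ∧ ∀ l ∈ T, bordered f (l + 1) = bordered f l + 1).card =
    (n - T.card).choose (z - T.card) := by
  classical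
  by_cases hzn : z ≤ n
  swap
  · rw [Nat.choose_eq_zero_of_lt (by omega), Finset.card_eq_zero, Finset.filter_eq_empty_iff]
    rintro f - ⟨hf, -⟩
    have := Fintype.card_le_of_injective f hf.injective
    rw [Fintype.card_fin, Fintype.card_fin] at this
    exact hzn this
  have hcard : (Finset.finsuppAntidiag (Finset.univ \ T) (n - z)).card =
      (n - T.card).choose (z - T.card) := by
    rw [Finset.card_finsuppAntidiag_nat_eq_choose, Finset.card_sdiff_of_subset (Finset.subset_univ _),
      Finset.card_univ, Fintype.card_fin]
    rw [show z + 1 - T.card + (n - z) - 1 = n - T.card by omega,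
      ← Nat.choose_symm (show z - T.card ≤ n - T.card by omega)]
    congr 1
    omega
  rw [← hcard]
  refine Finset.card_bij (fun f _ => Finsupp.equivFunOnFinite.symm
    fun l : Fin (z + 1) => bordered f (l + 1) - bordered f l - 1) ?_ ?_ ?_
  · intro f hf
    simp only [Finset.mem_filter, Finset.mem_univ, true_and] at hf
    rw [Finset.mem_finsuppAntidiag']
    constructor
    · rw [Finsupp.sum_fintype _ _ (fun _ => rfl)]
      have h := bordered_eq_sum f hf.1 (z + 1) le_rfl
      rw [bordered_last, Finset.sum_range] at h
      simp only [Finsupp.coe_equivFunOnFinite_symm]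
      omega
    · intro l hl
      simp only [Finset.mem_sdiff, Finset.mem_univ, true_and]
      intro hlT
      have h := hf.2 l hlT
      simp only [Finsupp.mem_support_iff, Finsupp.coe_equivFunOnFinite_symm] at hl
      omega
  · intro f hf g hg hfg
    simp only [Finset.mem_filter, Finset.mem_univ, true_and] at hf hg
    have h : ∀ l : Fin (z + 1), bordered f (l + 1) - bordered f l - 1 =
        bordered g (l + 1) - bordered g l - 1 := fun l => DFunLike.congr_fun hfg l
    funext k
    have h1 := bordered_eq_sum f hf.1 (k + 1) (by omega)
    have h2 := bordered_eq_sum g hg.1 (k + 1) (by omega)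
    rw [bordered_succ] at h1 h2
    have h3 : ∑ l ∈ Finset.range (k + 1), (bordered f (l + 1) - bordered f l - 1) =
        ∑ l ∈ Finset.range (k + 1), (bordered g (l + 1) - bordered g l - 1) := by
      refine Finset.sum_congr rfl fun l hl => ?_
      have := Finset.mem_range.1 hl
      exact h ⟨l, by omega⟩
    ext
    omega
  · intro d hd
    rw [Finset.mem_finsuppAntidiag'] at hd
    obtain ⟨hsum, hsupp⟩ := hd
    rw [Finsupp.sum_fintype _ _ (fun _ => rfl)] at hsum
    set e : ℕ → ℕ := fun l => if h : l < z + 1 then d ⟨l, h⟩ else 0 with he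
    have he' : ∀ l : Fin (z + 1), e l = d l := fun l => dif_pos l.2
    have hsum' : ∑ l ∈ Finset.range (z + 1), e l = n - z := by
      rw [Finset.sum_range, ← hsum]
      exact Finset.sum_congr rfl fun l _ => he' l
    have hle : ∀ k, k < z → ∑ l ∈ Finset.range (k + 1), e l ≤ n - z := by
      intro k hk
      rw [← hsum']
      exact Finset.sum_le_sum_of_subset (Finset.range_subset_range.2 (by omega))
    set f : Fin z → Fin n := fun k => ⟨k + ∑ l ∈ Finset.range (k + 1), e l, by
      have := hle k k.2
      omega⟩ with hf
    have hB : ∀ k, k ≤ z + 1 → bordered f k = k + ∑ l ∈ Finset.range k, e l := by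
      intro k hk
      rcases k with _ | k
      · simp [bordered]
      · rw [bordered]
        split_ifs with h
        · simp only [hf]; omega
        · obtain rfl : k = z := by omega
          rw [hsum']; omega
    have hgap : ∀ k, k ≤ z → bordered f (k + 1) = bordered f k + 1 + e k := by
      intro k hk
      rw [hB k (by omega), hB (k + 1) (by omega), Finset.sum_range_succ]
      omega
    have hmono : StrictMono f := by
      intro a b hab
      have hab' : (a : ℕ) < b := hab
      have : ∑ l ∈ Finset.range (a + 1), e l ≤ ∑ l ∈ Finset.range (b + 1), e l :=
        Finset.sum_le_sum_of_subset (Finset.range_subset_range.2 (by omega))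
      simp only [hf, Fin.mk_lt_mk]
      omega
    refine ⟨f, ?_, ?_⟩
    · simp only [Finset.mem_filter, Finset.mem_univ, true_and]
      refine ⟨hmono, fun l hl => ?_⟩
      rw [hgap l (by omega)]
      have h0 : d l = 0 := by
        by_contra h
        have := hsupp (Finsupp.mem_support_iff.2 h)
        simp [hl] at this
      have : e l = 0 := (he' l).trans h0
      omega
    · ext l
      simp only [Finsupp.coe_equivFunOnFinite_symm]
      rw [hgap l (by omega)]
      have := he' l
      omega

end Gaps

/-! ### Placing the positions of an occurrence -/

namespace VincularPattern

/-- The positions `i 0 < i 1 < i 2` among `m` satisfy the conditions given by square brackets and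
absent dashes. -/
def PositionsOK (φ : VincularPattern) (m : ℕ) (i : Fin 3 → ℕ) : Prop :=
  (φ.startBracket = true → i 0 = 0) ∧ (φ.bond₁₂ = true → i 1 = i 0 + 1) ∧
  (φ.bond₂₃ = true → i 2 = i 1 + 1) ∧ (φ.endBracket = true → i 2 + 1 = m)

instance (φ : VincularPattern) (m : ℕ) (i : Fin 3 → ℕ) : Decidable (φ.PositionsOK m i) := by
  unfold PositionsOK; infer_instance

section Tight

variable {z n : ℕ} (φ : VincularPattern)

/-- The gaps that the conditions of `φ` close in an increasing sequence of length `z` whose terms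
number `i 0`, `i 1`, `i 2` are the positions of an occurrence. -/
def tightGaps (i : Fin 3 → Fin z) : Finset (Fin (z + 1)) :=
  (((if φ.startBracket then {0} else ∅) ∪ (if φ.bond₁₂ then {(i 1).castSucc} else ∅)) ∪
    (if φ.bond₂₃ then {(i 2).castSucc} else ∅)) ∪ (if φ.endBracket then {Fin.last z} else ∅)

theorem card_tightGaps (i : Fin 3 → Fin z) (hi : StrictMono i) :
    (φ.tightGaps i).card = φ.numConditions := by
  have h01 : (i 0 : ℕ) < i 1 := hi (by decide)
  have h12 : (i 1 : ℕ) < i 2 := hi (by decide)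
  have h2 := (i 2).2
  unfold tightGaps numConditions
  rw [Finset.card_union_of_disjoint, Finset.card_union_of_disjoint, Finset.card_union_of_disjoint]
  · congr 1
    · congr 1
      · congr 1
        · cases φ.startBracket <;> simp
        · cases φ.bond₁₂ <;> simp
      · cases φ.bond₂₃ <;> simp
    · cases φ.endBracket <;> simp
  · cases φ.startBracket <;> cases φ.bond₁₂ <;> simp [Fin.ext_iff]
    omega
  · cases φ.startBracket <;> cases φ.bond₁₂ <;> cases φ.bond₂₃ <;> simp [Fin.ext_iff] <;> omega
  · cases φ.startBracket <;> cases φ.bond₁₂ <;> cases φ.bond₂₃ <;> cases φ.endBracket <;>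
      simp [Fin.ext_iff] <;> omega

/-- Conditions satisfied by the images under an increasing map are satisfied by the arguments. -/
theorem positionsOK_of_comp (i : Fin 3 → Fin z) (hi : StrictMono i) (f : Fin z → Fin n)
    (hf : StrictMono f) (h : φ.PositionsOK n fun a => f (i a)) : φ.PositionsOK z fun a => i a := by
  have h01 : (i 0 : ℕ) < i 1 := hi (by decide)
  have h12 : (i 1 : ℕ) < i 2 := hi (by decide)
  have h2 := (i 2).2
  -- a term strictly between two terms would be sent strictly between their images
  have key : ∀ a b : Fin z, (f b : ℕ) = f a + 1 → (b : ℕ) = a + 1 := by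
    intro a b hab
    have hlt : a < b := hf.lt_iff_lt.1 (show (f a : ℕ) < f b by omega)
    have hlt' : (a : ℕ) < b := hlt
    by_contra hne
    have hc : (a : ℕ) + 1 < z := by omega
    have h1 : (f a : ℕ) < f ⟨a + 1, hc⟩ := hf (show (a : ℕ) < a + 1 by omega)
    have h2 : (f ⟨a + 1, hc⟩ : ℕ) < f b := hf (show (a : ℕ) + 1 < b by omega)
    omega
  refine ⟨fun hs => ?_, fun hb => key _ _ (h.2.1 hb), fun hb => key _ _ (h.2.2.1 hb), fun he => ?_⟩
  · have h0 : (f (i 0) : ℕ) = 0 := h.1 hs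
    by_contra hne
    have hne' : (i 0 : ℕ) ≠ 0 := hne
    have h1 : (f ⟨0, by omega⟩ : ℕ) < f (i 0) := hf (show 0 < (i 0 : ℕ) by omega)
    omega
  · have h0 : (f (i 2) : ℕ) + 1 = n := h.2.2.2 he
    by_contra hne
    have hc : (i 2 : ℕ) + 1 < z := by simp only at hne; omega
    have h1 : (f (i 2) : ℕ) < f ⟨i 2 + 1, hc⟩ := hf (show (i 2 : ℕ) < i 2 + 1 by omega)
    have := (f ⟨i 2 + 1, hc⟩).2
    omega

theorem positionsOK_comp_iff (i : Fin 3 → Fin z) (hi : StrictMono i) (f : Fin z → Fin n)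
    (h : φ.PositionsOK z fun a => i a) :
    (φ.PositionsOK n fun a => f (i a)) ↔
      ∀ l ∈ φ.tightGaps i, bordered f (l + 1) = bordered f l + 1 := by
  have h01 : (i 0 : ℕ) < i 1 := hi (by decide)
  have h12 : (i 1 : ℕ) < i 2 := hi (by decide)
  have h2 := (i 2).2
  have hs := bordered_succ f
  have hl := bordered_last f
  have h0 : bordered f 0 = 0 := rfl
  obtain ⟨q1, q2, q3, q4⟩ := h
  simp only at q1 q2 q3 q4
  have e1 : φ.startBracket = true → ((f (i 0) : ℕ) = 0 ↔ bordered f (0 + 1) = bordered f 0 + 1) := by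
    intro h
    have := hs (i 0)
    rw [q1 h] at this
    rw [this, h0]; omega
  have e2 : φ.bond₁₂ = true → ((f (i 1) : ℕ) = f (i 0) + 1 ↔
      bordered f (i 1 + 1) = bordered f (i 1) + 1) := by
    intro h
    have := hs (i 0)
    rw [← q2 h] at this
    rw [this, hs]; omega
  have e3 : φ.bond₂₃ = true → ((f (i 2) : ℕ) = f (i 1) + 1 ↔
      bordered f (i 2 + 1) = bordered f (i 2) + 1) := by
    intro h
    have := hs (i 1)
    rw [← q3 h] at this
    rw [this, hs]; omega
  have e4 : φ.endBracket = true → ((f (i 2) : ℕ) + 1 = n ↔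
      bordered f (z + 1) = bordered f z + 1) := by
    intro h
    have := hs (i 2)
    rw [q4 h] at this
    rw [this, hl]; omega
  have hmem : ∀ P : Fin (z + 1) → Prop, (∀ l ∈ φ.tightGaps i, P l) ↔
      (φ.startBracket = true → P 0) ∧ (φ.bond₁₂ = true → P (i 1).castSucc) ∧
      (φ.bond₂₃ = true → P (i 2).castSucc) ∧ (φ.endBracket = true → P (Fin.last z)) := by
    intro P
    unfold tightGaps
    simp only [Finset.forall_mem_union, and_assoc]
    cases φ.startBracket <;> cases φ.bond₁₂ <;> cases φ.bond₂₃ <;> cases φ.endBracket <;> simp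
  rw [hmem]
  simp only [PositionsOK, Fin.val_castSucc, Fin.val_last, Fin.val_zero]
  rw [imp_congr_right e1, imp_congr_right e2, imp_congr_right e3, imp_congr_right e4]

/-- The number of ways to place `z` points in `Fin n` such that those number `i 0`, `i 1`, `i 2` satisfy
the conditions of `φ`. -/
theorem card_strictMono_positionsOK (hφ : φ.numConditions ≤ 3) (hn : 3 ≤ n) (i : Fin 3 → Fin z)
    (hi : StrictMono i) :
    (Finset.univ.filter fun f : Fin z → Fin n =>
      StrictMono f ∧ φ.PositionsOK n fun a => f (i a)).card =
    if φ.PositionsOK z fun a => i a then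
      (n - φ.numConditions).choose (z - φ.numConditions) else 0 := by
  have h01 : (i 0 : ℕ) < i 1 := hi (by decide)
  have h12 : (i 1 : ℕ) < i 2 := hi (by decide)
  have h2 := (i 2).2
  split_ifs with h
  · -- each condition of `φ` closes one of the `z + 1` gaps
    have hc := φ.card_tightGaps i hi
    rw [← hc, ← card_strictMono_tight (φ.tightGaps i) (by omega) (by omega)]
    congr 1
    ext f
    simp only [Finset.mem_filter, Finset.mem_univ, true_and]
    rw [φ.positionsOK_comp_iff i hi f h]
  · rw [Finset.card_eq_zero, Finset.filter_eq_empty_iff]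
    rintro f - ⟨hf, hp⟩
    exact h (φ.positionsOK_of_comp i hi f hf hp)

end Tight

end VincularPattern

/-! ### Occurrences by the relative position of positions and letters -/

namespace VincularPattern

section Regroup

variable {n : ℕ}

/-- Pairs of increasing triples in `{0, …, z - 1}` that together cover all of it. -/
def localPairs (z : ℕ) : Finset ((Fin 3 → Fin z) × (Fin 3 → Fin z)) :=
  ((Finset.univ.filter fun i : Fin 3 → Fin z => StrictMono i) ×ˢ
    (Finset.univ.filter fun v : Fin 3 → Fin z => StrictMono v)).filter fun q =>
      ∀ x, (∃ a, q.1 a = x) ∨ ∃ a, q.2 a = x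

theorem mem_localPairs {z : ℕ} (q : (Fin 3 → Fin z) × (Fin 3 → Fin z)) :
    q ∈ localPairs z ↔ (StrictMono q.1 ∧ StrictMono q.2) ∧
      ∀ x, (∃ a, q.1 a = x) ∨ ∃ a, q.2 a = x := by
  simp [localPairs]

/-- A pair of increasing triples is the image of a covering pair under an increasing map, in a
unique way: the map enumerates the union of the two triples. -/
theorem sum_strictMono_pairs {M : Type*} [AddCommMonoid M] (P : (Fin 3 → Fin n) → Prop)
    [DecidablePred P] (G : (Fin 3 → Fin n) → (Fin 3 → Fin n) → M) :
    (∑ i : Fin 3 → Fin n with StrictMono i ∧ P i, ∑ v : Fin 3 → Fin n with StrictMono v, G i v) =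
    ∑ z ∈ Finset.range 7, ∑ q ∈ localPairs z,
      ∑ f : Fin z → Fin n with StrictMono f ∧ P (fun a => f (q.1 a)),
        G (fun a => f (q.1 a)) (fun a => f (q.2 a)) := by
  classical
  rw [← Finset.sum_product' (f := G)]
  simp_rw [Finset.sum_sigma']
  symm
  refine Finset.sum_bij (fun t _ => (fun a => t.2.2 (t.2.1.1 a), fun a => t.2.2 (t.2.1.2 a)))
    ?_ ?_ ?_ (fun t _ => rfl)
  · rintro ⟨z, q, f⟩ ht
    simp only [Finset.mem_sigma, mem_localPairs, Finset.mem_filter, Finset.mem_univ,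
      true_and] at ht
    obtain ⟨-, ⟨⟨hi, hv⟩, -⟩, hf, hP⟩ := ht
    simp only [Finset.mem_product, Finset.mem_filter, Finset.mem_univ, true_and]
    exact ⟨⟨hf.comp hi, hP⟩, hf.comp hv⟩
  · rintro ⟨z, q, f⟩ ht ⟨z', q', f'⟩ ht' heq
    simp only [Finset.mem_sigma, mem_localPairs, Finset.mem_filter, Finset.mem_univ,
      true_and] at ht ht'
    obtain ⟨-, ⟨-, hs⟩, hf, -⟩ := ht
    obtain ⟨-, ⟨-, hs'⟩, hf', -⟩ := ht'
    have h1 : ∀ a, f (q.1 a) = f' (q'.1 a) := fun a => congrFun (Prod.ext_iff.1 heq).1 a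
    have h2 : ∀ a, f (q.2 a) = f' (q'.2 a) := fun a => congrFun (Prod.ext_iff.1 heq).2 a
    have hr : Set.range f = Set.range f' := by
      apply Set.Subset.antisymm
      · rintro _ ⟨x, rfl⟩
        rcases hs x with ⟨a, rfl⟩ | ⟨a, rfl⟩
        · exact ⟨_, (h1 a).symm⟩
        · exact ⟨_, (h2 a).symm⟩
      · rintro _ ⟨x, rfl⟩
        rcases hs' x with ⟨a, rfl⟩ | ⟨a, rfl⟩
        · exact ⟨_, h1 a⟩
        · exact ⟨_, h2 a⟩
    have hz : z = z' := by
      have c1 := Set.card_range_of_injective hf.injective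
      have c2 := Set.card_range_of_injective hf'.injective
      rw [Fintype.card_fin] at c1 c2
      rw [← c1, ← c2]
      exact Fintype.card_congr (Equiv.setCongr hr)
    subst hz
    obtain rfl : f = f' := (hf.range_inj hf').1 hr
    obtain rfl : q = q' := Prod.ext (funext fun a => hf.injective (h1 a))
      (funext fun a => hf.injective (h2 a))
    rfl
  · rintro ⟨i, v⟩ hiv
    simp only [Finset.mem_product, Finset.mem_filter, Finset.mem_univ, true_and] at hiv
    obtain ⟨⟨hi, hP⟩, hv⟩ := hiv
    set U := Finset.univ.image i ∪ Finset.univ.image v with hU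
    set f := U.orderEmbOfFin rfl with hf
    have hrange : ∀ y, y ∈ U → ∃ x, f x = y := by
      intro y hy
      have : y ∈ Set.range f := by rw [hf, Finset.range_orderEmbOfFin]; exact hy
      exact this
    have hiU : ∀ a, i a ∈ U := fun a => Finset.mem_union_left _ (Finset.mem_image_of_mem _ (by simp))
    have hvU : ∀ a, v a ∈ U := fun a => Finset.mem_union_right _ (Finset.mem_image_of_mem _ (by simp))
    choose i₀ hi₀ using fun a => hrange _ (hiU a)
    choose v₀ hv₀ using fun a => hrange _ (hvU a)
    have hcard : U.card < 7 := by
      have h1 : (Finset.univ.image i).card ≤ 3 := by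
        simpa using Finset.card_image_le (s := (Finset.univ : Finset (Fin 3))) (f := i)
      have h2 : (Finset.univ.image v).card ≤ 3 := by
        simpa using Finset.card_image_le (s := (Finset.univ : Finset (Fin 3))) (f := v)
      have := Finset.card_union_le (Finset.univ.image i) (Finset.univ.image v)
      rw [← hU] at this
      omega
    refine ⟨⟨U.card, (i₀, v₀), f⟩, ?_, ?_⟩
    · simp only [Finset.mem_sigma, mem_localPairs, Finset.mem_filter, Finset.mem_univ,
        true_and, Finset.mem_range, hi₀]
      refine ⟨hcard, ⟨⟨?_, ?_⟩, ?_⟩, f.strictMono, hP⟩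
      · intro a b hab
        rw [← f.lt_iff_lt, hi₀, hi₀]; exact hi hab
      · intro a b hab
        rw [← f.lt_iff_lt, hv₀, hv₀]; exact hv hab
      · intro x
        have hx : f x ∈ Finset.univ.image i ∪ Finset.univ.image v :=
          Finset.orderEmbOfFin_mem U rfl x
        rw [Finset.mem_union, Finset.mem_image, Finset.mem_image] at hx
        rcases hx with ⟨a, -, ha⟩ | ⟨a, -, ha⟩
        · exact Or.inl ⟨a, f.injective ((hi₀ a).trans ha)⟩
        · exact Or.inr ⟨a, f.injective ((hv₀ a).trans ha)⟩
    · exact Prod.ext (funext hi₀) (funext hv₀)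

end Regroup

section Count

variable {n : ℕ} (φ : VincularPattern)

/-- A triple is ordered like the word `w` exactly when it consists of increasing letters `v`, arranged
according to `w`; these letters are unique. -/
theorem order_iff (w : Perm (Fin 3)) (p : Fin 3 → Fin n) :
    (if ∀ a b, p a < p b ↔ w a < w b then 1 else 0) =
      ∑ v : Fin 3 → Fin n with StrictMono v, if ∀ a, p a = v (w a) then 1 else 0 := by
  have huniq : ∀ v : Fin 3 → Fin n, (∀ a, p a = v (w a)) ↔ v = fun b => p (w.symm b) := by
    intro v
    constructor
    · intro h; funext b; rw [h]; simp
    · rintro rfl a; simp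
  simp_rw [huniq]
  rw [Finset.sum_ite_eq']
  refine if_congr ?_ rfl rfl
  simp only [Finset.mem_filter, Finset.mem_univ, true_and]
  constructor
  · intro h a b hab
    exact (h _ _).2 (by simpa using hab)
  · intro h a b
    have := h.lt_iff_lt (a := w a) (b := w b)
    simpa using this

theorem count_eq (π : Perm (Fin n)) :
    φ.count π = ∑ i : Fin 3 → Fin n with StrictMono i ∧ φ.PositionsOK n (fun a => (i a).val),
      ∑ v : Fin 3 → Fin n with StrictMono v, if ∀ a, π (i a) = v (φ.word a) then 1 else 0 := by
  classical
  rw [Finset.sum_congr rfl fun i _ => (order_iff φ.word fun a => π (i a)).symm, count,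
    ← Finset.card_filter, Finset.filter_filter]
  refine congrArg Finset.card (Finset.ext fun i => ?_)
  rw [Finset.mem_filter, Finset.mem_filter]
  simp only [Finset.mem_univ, true_and, IsOccurrence, PositionsOK]
  tauto

theorem card_image_elim_comp {β : Type*} [DecidableEq β] {k : ℕ} (i v : Fin k → β)
    (w : Perm (Fin k)) : (Finset.univ.image (Sum.elim i fun a => v (w a))).card =
      (Finset.univ.image (Sum.elim i v)).card := by
  congr 1
  ext x
  simp only [Finset.mem_image, Finset.mem_univ, true_and, Sum.exists, Sum.elim_inl, Sum.elim_inr]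
  have h : (∃ a, v (w a) = x) ↔ ∃ a, v a = x :=
    ⟨fun ⟨a, h⟩ => ⟨w a, h⟩, fun ⟨a, h⟩ => ⟨w.symm a, by simpa using h⟩⟩
  rw [h]

/-- The number of occurrences of `φ` in all conjugates of `π`, sorted by the relative position of
the positions and the letters of an occurrence. -/
theorem sum_count_conj (hφ : φ.numConditions ≤ 3) (hn : 3 ≤ n) (π : Perm (Fin n)) :
    (∑ g : Perm (Fin n), φ.count (g * π * g⁻¹)) =
      ∑ z ∈ Finset.range 7, ∑ q ∈ localPairs z,
        (if φ.PositionsOK z fun a => q.1 a then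
          (n - φ.numConditions).choose (z - φ.numConditions) else 0) *
        ((n - z).factorial * embCount (fun a b => decide (q.2 (φ.word a) = q.1 b)) π) := by
  classical
  have h1 : (∑ g : Perm (Fin n), φ.count (g * π * g⁻¹)) =
      ∑ i : Fin 3 → Fin n with StrictMono i ∧ φ.PositionsOK n (fun a => (i a).val),
        ∑ v : Fin 3 → Fin n with StrictMono v,
          (n - (Finset.univ.image (Sum.elim i v)).card).factorial *
            embCount (fun a b => decide (v (φ.word a) = i b)) π := by
    simp_rw [count_eq]
    rw [Finset.sum_comm]
    refine Finset.sum_congr rfl fun i hi => ?_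
    rw [Finset.sum_comm]
    refine Finset.sum_congr rfl fun v hv => ?_
    have hi' := (Finset.mem_filter.1 hi).2.1
    have hv' := (Finset.mem_filter.1 hv).2
    rw [sum_conj_indicator π i (fun a => v (φ.word a)) hi'.injective
      (hv'.injective.comp φ.word.injective), card_image_elim_comp]
  rw [h1, sum_strictMono_pairs]
  refine Finset.sum_congr rfl fun z _ => Finset.sum_congr rfl fun q hq => ?_
  obtain ⟨⟨hi, hv⟩, hs⟩ := (mem_localPairs q).1 hq
  rw [← φ.card_strictMono_positionsOK hφ hn q.1 hi, Finset.card_eq_sum_ones, Finset.sum_mul]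
  refine Finset.sum_congr rfl fun f hf => ?_
  have hf' := (Finset.mem_filter.1 hf).2.1
  have hc : (Finset.univ.image (Sum.elim (fun a => f (q.1 a)) fun a => f (q.2 a))).card = z := by
    have : Finset.univ.image (Sum.elim (fun a => f (q.1 a)) fun a => f (q.2 a)) =
        Finset.univ.image f := by
      ext y
      simp only [Finset.mem_image, Finset.mem_univ, true_and, Sum.exists, Sum.elim_inl,
        Sum.elim_inr]
      constructor
      · rintro (⟨a, rfl⟩ | ⟨a, rfl⟩) <;> exact ⟨_, rfl⟩
      · rintro ⟨x, rfl⟩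
        rcases hs x with ⟨a, rfl⟩ | ⟨a, rfl⟩
        · exact Or.inl ⟨a, rfl⟩
        · exact Or.inr ⟨a, rfl⟩
    rw [this, Finset.card_image_of_injective _ hf'.injective, Finset.card_univ, Fintype.card_fin]
  rw [hc, one_mul]
  simp only [hf'.injective.eq_iff]

end Count

end VincularPattern

/-! ### Weights of a pattern -/

namespace VincularPattern

/-- The covering pairs of increasing triples of `localPairs z`, each preceded by `z`. -/
def configurations : List (ℕ × (Fin 3 → ℕ) × (Fin 3 → ℕ)) :=
  [
    (3, ![0, 1, 2], ![0, 1, 2]), (4, ![0, 1, 2], ![0, 1, 3]), (4, ![0, 1, 2], ![0, 2, 3]),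
    (4, ![0, 1, 2], ![1, 2, 3]), (4, ![0, 1, 3], ![0, 1, 2]), (4, ![0, 1, 3], ![0, 2, 3]),
    (4, ![0, 1, 3], ![1, 2, 3]), (4, ![0, 2, 3], ![0, 1, 2]), (4, ![0, 2, 3], ![0, 1, 3]),
    (4, ![0, 2, 3], ![1, 2, 3]), (4, ![1, 2, 3], ![0, 1, 2]), (4, ![1, 2, 3], ![0, 1, 3]),
    (4, ![1, 2, 3], ![0, 2, 3]), (5, ![0, 1, 2], ![0, 3, 4]), (5, ![0, 1, 2], ![1, 3, 4]),
    (5, ![0, 1, 2], ![2, 3, 4]), (5, ![0, 1, 3], ![0, 2, 4]), (5, ![0, 1, 3], ![1, 2, 4]),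
    (5, ![0, 1, 3], ![2, 3, 4]), (5, ![0, 1, 4], ![0, 2, 3]), (5, ![0, 1, 4], ![1, 2, 3]),
    (5, ![0, 1, 4], ![2, 3, 4]), (5, ![0, 2, 3], ![0, 1, 4]), (5, ![0, 2, 3], ![1, 2, 4]),
    (5, ![0, 2, 3], ![1, 3, 4]), (5, ![0, 2, 4], ![0, 1, 3]), (5, ![0, 2, 4], ![1, 2, 3]),
    (5, ![0, 2, 4], ![1, 3, 4]), (5, ![0, 3, 4], ![0, 1, 2]), (5, ![0, 3, 4], ![1, 2, 3]),
    (5, ![0, 3, 4], ![1, 2, 4]), (5, ![1, 2, 3], ![0, 1, 4]), (5, ![1, 2, 3], ![0, 2, 4]),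
    (5, ![1, 2, 3], ![0, 3, 4]), (5, ![1, 2, 4], ![0, 1, 3]), (5, ![1, 2, 4], ![0, 2, 3]),
    (5, ![1, 2, 4], ![0, 3, 4]), (5, ![1, 3, 4], ![0, 1, 2]), (5, ![1, 3, 4], ![0, 2, 3]),
    (5, ![1, 3, 4], ![0, 2, 4]), (5, ![2, 3, 4], ![0, 1, 2]), (5, ![2, 3, 4], ![0, 1, 3]),
    (5, ![2, 3, 4], ![0, 1, 4]), (6, ![0, 1, 2], ![3, 4, 5]), (6, ![0, 1, 3], ![2, 4, 5]),
    (6, ![0, 1, 4], ![2, 3, 5]), (6, ![0, 1, 5], ![2, 3, 4]), (6, ![0, 2, 3], ![1, 4, 5]),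
    (6, ![0, 2, 4], ![1, 3, 5]), (6, ![0, 2, 5], ![1, 3, 4]), (6, ![0, 3, 4], ![1, 2, 5]),
    (6, ![0, 3, 5], ![1, 2, 4]), (6, ![0, 4, 5], ![1, 2, 3]), (6, ![1, 2, 3], ![0, 4, 5]),
    (6, ![1, 2, 4], ![0, 3, 5]), (6, ![1, 2, 5], ![0, 3, 4]), (6, ![1, 3, 4], ![0, 2, 5]),
    (6, ![1, 3, 5], ![0, 2, 4]), (6, ![1, 4, 5], ![0, 2, 3]), (6, ![2, 3, 4], ![0, 1, 5]),
    (6, ![2, 3, 5], ![0, 1, 4]), (6, ![2, 4, 5], ![0, 1, 3]), (6, ![3, 4, 5], ![0, 1, 2])]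

theorem bind_localPairs :
    ((Finset.range 7).val.bind fun z => (localPairs z).val.map fun q =>
      (z, (fun a => (q.1 a).val), fun a => (q.2 a).val)) = (configurations : Multiset _) := by
  decide +kernel

theorem sum_localPairs {M : Type*} [AddCommMonoid M] (F : ℕ → (Fin 3 → ℕ) → (Fin 3 → ℕ) → M) :
    (∑ z ∈ Finset.range 7, ∑ q ∈ localPairs z,
      F z (fun a => (q.1 a).val) fun a => (q.2 a).val) =
      (configurations.map fun c => F c.1 c.2.1 c.2.2).sum := by
  have h := congrArg (fun s => (s.map fun c => F c.1 c.2.1 c.2.2).sum) bind_localPairs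
  simp only [Multiset.map_bind, Multiset.sum_bind, Multiset.map_map, Multiset.map_coe,
    Multiset.sum_coe, Function.comp_def] at h
  exact h

/-- The coefficient of the number of embeddings of the `t`-th partial injection in the mean of
`φ.count`, multiplied by `720` and by the falling factorial of `n` of length `numConditions`. The
factor `720 = 6!` is a common denominator for configurations of at most six points, and the division
is exact. -/
def classWeight (φ : VincularPattern) (t : Fin 10) : ℕ :=
  (configurations.map fun c =>
    if φ.PositionsOK c.1 c.2.1 ∧
        linkClass₃ (fun a b => decide (c.2.2 (φ.word a) = c.2.1 b)) = t then
      720 / (c.1 - φ.numConditions).factorial else 0).sum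

section Mean

variable {n : ℕ} (φ : VincularPattern)

theorem embCount_eq_sum_class (π : Perm (Fin n)) (R : Fin 3 → Fin 3 → Bool) (hR : IsLink R) :
    embCount R π = ∑ t, if linkClass₃ R = t then embCount (linkRep₃ t) π else 0 := by
  rw [Finset.sum_ite_eq, if_pos (Finset.mem_univ _), embCount_eq_rep₃ π R hR]

theorem isLink_configurations : ∀ c ∈ configurations, ∀ w : Perm (Fin 3),
    IsLink fun a b => decide (c.2.2 (w a) = c.2.1 b) := by
  have h : ∀ c ∈ configurations, Function.Injective c.2.1 ∧ Function.Injective c.2.2 := by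
    decide +kernel
  intro c hc w
  obtain ⟨hi, hv⟩ := h c hc
  refine ⟨fun a b d h1 h2 => ?_, fun a b d h1 h2 => ?_⟩
  · simp only [decide_eq_true_eq] at h1 h2
    exact hi (h1.symm.trans h2)
  · simp only [decide_eq_true_eq] at h1 h2
    exact w.injective (hv (h1.trans h2.symm))

theorem sum_map_mul_embCount {C : Type*} (π : Perm (Fin n)) (A : C → Prop) [DecidablePred A]
    (W : C → ℕ) (R : C → Fin 3 → Fin 3 → Bool) (L : List C) (hL : ∀ c ∈ L, IsLink (R c)) :
    (L.map fun c => (if A c then W c else 0) * embCount (R c) π).sum =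
      ∑ t, (L.map fun c => if A c ∧ linkClass₃ (R c) = t then W c else 0).sum *
        embCount (linkRep₃ t) π := by
  induction L with
  | nil => simp
  | cons c L ih =>
    simp only [List.map_cons, List.sum_cons, add_mul, Finset.sum_add_distrib]
    rw [ih fun d hd => hL d (List.mem_cons_of_mem _ hd),
      embCount_eq_sum_class π _ (hL c List.mem_cons_self), Finset.mul_sum]
    refine congrArg₂ (· + ·) (Finset.sum_congr rfl fun t _ => ?_) rfl
    by_cases h1 : A c <;> by_cases h2 : linkClass₃ (R c) = t <;> simp [h1, h2]

/-- The number of occurrences of `φ` in all conjugates of `π`, as a combination of the numbers of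
embeddings of partial injections in `π`. -/
theorem sum_count_conj_eq_classWeight (hφ : φ.numConditions ≤ 3) (hn : 3 ≤ n)
    (π : Perm (Fin n)) :
    (720 : ℕ) * (∑ g : Perm (Fin n), φ.count (g * π * g⁻¹)) =
      (n - φ.numConditions).factorial * ∑ t, φ.classWeight t * embCount (linkRep₃ t) π := by
  have key : ∀ z ∈ Finset.range 7, ∀ q ∈ localPairs z,
      720 * ((if φ.PositionsOK z fun a => q.1 a then
          (n - φ.numConditions).choose (z - φ.numConditions) else 0) *
        ((n - z).factorial * embCount (fun a b => decide (q.2 (φ.word a) = q.1 b)) π)) =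
      (n - φ.numConditions).factorial *
        ((if φ.PositionsOK z fun a => (q.1 a).val then 720 / (z - φ.numConditions).factorial
          else 0) *
        embCount (fun a b => decide ((q.2 (φ.word a)).val = (q.1 b).val)) π) := by
    intro z hz q hq
    obtain ⟨⟨hi, hv⟩, hs⟩ := (mem_localPairs q).1 hq
    simp only [Fin.val_inj]
    split_ifs with hP
    swap
    · simp
    -- for `z > n` the left-hand side has a vanishing binomial coefficient, but the right-hand side
    -- vanishes because there is no embedding
    rcases lt_or_ge n z with hnz | hnz
    · have himg : Finset.univ.image (Sum.elim q.1 fun a => q.2 (φ.word a)) = Finset.univ := by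
        ext x
        simp only [Finset.mem_image, Finset.mem_univ, true_and, iff_true, Sum.exists,
          Sum.elim_inl, Sum.elim_inr]
        refine (hs x).imp_right fun ⟨a, ha⟩ => ⟨φ.word.symm a, by simpa using ha⟩
      rw [embCount_eq_zero π q.1 (fun a => q.2 (φ.word a)) hi.injective
        (hv.injective.comp φ.word.injective) (by rw [himg]; simpa using hnz)]
      simp
    · have hz3 : 3 ≤ z := by
        simpa using Fintype.card_le_of_injective _ hi.injective
      have hz7 : z < 7 := Finset.mem_range.1 hz
      have hdvd : (z - φ.numConditions).factorial ∣ 720 := by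
        have h := Nat.factorial_dvd_factorial (show z - φ.numConditions ≤ 6 by omega)
        rwa [show Nat.factorial 6 = 720 by decide] at h
      have hch := Nat.choose_mul_factorial_mul_factorial
        (show z - φ.numConditions ≤ n - φ.numConditions by omega)
      rw [show n - φ.numConditions - (z - φ.numConditions) = n - z by omega] at hch
      obtain ⟨d, hd⟩ := hdvd
      rw [hd, Nat.mul_div_cancel_left _ (Nat.factorial_pos _), ← hch]
      ring
  rw [sum_count_conj φ hφ hn, Finset.mul_sum]
  rw [Finset.sum_congr rfl fun z hz => by
    rw [Finset.mul_sum, Finset.sum_congr rfl (key z hz), ← Finset.mul_sum]]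
  rw [← Finset.mul_sum, sum_localPairs fun z i v =>
    (if φ.PositionsOK z i then 720 / (z - φ.numConditions).factorial else 0) *
      embCount (fun a b => decide (v (φ.word a) = i b)) π]
  rw [sum_map_mul_embCount π _ _ (fun c => fun a b => decide (c.2.2 (φ.word a) = c.2.1 b)) _
    fun c hc => isLink_configurations c hc φ.word]
  rfl

/-- The mean of `φ.count` as a polynomial in the numbers of points on short cycles. -/
theorem meanStatistic_count (hφ : φ.numConditions ≤ 3) (hn : 3 ≤ n) (π : Perm (Fin n)) :
    meanStatistic (fun τ => (φ.count τ : ℝ)) π =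
      (((∑ t, φ.classWeight t * embPoly₃ n (numFix π) (numTwo π) (numThree π) t) /
        (720 * n.descFactorial φ.numConditions) : ℚ) : ℝ) := by
  have h := φ.sum_count_conj_eq_classWeight hφ hn π
  have h' := congrArg (Nat.cast : ℕ → ℚ) h
  push_cast [embCount_linkRep₃ π hn] at h'
  have hfac := Nat.factorial_mul_descFactorial (show φ.numConditions ≤ n by omega)
  have hq : ((∑ g : Perm (Fin n), φ.count (g * π * g⁻¹) : ℕ) : ℚ) / n.factorial =
      (∑ t, φ.classWeight t * embPoly₃ n (numFix π) (numTwo π) (numThree π) t) /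
        (720 * n.descFactorial φ.numConditions) := by
    have h1 : ((n - φ.numConditions).factorial : ℚ) ≠ 0 := by
      exact_mod_cast (Nat.factorial_pos _).ne'
    have h2 : (n.descFactorial φ.numConditions : ℚ) ≠ 0 := by
      exact_mod_cast (Nat.descFactorial_pos.2 (by omega)).ne'
    rw [← hfac]
    push_cast
    rw [div_eq_div_iff (by positivity) (by positivity)]
    linear_combination (n.descFactorial φ.numConditions : ℚ) * h'
  rw [meanStatistic_eq, ← hq]
  push_cast
  rfl

end Mean

end VincularPattern

/-! ### The coefficients in the tables -/

theorem cast_choose_three (m : ℕ) : (m.choose 3 : ℚ) = m * (m - 1) * (m - 2) / 6 := by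
  rw [← cast_descFactorial_three, Nat.descFactorial_eq_factorial_mul_choose]
  simp [Nat.factorial]

theorem cast_pred_choose_two {m : ℕ} (hm : 3 ≤ m) :
    ((m - 1).choose 2 : ℚ) = (m - 1) * (m - 2) / 2 := by
  rw [Nat.cast_choose_two, Nat.cast_sub (by omega)]
  push_cast
  ring

/-- The mean of every pattern of the row is the combination of characters given by the row. -/
def TableRow.IsMean {n : ℕ} (hn : 3 ≤ n) (row : TableRow) : Prop :=
  ∀ φ ∈ row.patterns, ∀ π : Perm (Fin n),
    ((meanStatistic (fun τ => (φ.count τ : ℝ)) π : ℝ) : ℂ) =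
      ∑ j : Fin 5, ((row.coeff j : ℚ) : ℂ) * chiVec hn j π

section Rows

open VincularPattern

variable {n : ℕ}

/-- The mean of every pattern of a row is as stated if the patterns have the same weights `k`, and
if `k` and the coefficients of the row give the same polynomial in the numbers of points on
cycles of length at most three. -/
theorem mean_of_classWeight (hn : 3 ≤ n) {ps : List VincularPattern} {co : Fin 5 → ℚ} (c : ℕ)
    (k : Fin 10 → ℕ)
    (hk : ∀ φ ∈ ps, φ.numConditions = c ∧ c ≤ 3 ∧ ∀ t, φ.classWeight t = k t)
    (hid : ∀ f t w : ℚ, ∑ s, k s * embPoly₃ n f t w s =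
      (∑ j, co j * chiPoly f t w j) * (720 * n.descFactorial c)) :
    (TableRow.mk ps co).IsMean hn := by
  intro φ hφ π
  obtain ⟨hc, hc3, hw⟩ := hk φ hφ
  have h0 : (720 * n.descFactorial c : ℚ) ≠ 0 := by
    have := Nat.descFactorial_pos.2 (hc3.trans hn)
    positivity
  rw [meanStatistic_count φ (hc.trans_le hc3) hn, hc]
  simp only [hw, hid, chiVec_eq]
  rw [mul_div_cancel_right₀ _ h0]
  push_cast
  rfl

set_option maxHeartbeats 4000000 in
theorem isMean_table₁ (hn : 3 ≤ n) : ∀ row ∈ table₁ n, row.IsMean hn := by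
  have h3 : (3 : ℚ) ≤ n := by exact_mod_cast hn
  have n0 : (n : ℚ) ≠ 0 := by linarith
  have n1 : (n : ℚ) - 1 ≠ 0 := by linarith
  have n2 : (n : ℚ) - 2 ≠ 0 := by linarith
  simp only [table₁, List.forall_mem_cons]
  refine ⟨
    mean_of_classWeight hn 0 ![20, 96, 84, 180, 120, 0, 60, 120, 0, 0] (by decide +kernel) ?_,
    mean_of_classWeight hn 0 ![20, 72, 108, 60, 180, 60, 60, 0, 120, 0] (by decide +kernel) ?_,
    mean_of_classWeight hn 0 ![20, 42, 138, 30, 60, 60, 210, 0, 0, 120] (by decide +kernel) ?_,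
    mean_of_classWeight hn 0 ![20, 36, 144, 0, 120, 120, 120, 0, 120, 0] (by decide +kernel) ?_,
    mean_of_classWeight hn 1 ![60, 240, 300, 480, 360, 0, 240, 360, 0, 0] (by decide +kernel) ?_,
    mean_of_classWeight hn 1 ![60, 180, 360, 120, 600, 120, 240, 0, 360, 0] (by decide +kernel) ?_,
    mean_of_classWeight hn 1 ![60, 240, 300, 240, 480, 240, 120, 0, 360, 0] (by decide +kernel) ?_,
    mean_of_classWeight hn 1 ![60, 120, 420, 120, 120, 240, 600, 0, 0, 360] (by decide +kernel) ?_,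
    mean_of_classWeight hn 1 ![60, 180, 360, 120, 240, 120, 600, 0, 0, 360] (by decide +kernel) ?_,
    mean_of_classWeight hn 1 ![60, 120, 420, 0, 360, 360, 360, 0, 360, 0] (by decide +kernel) ?_,
    mean_of_classWeight hn 1 ![60, 330, 210, 600, 360, 0, 120, 360, 0, 0] (by decide +kernel) ?_,
    mean_of_classWeight hn 1 ![60, 270, 270, 240, 600, 120, 120, 0, 360, 0] (by decide +kernel) ?_,
    mean_of_classWeight hn 1 ![60, 180, 360, 120, 480, 240, 240, 0, 360, 0] (by decide +kernel) ?_,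
    mean_of_classWeight hn 1 ![60, 60, 480, 0, 120, 240, 720, 0, 0, 360] (by decide +kernel) ?_,
    mean_of_classWeight hn 1 ![60, 150, 390, 120, 240, 120, 600, 0, 0, 360] (by decide +kernel) ?_,
    mean_of_classWeight hn 1 ![60, 90, 450, 0, 360, 360, 360, 0, 360, 0] (by decide +kernel) ?_,
    mean_of_classWeight hn 2 ![120, 600, 480, 1080, 720, 0, 360, 720, 0, 0] (by decide +kernel) ?_,
    mean_of_classWeight hn 2 ![120, 240, 840, 0, 1080, 360, 720, 0, 720, 0] (by decide +kernel) ?_,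
    mean_of_classWeight hn 2 ![120, 600, 480, 720, 1080, 360, 0, 0, 720, 0] (by decide +kernel) ?_,
    mean_of_classWeight hn 2 ![120, 240, 840, 360, 360, 360, 1080, 0, 0, 720] (by decide +kernel) ?_,
    mean_of_classWeight hn 2 ![120, 240, 840, 0, 360, 360, 1440, 0, 0, 720] (by decide +kernel) ?_,
    mean_of_classWeight hn 2 ![120, 240, 840, 0, 720, 720, 720, 0, 720, 0] (by decide +kernel) ?_,
    mean_of_classWeight hn 2 ![120, 480, 600, 1080, 720, 0, 360, 720, 0, 0] (by decide +kernel) ?_,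
    mean_of_classWeight hn 2 ![120, 480, 600, 360, 1440, 0, 360, 0, 720, 0] (by decide +kernel) ?_,
    mean_of_classWeight hn 2 ![120, 480, 600, 360, 720, 720, 360, 0, 720, 0] (by decide +kernel) ?_,
    mean_of_classWeight hn 2 ![120, 120, 960, 0, 0, 720, 1440, 0, 0, 720] (by decide +kernel) ?_,
    mean_of_classWeight hn 2 ![120, 480, 600, 360, 720, 0, 1080, 0, 0, 720] (by decide +kernel) ?_,
    mean_of_classWeight hn 2 ![120, 120, 960, 0, 720, 720, 720, 0, 720, 0] (by decide +kernel) ?_,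
    mean_of_classWeight hn 2 ![120, 840, 240, 1440, 720, 0, 0, 720, 0, 0] (by decide +kernel) ?_,
    mean_of_classWeight hn 2 ![120, 480, 600, 360, 1080, 360, 360, 0, 720, 0] (by decide +kernel) ?_,
    mean_of_classWeight hn 2 ![120, 120, 960, 0, 360, 360, 1440, 0, 0, 720] (by decide +kernel) ?_,
    List.forall_mem_nil _⟩
  all_goals
    intro f t w
    simp only [Fin.sum_univ_succ, embPoly₃, chiPoly, cast_choose_three, cast_pred_choose_two hn,
      Nat.cast_descFactorial_two]
    simp
    field_simp
    ring

set_option maxHeartbeats 4000000 in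
theorem isMean_table₂ (hn : 3 ≤ n) : ∀ row ∈ table₂ n, row.IsMean hn := by
  have h3 : (3 : ℚ) ≤ n := by exact_mod_cast hn
  have n0 : (n : ℚ) ≠ 0 := by linarith
  have n1 : (n : ℚ) - 1 ≠ 0 := by linarith
  have n2 : (n : ℚ) - 2 ≠ 0 := by linarith
  simp only [table₂, List.forall_mem_cons]
  refine ⟨
    mean_of_classWeight hn 2 ![120, 360, 720, 720, 720, 0, 720, 720, 0, 0] (by decide +kernel) ?_,
    mean_of_classWeight hn 2 ![120, 360, 720, 360, 1080, 360, 360, 0, 720, 0] (by decide +kernel) ?_,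
    mean_of_classWeight hn 2 ![120, 360, 720, 360, 360, 360, 1080, 0, 0, 720] (by decide +kernel) ?_,
    mean_of_classWeight hn 2 ![120, 360, 720, 0, 720, 720, 720, 0, 720, 0] (by decide +kernel) ?_,
    mean_of_classWeight hn 3 ![120, 360, 720, 720, 720, 0, 720, 720, 0, 0] (by decide +kernel) ?_,
    mean_of_classWeight hn 3 ![120, 360, 720, 720, 1440, 0, 0, 0, 720, 0] (by decide +kernel) ?_,
    mean_of_classWeight hn 3 ![120, 360, 720, 0, 720, 720, 720, 0, 720, 0] (by decide +kernel) ?_,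
    mean_of_classWeight hn 3 ![120, 360, 720, 0, 0, 720, 1440, 0, 0, 720] (by decide +kernel) ?_,
    mean_of_classWeight hn 3 ![120, 360, 720, 720, 720, 0, 720, 0, 0, 720] (by decide +kernel) ?_,
    mean_of_classWeight hn 3 ![120, 720, 360, 1440, 720, 0, 0, 720, 0, 0] (by decide +kernel) ?_,
    mean_of_classWeight hn 3 ![120, 360, 720, 0, 1440, 0, 720, 0, 720, 0] (by decide +kernel) ?_,
    mean_of_classWeight hn 3 ![120, 720, 360, 720, 720, 720, 0, 0, 720, 0] (by decide +kernel) ?_,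
    mean_of_classWeight hn 3 ![120, 0, 1080, 0, 0, 720, 1440, 0, 0, 720] (by decide +kernel) ?_,
    mean_of_classWeight hn 3 ![120, 360, 720, 0, 720, 0, 1440, 0, 0, 720] (by decide +kernel) ?_,
    mean_of_classWeight hn 3 ![120, 0, 1080, 0, 720, 720, 720, 0, 720, 0] (by decide +kernel) ?_,
    List.forall_mem_nil _⟩
  all_goals
    intro f t w
    simp only [Fin.sum_univ_succ, embPoly₃, chiPoly, cast_descFactorial_three,
      Nat.cast_descFactorial_two]
    simp
    field_simp
    ring

end Rows

/-! ### The list of patterns, and the patterns with four conditions -/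

namespace VincularPattern

instance : DecidableEq VincularPattern := fun _ _ => decidable_of_iff' _ VincularPattern.ext_iff

theorem exists_mem_patterns_zero : ∀ w : Perm (Fin 3), ∀ a b c d : Bool,
    (⟨w, a, b, c, d⟩ : VincularPattern).numConditions ≤ 3 →
      ∃ ps ∈ (table₁ 0 ++ table₂ 0).map TableRow.patterns, ⟨w, a, b, c, d⟩ ∈ ps := by
  decide +kernel

theorem exists_mem_patterns (n : ℕ) (φ : VincularPattern) (hφ : φ.numConditions ≤ 3) :
    ∃ row ∈ table₁ n ++ table₂ n, φ ∈ row.patterns := by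
  obtain ⟨ps, hps, h⟩ := exists_mem_patterns_zero φ.1 φ.2 φ.3 φ.4 φ.5 hφ
  -- the patterns of the tables do not depend on `n`
  have hps' : ps ∈ (table₁ n ++ table₂ n).map TableRow.patterns := hps
  obtain ⟨row, hrow, rfl⟩ := List.mem_map.1 hps'
  exact ⟨row, hrow, h⟩

theorem isOccurrence_sXXXs_iff (w : Perm (Fin 3)) (π : Perm (Fin 3)) (i : Fin 3 → Fin 3) :
    (sXXXs w).IsOccurrence π i ↔ (rXXXr w).IsOccurrence π i := by
  constructor
  · rintro ⟨hi, h, -, h1, h2, -⟩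
    exact ⟨hi, h, fun h => absurd h Bool.false_ne_true, h1, h2,
      fun h => absurd h Bool.false_ne_true⟩
  · rintro ⟨hi, h, -, h1, h2, -⟩
    refine ⟨hi, h, fun _ => ?_, h1, h2, fun _ => ?_⟩ <;>
    · have := h1 rfl
      have := h2 rfl
      have := (i 2).2
      omega

theorem count_sXXXs_eq (w : Perm (Fin 3)) (π : Perm (Fin 3)) :
    (sXXXs w).count π = (rXXXr w).count π := by
  classical
  exact congrArg Finset.card (Finset.filter_congr fun i _ => isOccurrence_sXXXs_iff w π i)

/-- An occurrence of `[abc]` fills all of `Fin n`, so that `n = 3`. -/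
theorem count_sXXXs_eq_zero {n : ℕ} (hn : 3 < n) (w : Perm (Fin 3)) (π : Perm (Fin n)) :
    (sXXXs w).count π = 0 := by
  classical
  rw [count, Finset.card_eq_zero, Finset.filter_eq_empty_iff]
  rintro i - ⟨-, -, h0, h1, h2, h3⟩
  have := h0 rfl
  have := h1 rfl
  have := h2 rfl
  have := h3 rfl
  omega

end VincularPattern

/-- Means of the statistics counting vincular 3-patterns, as linear combinations of irreducible
characters. The patterns `[abc]`, with four conditions, are not listed in the tables: they agree
with `(abc)` for `n = 3` and do not occur for `n > 3`. -/
theorem mainTheorem1 (n : ℕ) (hn : 3 ≤ n) :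
    (∀ φ : VincularPattern, φ.numConditions ≤ 3 →
      ∃ row ∈ table₁ n ++ table₂ n, φ ∈ row.patterns) ∧
    (∀ row ∈ table₁ n ++ table₂ n, ∀ φ ∈ row.patterns, ∀ π : Equiv.Perm (Fin n),
      ((meanStatistic (fun τ => (φ.count τ : ℝ)) π : ℝ) : ℂ) =
        ∑ j : Fin 5, ((row.coeff j : ℚ) : ℂ) * chiVec hn j π) ∧
    (∀ (w : Equiv.Perm (Fin 3)) (π : Equiv.Perm (Fin n)),
      meanStatistic (fun τ => ((VincularPattern.sXXXs w).count τ : ℝ)) π =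
        if n = 3 then meanStatistic (fun τ => ((VincularPattern.rXXXr w).count τ : ℝ)) π
        else 0) := by
  refine ⟨VincularPattern.exists_mem_patterns n, fun row hrow => ?_, fun w π => ?_⟩
  · exact (List.mem_append.1 hrow).elim (isMean_table₁ hn row) (isMean_table₂ hn row)
  · split_ifs with h
    · subst h
      simp only [VincularPattern.count_sXXXs_eq]
    · simp [VincularPattern.count_sXXXs_eq_zero (show 3 < n by omega), meanStatistic]
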